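/- **Theorem.** Fix integers $g,n\ge 0$ with $2g-2+n>0$. *Graphs.* Graphs are finite, vertex-weighted (by the genus $h(v)\ge 0$) and have $n$ marked legs; a *morphism* $\pi:G\to G'$ is a weighted edge contraction followed by an isomorphism. A connected graph of total genus $g$ is *stable* if $2h(v)-2+\mathrm{val}(v)>0$ for all vertices $v$. It is *quasi-stable* if every vertex of genus $0$ has valence at least $2$, every vertex of genus $0$ and valence $2$ (*exceptional* vertex) is incident to exactly two edges, and no two distinct exceptional vertices are adjacent. The *stabilization* $G^{\rm st}$ is obtained from $G$ by replacing each exceptional vertex $v$ and its two edges $e_v^1,e_v^2$ by one (*exceptional*) edge $e_v$; it is functorial: $\pi^{\rm st}$ contracts $e_v$ if and only if $\pi$ contracts both $e_v^1$ and $e_v^2$. For a metric on $G$, the length of $e_v$ in $G^{\rm st}$ is the sum of the lengths of $e_v^1$ and $e_v^2$, and the other edges keep their lengths. Let $SG_{g,n}$ be the category of stable graphs, and let $QD_{g,n}$ be the category of pairs $(G,D)$ of a quasi-stable graph $G$ and a divisor $D$ on $G$ that is *admissible*, i.e. $D(v)=1$ for all exceptional $v$; its morphisms are the morphisms $\pi:G\to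 G'$ of graphs with $\pi_*D=D'$. *Stability.* $(G,D)$ is *simple* if $G$ remains connected after removing its exceptional vertices (and the edges at them). A *universal stability condition* $\phi$ consists of functions $\phi_G:V(G)\to\mathbb R$ with $\sum_v\phi_G(v)\in\mathbb Z$, for all stable $G$, that are compatible with push-forward along all morphisms; for quasi-stable $G$ put $\phi_G=0$ at exceptional vertices and $\phi_G=\phi_{G^{\rm st}}$ at the others. $(G,D)$ is *$\phi$-semistable* if $\deg D=\sum_v \phi_G(v)$ and $|D(S)-\phi_G(S)|\le \tfrac12|E(S,S^c)|$ for all $S\subseteq V(G)$. *Topological stacks.* Let $\mathcal C$ be $SG_{g,n}$ or $QD_{g,n}$ or one of the full subcategories $\mathcal Q\subseteq QD_{g,n}$ below. The topological realization of the corresponding cone stack is the stack on topological spaces, for the topology generated by open coverings and by coverings by finitely many closed subsets, associated with the prestack whose objects over $T$ are pairs $(x,l)$ of an object $x$ of $\mathcal C$, with underlying graph $G$, and a continuous map $l:T\to\mathbb R_{\ge 0}^{E(G)}$, where $x$ may be replaced by $x'$, for any morphism $x\to x'$ in $\mathcal C$, if the edges that are contracted by it have length $0$ everywhere. Its objects over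 a point are the objects of $\mathcal C$ together with a metric $E(G)\to\mathbb R_{>0}$. This defines $|\mathcal M^{\rm trop}_{g,n}|$ (for $SG_{g,n}$), $|\mathcal J^{\rm trop}_{g,n}|$ (for $QD_{g,n}$) and its substacks $|\mathcal J^{\rm trop}_{\mathcal Q}|$. Stabilization of curves with edge lengths (forgetting $D$) defines a morphism $|\Phi^{\rm trop}|:|\mathcal J^{\rm trop}_{g,n}|\to|\mathcal M^{\rm trop}_{g,n}|$ and its restrictions to the substacks. *Jacobian.* Let $\overline\Gamma$ be a stable tropical curve of type $(g,n)$ with real edge lengths, i.e. a stable graph $\overline G$ with a metric $d:E(\overline G)\to\mathbb R_{>0}$. Let $QD_{\overline G}$ be the category of triples $(G,D,\rho)$ with $(G,D)\in QD_{g,n}$ and $\rho:\overline G\cong G^{\rm st}$, whose morphisms are the morphisms $\pi$ in $QD_{g,n}$ with $\pi^{\rm st}\circ\rho=\rho'$. Choose an orientation (one half-edge) of each edge of $\overline G$; through $\rho$, it orders the two edges $e^1,e^2$ of $G$ that make up an exceptional edge $e$ of $G^{\rm st}$. Identify $E(\overline G)$ with $E(G^{\rm st})$ by $\rho$. The *Jacobian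 topological space* $\mathrm{Jac}_{\overline\Gamma}$ is the colimit in topological spaces of the functor $QD_{\overline G}^{\rm op}\to \mathrm{Top}$ with $$P(G,D,\rho)=\prod_{e\in E_{\rm exc}(G^{\rm st})}[0,d(e)],$$ where $\pi:(G,D,\rho)\to(G',D',\rho')$ induces the map $P(G',D',\rho')\to P(G,D,\rho)$ that is the identity on the coordinates $e$ that are exceptional for both, and that takes as coordinate at an edge $e$ exceptional for $G$ but not for $G'$ the value $0$ if $\pi$ contracts $e^1$, and $d(e)$ if $\pi$ contracts $e^2$. For a full subcategory $\mathcal Q\subseteq QD_{g,n}$, the space $\mathrm{Jac}_{\overline\Gamma,\mathcal Q}$ is the colimit of the same functor over the full subcategory of triples with $(G,D)\in\mathcal Q$. *Claim.* For every $\overline\Gamma$ and every orientation, there is a cartesian (2-fibre product) diagram of stacks over topological spaces $$\begin{array}{ccc}\mathrm{Jac}_{\overline\Gamma}&\longrightarrow&|\mathcal J^{\rm trop}_{g,n}|\\ \downarrow&&\downarrow{\scriptstyle|\Phi^{\rm trop}|}\\ \star&\xrightarrow{\ \overline\Gamma\ }&|\mathcal M^{\rm trop}_{g,n}|\end{array}$$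 where $\star\to|\mathcal M^{\rm trop}_{g,n}|$ is the modular morphism of $\overline\Gamma$. The same holds with $\mathrm{Jac}_{\overline\Gamma,\mathcal Q}$ and $|\mathcal J^{\rm trop}_{\mathcal Q}|$ instead of $\mathrm{Jac}_{\overline\Gamma}$ and $|\mathcal J^{\rm trop}_{g,n}|$, where $\mathcal Q$ consists of the pairs $(G,D)$ that are: of degree $\deg D=d$ (any $d\in\mathbb Z$); simple; simple and of degree $d$; $\phi$-semistable (any universal stability condition $\phi$, not necessarily general). -/

import Mathlib

namespace Trop

open CategoryTheory

section Graphs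

/-- A finite `n`-marked vertex-weighted graph: a finite set `X` with a root map `r` and an
involution `i`.  The vertices are the fixed points (equivalently, the image) of `r`, all other
elements are flags; the flags fixed by `i` are the legs, the other ones the half-edges. -/
structure MGraph (n : ℕ) where
  X : Type
  finite_X : Finite X
  r : X → X
  i : X → X
  r_r : ∀ x, r (r x) = r x
  i_i : ∀ x, i (i x) = x
  i_r : ∀ x, i (r x) = r x
  /-- the genus of a vertex -/
  h : {v : X // r v = v} → ℕ
  /-- the marking of the legs -/
  m : Fin n ≃ {x : X // i x = x ∧ r x ≠ x}

namespace MGraph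

variable {n : ℕ} (G : MGraph n)

noncomputable instance : Fintype G.X := @Fintype.ofFinite _ G.finite_X

/-- vertices -/
abbrev V : Type := {v : G.X // G.r v = v}

/-- half-edges (these are automatically flags) -/
abbrev H : Type := {x : G.X // G.i x ≠ x}

/-- two half-edges belong to the same edge if they are equal or conjugate -/
def edgeSetoid : Setoid G.H where
  r x y := y.1 = x.1 ∨ y.1 = G.i x.1
  iseqv :=
    ⟨fun _ => Or.inl rfl,
     fun {x y} h => by
      rcases h with h | h
      · exact Or.inl h.symm
      · right; rw [h, G.i_i],
     fun {x y z} h h' => by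
      rcases h with h | h <;> rcases h' with h' | h'
      · left; rw [h', h]
      · right; rw [h', h]
      · right; rw [h', h]
      · left; rw [h', h, G.i_i]⟩

/-- edges: the quotient of the set of half-edges by the involution -/
def E : Type := Quotient G.edgeSetoid

/-- the edge of a half-edge -/
def edge (x : G.X) (hx : G.i x ≠ x) : G.E := Quotient.mk G.edgeSetoid ⟨x, hx⟩

noncomputable instance : Fintype G.H := @Fintype.ofFinite _ inferInstance
noncomputable instance : Fintype G.V := @Fintype.ofFinite _ inferInstance
noncomputable instance : Fintype G.E :=
  @Fintype.ofFinite _ (inferInstanceAs (Finite (Quotient G.edgeSetoid)))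

/-- the valence of a vertex: the number of flags rooted at it -/
noncomputable def val (v : G.X) : ℕ := by
  classical exact (Finset.univ.filter fun x : G.X => G.r x ≠ x ∧ G.r x = v).card

/-- `a` and `b` are the roots of an element of `S` and of its conjugate -/
def Step (S : Set G.X) (a b : G.X) : Prop := ∃ x ∈ S, G.r x = a ∧ G.r (G.i x) = b

/-- The subgraph of `G` with underlying set `S` (which is closed under `r` and `i` whenever this
is used) is connected: it has a vertex, and any two vertices are joined by a path of edges. -/
def ConnOn (S : Set G.X) : Prop :=
  (∃ v ∈ S, G.r v = v) ∧
    ∀ a ∈ S, ∀ b ∈ S, G.r a = a → G.r b = b → Relation.ReflTransGen (G.Step S) a b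

/-- The genus `b₁ + ∑ h(v)` of the connected subgraph of `G` with underlying set `S`, where
`b₁ = #edges - #vertices + 1`. -/
noncomputable def genusOn (S : Set G.X) : ℤ := by
  classical exact
    ((Finset.univ.filter fun e : G.E => ∀ x hx, G.edge x hx = e → x ∈ S).card : ℤ)
      - ((Finset.univ.filter fun v : G.V => v.1 ∈ S).card : ℤ) + 1
      + ∑ v : G.V, if v.1 ∈ S then (G.h v : ℤ) else 0

/-- Morphisms of `n`-marked vertex-weighted graphs (weighted edge contractions followed by
isomorphisms).  In `flag` the unique preimage of a flag is automatically a flag, and by `leg` the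
legs are mapped bijectively to the legs. -/
@[ext]
structure Hom (G G' : MGraph n) where
  f : G.X → G'.X
  map_r : ∀ x, f (G.r x) = G'.r (f x)
  map_i : ∀ x, f (G.i x) = G'.i (f x)
  flag : ∀ y, G'.r y ≠ y → ∃! x, f x = y
  leg : ∀ j, f (G.m j).1 = (G'.m j).1
  conn : ∀ v : G'.V, G.ConnOn (f ⁻¹' {v.1})
  genus : ∀ v : G'.V, G.genusOn (f ⁻¹' {v.1}) = G'.h v

/-! Helper facts: the genus as a weighted count. -/

open scoped Classical in
noncomputable def hX (x : G.X) : ℤ := if hx : G.r x = x then (G.h ⟨x, hx⟩ : ℤ) else 0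

open scoped Classical in
/-- weight of an element in the count of `2 * genus - 2` -/
noncomputable def om (x : G.X) : ℤ :=
  (if G.i x ≠ x then 1 else 0) + (if G.r x = x then 2 * G.hX x - 2 else 0)

variable {G}

lemma flag_of_half {x : G.X} (hx : G.i x ≠ x) : G.r x ≠ x := fun h => hx (by
  conv_lhs => rw [← h, G.i_r]
  exact h)

lemma half_i {x : G.X} (hx : G.i x ≠ x) : G.i (G.i x) ≠ G.i x := fun h => hx (by
  rw [G.i_i] at h; exact h.symm)

lemma edge_i {x : G.X} (hx : G.i x ≠ x) (hx' : G.i (G.i x) ≠ G.i x) :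
    G.edge (G.i x) hx' = G.edge x hx :=
  Quotient.sound (s := G.edgeSetoid) (Or.inr (G.i_i x).symm)

lemma edge_eq_iff {x y : G.X} (hx : G.i x ≠ x) (hy : G.i y ≠ y) :
    G.edge x hx = G.edge y hy ↔ y = x ∨ y = G.i x :=
  ⟨fun h => Quotient.exact (s := G.edgeSetoid) h, fun h => Quotient.sound (s := G.edgeSetoid) h⟩

lemma edge_ind {p : G.E → Prop} (H : ∀ x hx, p (G.edge x hx)) (e : G.E) : p e :=
  Quotient.ind (s := G.edgeSetoid) (fun x => H x.1 x.2) e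

open scoped Classical in
lemma card_half (S : Set G.X) (hS : ∀ x ∈ S, G.i x ∈ S) :
    (Finset.univ.filter fun x : G.X => G.i x ≠ x ∧ x ∈ S).card
      = 2 * (Finset.univ.filter fun e : G.E => ∀ x hx, G.edge x hx = e → x ∈ S).card := by
  let φ : G.X → Option G.E := fun x => if hx : G.i x ≠ x then some (G.edge x hx) else none
  set A := Finset.univ.filter fun x : G.X => G.i x ≠ x ∧ x ∈ S
  set B := Finset.univ.filter fun e : G.E => ∀ x hx, G.edge x hx = e → x ∈ S
  have hmap : ∀ x ∈ A, φ x ∈ B.map Function.Embedding.some := by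
    intro x hx
    simp only [A, Finset.mem_filter, Finset.mem_univ, true_and] at hx
    simp only [φ, dif_pos hx.1, Finset.mem_map, B, Finset.mem_filter, Finset.mem_univ, true_and]
    refine ⟨_, fun y hy hxy => ?_, rfl⟩
    rcases (edge_eq_iff _ _).1 hxy with h | h
    · rw [← h]; exact hx.2
    · have := hS _ hx.2
      rwa [h, G.i_i] at this
  have key := Finset.card_eq_sum_card_fiberwise hmap
  rw [key, Finset.sum_map]
  rw [Finset.sum_congr rfl (g := fun _ => 2), Finset.sum_const, smul_eq_mul, mul_comm]
  intro e he
  induction e using edge_ind with | H x hx =>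
  simp only [B, Finset.mem_filter, Finset.mem_univ, true_and] at he
  rw [Finset.card_eq_two]
  refine ⟨x, G.i x, fun h => hx h.symm, ?_⟩
  have hxS := he x hx rfl
  ext y
  simp only [A, φ, Finset.mem_filter, Finset.mem_univ, true_and, Finset.mem_insert,
    Finset.mem_singleton, Function.Embedding.some_apply]
  constructor
  · rintro ⟨⟨hy, _⟩, h⟩
    rw [dif_pos hy] at h
    exact (edge_eq_iff hx hy).1 (Option.some.inj h).symm
  · rintro (h | h)
    · subst h; exact ⟨⟨hx, hxS⟩, by rw [dif_pos hx]⟩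
    · subst h; exact ⟨⟨half_i hx, hS _ hxS⟩, by rw [dif_pos (half_i hx), edge_i hx]⟩

open scoped Classical in
lemma sum_V {M : Type*} [AddCommMonoid M] (F : G.V → M) :
    ∑ v : G.V, F v = ∑ x : G.X, if hx : G.r x = x then F ⟨x, hx⟩ else 0 := by
  have h1 : ∑ v : G.V, F v = ∑ v : G.V,
      (fun x : G.X => if hx : G.r x = x then F ⟨x, hx⟩ else 0) v.1 :=
    Finset.sum_congr rfl fun v _ => by simp [v.2]
  rw [h1]
  have h2 := Finset.sum_subtype_of_mem (s := Finset.univ.filter fun x : G.X => G.r x = x)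
    (p := fun x => G.r x = x)
    (fun x : G.X => if hx : G.r x = x then F ⟨x, hx⟩ else 0) (by simp)
  rw [← Finset.sum_filter_of_ne (p := fun x => G.r x = x) (s := Finset.univ)]
  · rw [← h2]
    apply Finset.sum_congr
    · ext v; simp [v.2]
    · intros; rfl
  · intro x _ hx; by_contra h; simp [h] at hx

open scoped Classical in
lemma genus_om (S : Set G.X) (hS : ∀ x ∈ S, G.i x ∈ S) :
    2 * G.genusOn S - 2 = ∑ x : G.X, if x ∈ S then G.om x else 0 := by
  have hE := card_half S hS
  have hH : ((Finset.univ.filter fun x : G.X => G.i x ≠ x ∧ x ∈ S).card : ℤ)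
      = ∑ x : G.X, if x ∈ S then (if G.i x ≠ x then 1 else 0) else 0 := by
    rw [Finset.card_filter]; push_cast
    refine Finset.sum_congr rfl fun x _ => ?_
    by_cases h1 : x ∈ S <;> by_cases h2 : G.i x = x <;> simp [h1, h2]
  have hV : ((Finset.univ.filter fun v : G.V => v.1 ∈ S).card : ℤ)
      = ∑ x : G.X, if x ∈ S then (if G.r x = x then 1 else 0) else 0 := by
    rw [Finset.card_filter]; push_cast
    rw [sum_V]
    refine Finset.sum_congr rfl fun x _ => ?_
    by_cases h1 : x ∈ S <;> by_cases h2 : G.r x = x <;> simp [h1, h2]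
  have hh : (∑ v : G.V, if v.1 ∈ S then (G.h v : ℤ) else 0)
      = ∑ x : G.X, if x ∈ S then (if G.r x = x then G.hX x else 0) else 0 := by
    rw [sum_V]
    refine Finset.sum_congr rfl fun x _ => ?_
    by_cases h1 : x ∈ S <;> by_cases h2 : G.r x = x <;> simp [h1, h2, hX]
  have e : (∑ x : G.X, if x ∈ S then G.om x else 0)
      = (∑ x : G.X, if x ∈ S then (if G.i x ≠ x then (1:ℤ) else 0) else 0)
        - 2 * (∑ x : G.X, if x ∈ S then (if G.r x = x then (1:ℤ) else 0) else 0)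
        + 2 * ∑ x : G.X, if x ∈ S then (if G.r x = x then G.hX x else 0) else 0 := by
    rw [Finset.mul_sum, Finset.mul_sum, ← Finset.sum_sub_distrib, ← Finset.sum_add_distrib]
    refine Finset.sum_congr rfl fun x _ => ?_
    unfold om
    by_cases h1 : x ∈ S <;> by_cases h2 : G.r x = x <;> (simp [h1, h2]; try ring)
  rw [e, ← hH, ← hV, ← hh, hE]
  unfold genusOn
  push_cast
  ring


namespace Hom

variable {G₁ G₂ G₃ : MGraph n}

lemma not_leg_flag (π : Hom G₁ G₂) {x : G₁.X} (hl : G₁.i x = x) (hr : G₁.r x ≠ x) :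
    G₂.r (π.f x) ≠ π.f x := by
  have := π.leg (G₁.m.symm ⟨x, hl, hr⟩)
  simp only [Equiv.apply_symm_apply] at this
  rw [this]
  exact (G₂.m _).2.2

lemma r_of_vertex (π : Hom G₁ G₂) {x : G₁.X} (hx : G₂.r (π.f x) = π.f x) :
    π.f (G₁.r x) = π.f x := by rw [π.map_r, hx]

lemma i_vertex {G : MGraph n} {x : G.X} (hx : G.r x = x) : G.i x = x := by
  conv_lhs => rw [← hx, G.i_r]
  exact hx

lemma i_of_vertex (π : Hom G₁ G₂) {x : G₁.X} (hx : G₂.r (π.f x) = π.f x) :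
    π.f (G₁.i x) = π.f x := by rw [π.map_i, i_vertex hx]

lemma flag_of_flag (π : Hom G₁ G₂) {x : G₁.X} (hx : G₂.r (π.f x) ≠ π.f x) : G₁.r x ≠ x :=
  fun h => hx (by rw [← π.map_r, h])

lemma half_iff (π : Hom G₁ G₂) {x : G₁.X} (hx : G₂.r (π.f x) ≠ π.f x) :
    G₂.i (π.f x) ≠ π.f x ↔ G₁.i x ≠ x := by
  refine not_congr ⟨fun h => ?_, fun h => by rw [← π.map_i, h]⟩
  exact (π.flag _ hx).unique (by rw [π.map_i, h]) rfl

open scoped Classical in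
lemma sum_fiber (π : Hom G₁ G₂) (y : G₂.X) :
    (∑ x : G₁.X, if π.f x = y then G₁.om x else 0) = G₂.om y := by
  by_cases hy : G₂.r y = y
  · have h1 := genus_om (G := G₁) (π.f ⁻¹' {y}) (by
      intro x hx
      simp only [Set.mem_preimage, Set.mem_singleton_iff] at hx ⊢
      rw [π.map_i, hx, i_vertex hy])
    rw [π.genus ⟨y, hy⟩] at h1
    simp only [Set.mem_preimage, Set.mem_singleton_iff] at h1
    rw [← h1]
    simp [om, hX, hy, i_vertex hy]
  · obtain ⟨x, hx, hu⟩ := π.flag y hy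
    rw [Finset.sum_eq_single x]
    · have h2 : G₂.r (π.f x) ≠ π.f x := by rwa [hx]
      have h3 := π.half_iff h2
      have h4 := π.flag_of_flag h2
      rw [hx] at h3
      simp only [hx, if_true, om, hy, h4, if_false, add_zero]
      simp only [h3]
    · intro z _ hz
      rw [if_neg]
      exact fun h => hz (hu z h)
    · simp

open scoped Classical in
lemma sum_preimage (π : Hom G₁ G₂) (S : Set G₂.X) :
    (∑ x : G₁.X, if x ∈ π.f ⁻¹' S then G₁.om x else 0)
      = ∑ y : G₂.X, if y ∈ S then G₂.om y else 0 := by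
  rw [← Finset.sum_fiberwise (g := π.f)]
  refine Finset.sum_congr rfl fun y _ => ?_
  rw [← π.sum_fiber y, Finset.sum_filter]
  by_cases hy : y ∈ S
  · rw [if_pos hy]
    refine Finset.sum_congr rfl fun x _ => ?_
    by_cases hx : π.f x = y
    · simp [hx, hy]
    · simp [hx]
  · rw [if_neg hy]
    refine Finset.sum_eq_zero fun x _ => ?_
    by_cases hx : π.f x = y
    · simp [hx, hy]
    · simp [hx]

lemma Step.mono {G : MGraph n} {S T : Set G.X} (h : S ⊆ T) {a b} :
    Relation.ReflTransGen (G.Step S) a b → Relation.ReflTransGen (G.Step T) a b := by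
  intro h1
  induction h1 with
  | refl => exact .refl
  | tail _ h2 ih =>
    obtain ⟨x, hx, h3⟩ := h2
    exact ih.tail ⟨x, h hx, h3⟩

lemma conn_preimage (π : Hom G₁ G₂) (S : Set G₂.X) (hr : ∀ x ∈ S, G₂.r x ∈ S)
    (hi : ∀ x ∈ S, G₂.i x ∈ S) (hS : G₂.ConnOn S) : G₁.ConnOn (π.f ⁻¹' S) := by
  have hfib : ∀ c ∈ S, G₂.r c = c → ∀ a b, π.f a = c → π.f b = c → G₁.r a = a → G₁.r b = b →
      Relation.ReflTransGen (G₁.Step (π.f ⁻¹' S)) a b := by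
    intro c hc hrc a b ha hb hra hrb
    refine Step.mono ?_ ((π.conn ⟨c, hrc⟩).2 a ha b hb hra hrb)
    rintro x hx
    simp only [Set.mem_preimage, Set.mem_singleton_iff] at hx ⊢
    rwa [hx]
  constructor
  · obtain ⟨v, hv, hrv⟩ := hS.1
    obtain ⟨x, hx, hrx⟩ := (π.conn ⟨v, hrv⟩).1
    refine ⟨x, ?_, hrx⟩
    simp only [Set.mem_preimage, Set.mem_singleton_iff] at hx ⊢
    rwa [hx]
  · intro a ha b hb hra hrb
    have hp := hS.2 _ ha _ hb (by rw [← π.map_r, hra]) (by rw [← π.map_r, hrb])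
    generalize hc : π.f a = c at hp
    generalize hd : π.f b = d at hp
    induction hp using Relation.ReflTransGen.head_induction_on generalizing a with
    | refl =>
      exact hfib _ (by rw [← hd]; exact hb) (by rw [← hd, ← π.map_r, hrb]) a b hc hd hra hrb
    | head h hrest ih =>
      rename_i c e
      obtain ⟨y, hy, h1, h2⟩ := h
      by_cases hv : G₂.r y = y
      · rw [i_vertex hv, hv] at h2
        rw [hv] at h1
        exact ih a ha hra (by rw [hc, ← h1, h2])
      · obtain ⟨x, hx, -⟩ := π.flag y hv
        have s1 : Relation.ReflTransGen (G₁.Step (π.f ⁻¹' S)) a (G₁.r x) :=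
          hfib c (by rw [← h1]; exact hr _ hy) (by rw [← h1, G₂.r_r]) _ _ hc
            (by rw [π.map_r, hx, h1]) hra (G₁.r_r _)
        have s2 : G₁.Step (π.f ⁻¹' S) (G₁.r x) (G₁.r (G₁.i x)) :=
          ⟨x, by simp only [Set.mem_preimage]; rwa [hx], rfl, rfl⟩
        have e1 : π.f (G₁.r (G₁.i x)) = e := by rw [π.map_r, π.map_i, hx, h2]
        refine (s1.tail s2).trans (ih _ ?_ (G₁.r_r _) e1)
        simp only [Set.mem_preimage]
        rw [e1, ← h2]; exact hr _ (hi _ hy)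

/-- identity morphism -/
def id (G : MGraph n) : Hom G G where
  f := _root_.id
  map_r _ := rfl
  map_i _ := rfl
  flag y _ := ⟨y, rfl, fun _ h => h⟩
  leg _ := rfl
  conn v := by
    refine ⟨⟨v.1, rfl, v.2⟩, ?_⟩
    rintro a ha b hb - -
    simp only [Set.preimage_id, Set.mem_singleton_iff] at ha hb
    rw [ha, hb]
  genus v := by
    classical
    have h1 := genus_om (G := G) (_root_.id ⁻¹' {v.1}) (by
      intro x hx
      simp only [Set.preimage_id, Set.mem_singleton_iff] at hx ⊢
      rw [hx, i_vertex v.2])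
    have h2 : (∑ x : G.X, if x ∈ (_root_.id ⁻¹' {v.1} : Set G.X) then G.om x else 0)
        = G.om v.1 := by
      rw [Finset.sum_eq_single v.1]
      · simp
      · intro b _ hb; rw [if_neg]; simpa using hb
      · simp
    rw [h2] at h1
    simp only [om, i_vertex v.2, v.2, hX] at h1
    simp at h1
    rw [Set.preimage_id]
    linarith

/-- composition of morphisms -/
def comp (π : Hom G₁ G₂) (ρ : Hom G₂ G₃) : Hom G₁ G₃ where
  f := ρ.f ∘ π.f
  map_r x := by simp [π.map_r, ρ.map_r]
  map_i x := by simp [π.map_i, ρ.map_i]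
  flag y hy := by
    obtain ⟨z, hz, hzu⟩ := ρ.flag y hy
    obtain ⟨x, hx, hxu⟩ := π.flag z (fun h => hy (by rw [← hz, ← ρ.map_r, h]))
    refine ⟨x, by simp only [Function.comp, hx]; exact hz, fun x' hx' => ?_⟩
    exact hxu _ (hzu _ hx')
  leg j := by simp [π.leg, ρ.leg]
  conn v := by
    rw [Set.preimage_comp]
    refine π.conn_preimage _ ?_ ?_ (ρ.conn v)
    · intro x hx
      simp only [Set.mem_preimage, Set.mem_singleton_iff] at hx ⊢
      rw [ρ.map_r, hx, v.2]
    · intro x hx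
      simp only [Set.mem_preimage, Set.mem_singleton_iff] at hx ⊢
      rw [ρ.map_i, hx, i_vertex v.2]
  genus v := by
    classical
    have h2 : ∀ x ∈ ρ.f ⁻¹' {v.1}, G₂.i x ∈ ρ.f ⁻¹' {v.1} := by
      intro x hx
      simp only [Set.mem_preimage, Set.mem_singleton_iff] at hx ⊢
      rw [ρ.map_i, hx, i_vertex v.2]
    have h1 : ∀ x ∈ (ρ.f ∘ π.f) ⁻¹' {v.1}, G₁.i x ∈ (ρ.f ∘ π.f) ⁻¹' {v.1} := by
      intro x hx
      rw [Set.preimage_comp] at hx ⊢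
      simp only [Set.mem_preimage (f := π.f)] at hx ⊢
      rw [π.map_i]; exact h2 _ hx
    have e1 := genus_om _ h1
    have e2 := genus_om _ h2
    rw [Set.preimage_comp, π.sum_preimage, ← e2, ← Set.preimage_comp] at e1
    rw [← ρ.genus v]
    linarith

end Hom

instance : Category (MGraph n) where
  Hom := Hom
  id := Hom.id
  comp := Hom.comp

@[simp] lemma id_f (G : MGraph n) : (𝟙 G : Hom G G).f = id := rfl

@[simp] lemma comp_f {G₁ G₂ G₃ : MGraph n} (π : G₁ ⟶ G₂) (ρ : G₂ ⟶ G₃) :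
    Hom.f (π ≫ ρ) = Hom.f ρ ∘ Hom.f π := rfl

lemma hom_ext {G₁ G₂ : MGraph n} {π ρ : G₁ ⟶ G₂} (h : ∀ x, Hom.f π x = Hom.f ρ x) : π = ρ :=
  Hom.ext (funext h)

variable (G)

/-- exceptional vertices: genus zero and valence two -/
def Exc (v : G.X) : Prop := ∃ hv : G.r v = v, G.h ⟨v, hv⟩ = 0 ∧ G.val v = 2

/-- stable graphs of type `(g, n)` -/
structure IsStable (g : ℕ) : Prop where
  hyp : 2 < 2 * g + n
  conn : G.ConnOn Set.univ
  genus : G.genusOn Set.univ = g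
  stable : ∀ v : G.V, 2 < 2 * G.h v + G.val v.1

/-- quasi-stable graphs of type `(g, n)` -/
structure IsQuasiStable (g : ℕ) : Prop where
  hyp : 2 < 2 * g + n
  conn : G.ConnOn Set.univ
  genus : G.genusOn Set.univ = g
  two_le_val : ∀ v : G.V, G.h v = 0 → 2 ≤ G.val v.1
  /-- the two flags at an exceptional vertex are half-edges belonging to two different edges -/
  exc_edges : ∀ x, G.r x ≠ x → G.Exc (G.r x) → G.i x ≠ x ∧ G.r (G.i x) ≠ G.r x
  /-- two distinct exceptional vertices are not adjacent -/
  exc_not_adj : ∀ x, G.r (G.i x) ≠ G.r x → G.Exc (G.r x) → ¬ G.Exc (G.r (G.i x))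

open scoped Classical in
/-- the other flag at the root of a flag `x`, when this root is an exceptional vertex -/
noncomputable def sw (x : G.X) : G.X :=
  if h : ∃ y, y ≠ x ∧ G.r y ≠ y ∧ G.r y = G.r x then h.choose else x

/-! Helper facts on valences and exceptional vertices. -/

open scoped Classical in
noncomputable def nu (x : G.X) : ℤ :=
  (if G.r x ≠ x then 1 else 0) + (if G.r x = x then 2 * G.hX x - 2 else 0)

variable {G}

lemma val_eq (v : G.X) [DecidablePred fun x : G.X => G.r x ≠ x ∧ G.r x = v] :
    G.val v = (Finset.univ.filter fun x : G.X => G.r x ≠ x ∧ G.r x = v).card := by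
  unfold val; congr

open scoped Classical in
lemma sum_nu (v : G.X) (hv : G.r v = v) :
    (∑ x : G.X, if G.r x = v then G.nu x else 0) = G.val v + 2 * G.hX v - 2 := by
  have e : (∑ x : G.X, if G.r x = v then G.nu x else 0)
      = (∑ x : G.X, if G.r x ≠ x ∧ G.r x = v then (1:ℤ) else 0)
        + ∑ x : G.X, if x = v then (2 * G.hX x - 2) else 0 := by
    rw [← Finset.sum_add_distrib]
    refine Finset.sum_congr rfl fun x _ => ?_
    by_cases h1 : G.r x = v
    · by_cases h2 : x = v
      · subst h2; simp [nu, hv]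
      · have h3 : G.r x ≠ x := by rw [h1]; exact fun h => h2 h.symm
        have h4 : v ≠ x := fun h => h2 h.symm
        simp [nu, h1, h2, h4]
    · have h2 : x ≠ v := fun h => h1 (by rw [h, hv])
      simp [h1, h2]
  rw [e, Finset.sum_ite_eq', if_pos (Finset.mem_univ _), val_eq, Finset.card_filter]
  push_cast
  ring

lemma Hom.hX_fiber_nu {G₁ G₂ : MGraph n} (π : Hom G₁ G₂) {x : G₁.X}
    (hx : G₂.r (π.f x) = π.f x) : G₁.nu x = G₁.om x := by
  by_cases h : G₁.r x = x
  · simp [nu, om, h, i_vertex h]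
  · have : G₁.i x ≠ x := fun h' => π.not_leg_flag h' h hx
    simp [nu, om, h, this]

open scoped Classical in
lemma Hom.sum_fiber_nu {G₁ G₂ : MGraph n} (π : Hom G₁ G₂) (y : G₂.X) :
    (∑ x : G₁.X, if π.f x = y then G₁.nu x else 0) = G₂.nu y := by
  by_cases hy : G₂.r y = y
  · have h1 : G₂.nu y = G₂.om y := by simp [nu, om, hy, i_vertex hy]
    rw [h1, ← π.sum_fiber y]
    refine Finset.sum_congr rfl fun x _ => ?_
    by_cases hx : π.f x = y
    · rw [if_pos hx, if_pos hx, π.hX_fiber_nu (by rw [hx, hy])]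
    · rw [if_neg hx, if_neg hx]
  · obtain ⟨x, hx, hu⟩ := π.flag y hy
    rw [Finset.sum_eq_single x]
    · have h4 := π.flag_of_flag (x := x) (by rwa [hx])
      simp [nu, hx, hy, h4]
    · intro z _ hz
      rw [if_neg]
      exact fun h => hz (hu z h)
    · simp

open scoped Classical in
lemma Hom.sum_root_nu {G₁ G₂ : MGraph n} (π : Hom G₁ G₂) (w : G₂.X) (hw : G₂.r w = w) :
    (∑ x : G₁.X, if π.f (G₁.r x) = w then G₁.nu x else 0) = G₂.val w + 2 * G₂.hX w - 2 := by
  rw [← sum_nu w hw, ← Finset.sum_fiberwise (g := π.f)]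
  refine Finset.sum_congr rfl fun y _ => ?_
  rw [← π.sum_fiber_nu y, Finset.sum_filter]
  by_cases hy : G₂.r y = w
  · rw [if_pos hy]
    refine Finset.sum_congr rfl fun x _ => ?_
    by_cases hx : π.f x = y
    · simp [hx, hy, π.map_r]
    · simp [hx]
  · rw [if_neg hy]
    refine Finset.sum_eq_zero fun x _ => ?_
    by_cases hx : π.f x = y
    · simp [hx, hy, π.map_r]
    · simp [hx]

lemma Exc.vertex {v : G.X} (h : G.Exc v) : G.r v = v := h.1

lemma exc_iff {v : G.X} (hv : G.r v = v) : G.Exc v ↔ G.hX v = 0 ∧ G.val v = 2 := by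
  simp [Exc, hX, hv]

lemma sw_spec {x : G.X} (hx : G.r x ≠ x) (he : G.Exc (G.r x)) :
    G.sw x ≠ x ∧ G.r (G.sw x) ≠ G.sw x ∧ G.r (G.sw x) = G.r x ∧
      ∀ z, G.r z ≠ z → G.r z = G.r x → z = x ∨ z = G.sw x := by
  classical
  obtain ⟨_, _, h2⟩ := he
  rw [val_eq, Finset.card_eq_two] at h2
  obtain ⟨a, b, hab, h⟩ := h2
  have hm : ∀ z, (G.r z ≠ z ∧ G.r z = G.r x) ↔ z = a ∨ z = b := by
    intro z
    have := Finset.ext_iff.1 h z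
    simpa using this
  have hex : ∃ y, y ≠ x ∧ G.r y ≠ y ∧ G.r y = G.r x := by
    rcases (hm x).1 ⟨hx, rfl⟩ with h | h
    · exact ⟨b, by rw [h]; exact hab.symm, (hm b).2 (Or.inr rfl)⟩
    · exact ⟨a, by rw [h]; exact hab, (hm a).2 (Or.inl rfl)⟩
  have hs : G.sw x = hex.choose := by unfold sw; rw [dif_pos hex]
  have hc := hex.choose_spec
  rw [← hs] at hc
  refine ⟨hc.1, hc.2.1, hc.2.2, fun z h1 h2 => ?_⟩
  rcases (hm x).1 ⟨hx, rfl⟩ with e1 | e1 <;> rcases (hm _).1 hc.2 with e2 | e2 <;>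
    rcases (hm z).1 ⟨h1, h2⟩ with e3 | e3 <;> simp_all

lemma sw_sw {x : G.X} (hx : G.r x ≠ x) (he : G.Exc (G.r x)) : G.sw (G.sw x) = x := by
  obtain ⟨h1, h2, h3, h4⟩ := sw_spec hx he
  obtain ⟨k1, k2, k3, k4⟩ := sw_spec h2 (by rwa [h3])
  rcases h4 _ k2 (by rw [k3, h3]) with h | h
  · exact h
  · exact absurd h k1

lemma exists_flag {v : G.X} (he : G.Exc v) : ∃ x, G.r x ≠ x ∧ G.r x = v := by
  classical
  obtain ⟨_, _, h2⟩ := he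
  rw [val_eq, Finset.card_eq_two] at h2
  obtain ⟨a, b, hab, h⟩ := h2
  have := Finset.ext_iff.1 h a
  exact ⟨a, by simpa using this⟩

namespace IsQuasiStable

variable {g : ℕ}

lemma nexc_i (hG : G.IsQuasiStable g) {x : G.X} (hx : G.r x ≠ x) (he : G.Exc (G.r x)) :
    ¬ G.Exc (G.r (G.i x)) := hG.exc_not_adj x (hG.exc_edges x hx he).2 he

lemma nonneg (hG : G.IsQuasiStable g) {v : G.X} (hv : G.r v = v) :
    0 ≤ (G.val v : ℤ) + 2 * G.hX v - 2 := by
  have := hG.two_le_val ⟨v, hv⟩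
  simp only [hX, hv, dif_pos]
  by_cases h : G.h ⟨v, hv⟩ = 0
  · have h2 : 2 ≤ G.val v := this h
    rw [h]; omega
  · omega

/-- if `x` is not rooted at an exceptional vertex but its conjugate is, the conjugate is a flag -/
lemma flag_i {x : G.X} (hx : ¬ G.Exc (G.r x)) (he : G.Exc (G.r (G.i x))) :
    G.r (G.i x) ≠ G.i x := fun h => hx (by
  have := Hom.i_vertex h
  rw [G.i_i] at this
  rwa [this])

variable {G₁ G₂ : MGraph n}

lemma exc_of_map (hG : G₁.IsQuasiStable g) (π : Hom G₁ G₂) {v : G₁.X} (hv : G₁.r v = v)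
    (he : G₂.Exc (π.f v)) : G₁.Exc v := by
  classical
  have hw := he.vertex
  have hs := π.sum_root_nu _ hw
  obtain ⟨h0, h2⟩ := (exc_iff hw).1 he
  rw [h0, h2, ← Finset.sum_fiberwise (g := G₁.r)] at hs
  norm_num at hs
  have hterm : ∀ a : G₁.X, (∑ x with G₁.r x = a, if π.f (G₁.r x) = π.f v then G₁.nu x else 0)
      = if G₁.r a = a ∧ π.f a = π.f v then (G₁.val a : ℤ) + 2 * G₁.hX a - 2 else 0 := by
    intro a
    rw [Finset.sum_filter]
    by_cases ha : G₁.r a = a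
    · by_cases hb : π.f a = π.f v
      · rw [if_pos ⟨ha, hb⟩, ← sum_nu a ha]
        refine Finset.sum_congr rfl fun x _ => ?_
        by_cases hx : G₁.r x = a
        · rw [if_pos hx, if_pos hx, hx, if_pos hb]
        · rw [if_neg hx, if_neg hx]
      · rw [if_neg (fun h => hb h.2)]
        refine Finset.sum_eq_zero fun x _ => ?_
        by_cases hx : G₁.r x = a
        · rw [if_pos hx, hx, if_neg hb]
        · rw [if_neg hx]
    · rw [if_neg (fun h => ha h.1)]
      refine Finset.sum_eq_zero fun x _ => ?_
      rw [if_neg]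
      intro hx
      exact ha (by rw [← hx, G₁.r_r])
  have hs' : (∑ a : G₁.X, if G₁.r a = a ∧ π.f a = π.f v
      then (G₁.val a : ℤ) + 2 * G₁.hX a - 2 else 0) = 0 := by
    exact (Finset.sum_congr rfl fun a _ => (hterm a).symm).trans hs
  rw [Finset.sum_eq_zero_iff_of_nonneg] at hs'
  · have := hs' v (Finset.mem_univ _)
    rw [if_pos ⟨hv, rfl⟩] at this
    rw [exc_iff hv]
    have hn : 0 ≤ G₁.hX v := by simp [hX, hv]
    by_cases hz : G₁.hX v = 0
    · exact ⟨hz, by rw [hz] at this; omega⟩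
    · exfalso
      have h1 : G₁.hX v = 1 := by omega
      have hval : G₁.val v = 0 := by omega
      rw [val_eq, Finset.card_eq_zero] at hval
      have hno : ∀ x, G₁.r x = v → x = v := by
        intro x hx
        by_contra hne
        have : x ∈ (Finset.univ.filter fun x : G₁.X => G₁.r x ≠ x ∧ G₁.r x = v) := by
          simp only [Finset.mem_filter, Finset.mem_univ, true_and]
          exact ⟨by rw [hx]; exact fun h => hne h.symm, hx⟩
        rw [hval] at this
        simp at this
      have hpath : ∀ b, Relation.ReflTransGen (G₁.Step (π.f ⁻¹' {π.f v})) v b → b = v := by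
        intro b hb
        induction hb with
        | refl => rfl
        | tail _ h ih =>
          obtain ⟨x, _, hx1, hx2⟩ := h
          rw [ih] at hx1
          have := hno x hx1
          rw [← hx2, this, Hom.i_vertex hv, hv]
      have hS : ∀ x, π.f x = π.f v → x = v := by
        intro x hx
        apply hno
        apply hpath
        refine (π.conn ⟨π.f v, hw⟩).2 v rfl _ ?_ hv (G₁.r_r _)
        simp only [Set.mem_preimage, Set.mem_singleton_iff]
        rw [π.map_r, hx, hw]
      have hf := π.sum_fiber (π.f v)
      rw [Finset.sum_eq_single v] at hf
      · simp [om, hv, hw, Hom.i_vertex hv, Hom.i_vertex hw, h1, h0] at hf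
      · intro b _ hb
        rw [if_neg]
        exact fun h => hb (hS b h)
      · simp
  · intro a _
    split_ifs with h
    · exact hG.nonneg h.1
    · exact le_rfl

/-- an exceptional vertex stays exceptional if none of its two edges is contracted -/
lemma exc_map (π : Hom G₁ G₂) {x : G₁.X} (hx : G₁.r x ≠ x)
    (he : G₁.Exc (G₁.r x)) (h1 : G₂.r (π.f x) ≠ π.f x)
    (h2 : G₂.r (π.f (G₁.sw x)) ≠ π.f (G₁.sw x)) : G₂.Exc (π.f (G₁.r x)) := by
  classical
  obtain ⟨s1, s2, s3, s4⟩ := sw_spec hx he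
  set v := G₁.r x with hvdef
  have hv : G₁.r v = v := he.vertex
  have hw : G₂.r (π.f v) = π.f v := by rw [← π.map_r, hv]
  have hno : ∀ y, π.f y = π.f v → G₁.r y = v → y = v := by
    intro y hy hyv
    by_contra hne
    rcases s4 y (by rw [hyv]; exact fun h => hne h.symm) hyv with h | h
    · exact h1 (by rw [← h, hy, hw])
    · exact h2 (by rw [← h, hy, hw])
  have hpath : ∀ b, Relation.ReflTransGen (G₁.Step (π.f ⁻¹' {π.f v})) v b → b = v := by
    intro b hb
    induction hb with
    | refl => rfl
    | tail _ h ih =>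
      obtain ⟨y, hy, hx1, hx2⟩ := h
      rw [ih] at hx1
      have := hno y hy hx1
      rw [← hx2, this, Hom.i_vertex hv, hv]
  have hS : ∀ y, π.f (G₁.r y) = π.f v → G₁.r y = v := by
    intro y hy
    apply hpath
    exact (π.conn ⟨π.f v, hw⟩).2 v rfl _ hy hv (G₁.r_r _)
  have hS' : ∀ y, π.f y = π.f v → y = v := fun y hy =>
    hno y hy (hS y (by rw [π.map_r, hy, hw]))
  obtain ⟨h0, hval⟩ := (exc_iff hv).1 he
  have hf := π.sum_fiber (π.f v)
  rw [Finset.sum_eq_single v] at hf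
  · simp [om, hv, hw, Hom.i_vertex hv, Hom.i_vertex hw, h0] at hf
    have hr := π.sum_root_nu _ hw
    have : (∑ y : G₁.X, if π.f (G₁.r y) = π.f v then G₁.nu y else 0)
        = ∑ y : G₁.X, if G₁.r y = v then G₁.nu y else 0 := by
      refine Finset.sum_congr rfl fun y _ => ?_
      by_cases hy : G₁.r y = v
      · simp [hy]
      · rw [if_neg hy, if_neg]
        exact fun h => hy (hS y h)
    rw [this, sum_nu v hv, h0, hval] at hr
    rw [exc_iff hw]
    constructor
    · omega
    · have : G₂.hX (π.f v) = 0 := by omega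
      rw [this] at hr
      push_cast at hr
      omega
  · intro b _ hb
    rw [if_neg]
    exact fun h => hb (hS' b h)
  · simp

end IsQuasiStable

/-! The stabilization. -/

open scoped Classical in
/-- The conjugation of the stabilization: if the conjugate `G.i x` of `x` is rooted at an
exceptional vertex, then `x` is sent to the conjugate of the other half-edge at that vertex. -/
noncomputable def stInv (G : MGraph n) (x : G.X) : G.X :=
  if G.Exc (G.r (G.i x)) then G.i (G.sw (G.i x)) else G.i x

lemma stInv_of_exc {x : G.X} (he : G.Exc (G.r (G.i x))) : G.stInv x = G.i (G.sw (G.i x)) :=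
  if_pos he

lemma stInv_of_nexc {x : G.X} (he : ¬ G.Exc (G.r (G.i x))) : G.stInv x = G.i x :=
  if_neg he

namespace IsQuasiStable

variable {g : ℕ}

lemma stInv_exc_root {x : G.X} (hx : ¬ G.Exc (G.r x))
    (he : G.Exc (G.r (G.i x))) :
    G.r (G.i (G.stInv x)) = G.r (G.i x) ∧ G.i (G.stInv x) = G.sw (G.i x) := by
  have hf := flag_i hx he
  obtain ⟨s1, s2, s3, s4⟩ := sw_spec hf he
  rw [stInv_of_exc he, G.i_i]
  exact ⟨s3, rfl⟩

lemma stInv_nexc (hG : G.IsQuasiStable g) {x : G.X} (hx : ¬ G.Exc (G.r x)) :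
    ¬ G.Exc (G.r (G.stInv x)) := by
  by_cases he : G.Exc (G.r (G.i x))
  · have hf := flag_i hx he
    obtain ⟨s1, s2, s3, s4⟩ := sw_spec hf he
    rw [stInv_of_exc he]
    exact hG.nexc_i s2 (by rwa [s3])
  · rw [stInv_of_nexc he]; exact he

lemma stInv_stInv {x : G.X} (hx : ¬ G.Exc (G.r x)) :
    G.stInv (G.stInv x) = x := by
  by_cases he : G.Exc (G.r (G.i x))
  · have hf := flag_i hx he
    obtain ⟨h1, h2⟩ := stInv_exc_root hx he
    rw [stInv_of_exc (by rwa [h1]), h2, sw_sw hf he, G.i_i]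
  · rw [stInv_of_nexc he, stInv_of_nexc (by rwa [G.i_i]), G.i_i]

lemma stInv_eq_iff {x : G.X} (hx : ¬ G.Exc (G.r x)) :
    G.stInv x = x ↔ G.i x = x := by
  by_cases he : G.Exc (G.r (G.i x))
  · have hf := flag_i hx he
    obtain ⟨s1, s2, s3, s4⟩ := sw_spec hf he
    constructor
    · intro h
      rw [stInv_of_exc he] at h
      exact absurd ((G.i_i (G.sw (G.i x))).symm.trans (congrArg G.i h)) s1
    · intro h; rw [h] at he; exact absurd he hx
  · rw [stInv_of_nexc he]

lemma leg_nexc (hG : G.IsQuasiStable g) {x : G.X} (hx : G.i x = x) (hr : G.r x ≠ x) :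
    ¬ G.Exc (G.r x) := fun h => (hG.exc_edges x hr h).1 hx

/-- The stabilization of a quasi-stable graph: one removes the exceptional vertices and the
half-edges rooted at them. -/
noncomputable def st (hG : G.IsQuasiStable g) : MGraph n where
  X := {x : G.X // ¬ G.Exc (G.r x)}
  finite_X := have := G.finite_X; inferInstance
  r x := ⟨G.r x.1, by rw [G.r_r]; exact x.2⟩
  i x := ⟨G.stInv x.1, hG.stInv_nexc x.2⟩
  r_r x := Subtype.ext (G.r_r _)
  i_i x := Subtype.ext (stInv_stInv x.2)
  i_r x := Subtype.ext (by
    have h1 : G.i (G.r x.1) = G.r x.1 := G.i_r _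
    change G.stInv (G.r x.1) = G.r x.1
    rw [stInv_of_nexc, h1]
    rw [h1, G.r_r]; exact x.2)
  h v := G.h ⟨v.1.1, congrArg Subtype.val v.2⟩
  m := G.m.trans
    { toFun := fun x => ⟨⟨x.1, hG.leg_nexc x.2.1 x.2.2⟩,
        Subtype.ext ((stInv_eq_iff (hG.leg_nexc x.2.1 x.2.2)).2 x.2.1),
        fun h => x.2.2 (congrArg Subtype.val h)⟩
      invFun := fun x => ⟨x.1.1, (stInv_eq_iff x.1.2).1 (congrArg Subtype.val x.2.1),
        fun h => x.2.2 (Subtype.ext h)⟩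
      left_inv := fun _ => rfl
      right_inv := fun _ => rfl }

lemma st_om (hG : G.IsQuasiStable g) (x : hG.st.X) : hG.st.om x = G.om x.1 := by
  have h1 : hG.st.i x = x ↔ G.i x.1 = x.1 :=
    Iff.trans Subtype.ext_iff (stInv_eq_iff x.2)
  have h2 : hG.st.r x = x ↔ G.r x.1 = x.1 := Subtype.ext_iff
  have h3 : hG.st.hX x = G.hX x.1 := by
    unfold hX
    by_cases h : G.r x.1 = x.1
    · rw [dif_pos h, dif_pos (h2.2 h)]; rfl
    · rw [dif_neg h, dif_neg (fun h' => h (h2.1 h'))]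
  unfold om
  rw [h3]
  refine congrArg₂ _ ?_ ?_
  · by_cases a : G.i x.1 = x.1
    · rw [if_neg (not_not.2 (h1.2 a)), if_neg (not_not.2 a)]
    · rw [if_pos (fun h => a (h1.1 h)), if_pos a]
  · by_cases b : G.r x.1 = x.1
    · rw [if_pos (h2.2 b), if_pos b]
    · rw [if_neg (fun h => b (h2.1 h)), if_neg b]

/-- the part of the stabilization lying in a subgraph -/
def stSet (hG : G.IsQuasiStable g) (S : Set G.X) : Set hG.st.X :=
  {x | x.1 ∈ S ∧ (G.Exc (G.r (G.i x.1)) → G.sw (G.i x.1) ∈ S)}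

lemma stSet_i (hG : G.IsQuasiStable g) {S : Set G.X} (hi : ∀ x ∈ S, G.i x ∈ S) :
    ∀ x ∈ hG.stSet S, hG.st.i x ∈ hG.stSet S := by
  rintro x ⟨h1, h2⟩
  change G.stInv x.1 ∈ S ∧ (G.Exc (G.r (G.i (G.stInv x.1))) → G.sw (G.i (G.stInv x.1)) ∈ S)
  by_cases he : G.Exc (G.r (G.i x.1))
  · obtain ⟨e1, e2⟩ := stInv_exc_root x.2 he
    rw [e2, sw_sw (flag_i x.2 he) he]
    refine ⟨?_, fun _ => hi _ h1⟩
    rw [stInv_of_exc he]; exact hi _ (h2 he)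
  · rw [stInv_of_nexc he]
    exact ⟨hi _ h1, fun h => absurd (by rwa [G.i_i] at h) x.2⟩

open scoped Classical in
lemma sum_stSet (hG : G.IsQuasiStable g) (S : Set G.X) (hr : ∀ x ∈ S, G.r x ∈ S)
    (hi : ∀ x ∈ S, G.i x ∈ S)
    (hS : ∀ v ∈ S, G.Exc v → ∃ x ∈ S, G.r x ≠ x ∧ G.r x = v) :
    (∑ x : hG.st.X, if x ∈ hG.stSet S then hG.st.om x else 0)
      = ∑ x : G.X, if x ∈ S then G.om x else 0 := by
  have e1 : (∑ x : hG.st.X, if x ∈ hG.stSet S then hG.st.om x else 0)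
      = ∑ x : G.X, if ¬ G.Exc (G.r x) ∧ x ∈ S ∧ (G.Exc (G.r (G.i x)) → G.sw (G.i x) ∈ S)
        then G.om x else 0 := by
    have h1 : (∑ x : hG.st.X, if x ∈ hG.stSet S then hG.st.om x else 0)
      = ∑ x : hG.st.X, (fun x : G.X => if x ∈ S ∧ (G.Exc (G.r (G.i x)) → G.sw (G.i x) ∈ S)
        then G.om x else 0) x.1 := by
      refine Finset.sum_congr rfl fun x _ => ?_
      rw [st_om]; exact if_congr Iff.rfl rfl rfl
    rw [h1]
    have h2 := Finset.sum_subtype_of_mem (s := Finset.univ.filter fun x : G.X => ¬ G.Exc (G.r x))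
      (p := fun x => ¬ G.Exc (G.r x))
      (fun x : G.X => if x ∈ S ∧ (G.Exc (G.r (G.i x)) → G.sw (G.i x) ∈ S)
        then G.om x else 0) (by simp)
    rw [Finset.sum_filter] at h2
    refine (Eq.trans ?_ h2).trans ?_
    · refine Finset.sum_congr ?_ fun _ _ => rfl
      ext x
      refine ⟨fun _ => Finset.mem_subtype.2 ?_, fun _ => Finset.mem_univ _⟩
      exact Finset.mem_filter.2 ⟨Finset.mem_univ _, x.2⟩
    · refine Finset.sum_congr rfl fun x _ => ?_
      by_cases h : G.Exc (G.r x) <;> simp [h]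
  rw [e1, ← sub_eq_zero, ← neg_sub, neg_eq_zero, ← Finset.sum_sub_distrib]
  set A : G.X → Prop := fun x => x ∈ S ∧
    (G.Exc (G.r x) ∨ (G.Exc (G.r (G.i x)) ∧ G.sw (G.i x) ∉ S)) with hA
  have e2 : (∑ x : G.X, ((if x ∈ S then G.om x else 0) - if ¬ G.Exc (G.r x) ∧ x ∈ S ∧
      (G.Exc (G.r (G.i x)) → G.sw (G.i x) ∈ S) then G.om x else 0))
      = ∑ x : G.X with A x, G.om x := by
    rw [Finset.sum_filter]
    refine Finset.sum_congr rfl fun x _ => ?_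
    by_cases h1 : x ∈ S <;> by_cases h2 : G.Exc (G.r x) <;> by_cases h3 : G.Exc (G.r (G.i x)) <;>
      by_cases h4 : G.sw (G.i x) ∈ S <;> simp [hA, h1, h2, h3, h4]
  rw [e2, ← Finset.sum_fiberwise (g := fun x => if G.Exc (G.r x) then G.r x else G.r (G.i x))]
  refine Finset.sum_eq_zero fun v _ => ?_
  rw [Finset.filter_filter]
  by_cases hv : G.Exc v ∧ v ∈ S
  · obtain ⟨hv, hvS⟩ := hv
    obtain ⟨x1, hx1S, hx1f, hx1⟩ := hS v hvS hv
    have hx1e : G.Exc (G.r x1) := by rwa [hx1]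
    obtain ⟨s1, s2, s3, s4⟩ := sw_spec hx1f hx1e
    have hrv := hv.vertex
    have omv : G.om v = -2 := by
      have := ((exc_iff hrv).1 hv).1
      simp [om, hrv, Hom.i_vertex hrv, this]
    have omf : ∀ x, G.r x ≠ x → G.r x = v → G.om x = 1 := by
      intro x h1 h2
      have := (hG.exc_edges x h1 (by rwa [h2])).1
      simp [om, h1, this]
    have hvx1 : v ≠ x1 := fun h => hx1f (by rw [← h, hrv])
    by_cases h2S : G.sw x1 ∈ S
    · have hvx2 : v ≠ G.sw x1 := fun h => s2 (by rw [← h, hrv])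
      have : (Finset.univ.filter fun x => A x ∧
          (if G.Exc (G.r x) then G.r x else G.r (G.i x)) = v) = {v, x1, G.sw x1} := by
        ext x
        simp only [Finset.mem_filter, Finset.mem_univ, true_and, Finset.mem_insert,
          Finset.mem_singleton]
        constructor
        · rintro ⟨⟨hxS, ho⟩, hc⟩
          by_cases he : G.Exc (G.r x)
          · rw [if_pos he] at hc
            by_cases hxf : G.r x = x
            · left; rw [← hxf, hc]
            · right; exact s4 x hxf (by rw [hc, hx1])
          · rw [if_neg he] at hc
            obtain ⟨h5, h6⟩ := ho.resolve_left he
            exfalso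
            rcases s4 _ (flag_i he h5) (by rw [hc, hx1]) with h | h
            · exact h6 (by rw [h]; exact h2S)
            · apply h6; rw [h, sw_sw hx1f hx1e]; exact hx1S
        · rintro (h | h | h)
          · rw [h, hrv, if_pos hv]; exact ⟨⟨hvS, Or.inl (by rwa [hrv])⟩, rfl⟩
          · rw [h, hx1, if_pos hv]; exact ⟨⟨hx1S, Or.inl hx1e⟩, rfl⟩
          · rw [h, s3, if_pos hx1e]; exact ⟨⟨h2S, Or.inl (by rwa [s3])⟩, hx1⟩
      rw [this, Finset.sum_insert (by simp [hvx1, hvx2]), Finset.sum_insert (by simp [s1.symm]),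
        Finset.sum_singleton, omv, omf _ hx1f hx1, omf _ s2 (by rw [s3, hx1])]
      norm_num
    · have hix1 := hG.nexc_i hx1f hx1e
      have hvix : v ≠ G.i x1 := fun h => hix1 (by rwa [← h, hrv])
      have hxx : x1 ≠ G.i x1 := fun h => hix1 (by rwa [← h])
      have : (Finset.univ.filter fun x => A x ∧
          (if G.Exc (G.r x) then G.r x else G.r (G.i x)) = v) = {v, x1, G.i x1} := by
        ext x
        simp only [Finset.mem_filter, Finset.mem_univ, true_and, Finset.mem_insert,
          Finset.mem_singleton]
        constructor
        · rintro ⟨⟨hxS, ho⟩, hc⟩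
          by_cases he : G.Exc (G.r x)
          · rw [if_pos he] at hc
            by_cases hxf : G.r x = x
            · left; rw [← hxf, hc]
            · rcases s4 x hxf (by rw [hc, hx1]) with h | h
              · right; left; exact h
              · exact absurd (by rwa [h] at hxS) h2S
          · rw [if_neg he] at hc
            obtain ⟨h5, h6⟩ := ho.resolve_left he
            rcases s4 _ (flag_i he h5) (by rw [hc, hx1]) with h | h
            · right; right; rw [← h, G.i_i]
            · exact absurd (by rw [← h]; exact hi _ hxS) h2S
        · rintro (h | h | h)
          · rw [h, hrv, if_pos hv]; exact ⟨⟨hvS, Or.inl (by rwa [hrv])⟩, rfl⟩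
          · rw [h, hx1, if_pos hv]; exact ⟨⟨hx1S, Or.inl hx1e⟩, rfl⟩
          · rw [h, if_neg hix1, G.i_i]
            exact ⟨⟨hi _ hx1S, Or.inr ⟨by rwa [G.i_i], by rwa [G.i_i]⟩⟩, hx1⟩
      have omi : G.om (G.i x1) = 1 := by
        have h1 := half_i (hG.exc_edges x1 hx1f hx1e).1
        rw [om, if_pos h1, if_neg (flag_of_half h1), add_zero]
      rw [this, Finset.sum_insert (by simp [hvx1, hvix]), Finset.sum_insert (by simp [hxx]),
        Finset.sum_singleton, omv, omf _ hx1f hx1, omi]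
      norm_num
  · rw [Finset.filter_eq_empty_iff.2, Finset.sum_empty]
    rintro x - ⟨⟨hxS, ho⟩, hc⟩
    apply hv
    by_cases he : G.Exc (G.r x)
    · rw [if_pos he] at hc
      rw [← hc]; exact ⟨he, hr _ hxS⟩
    · rw [if_neg he] at hc
      rw [← hc]; exact ⟨(ho.resolve_left he).1, hr _ (hi _ hxS)⟩

lemma genus_stSet (hG : G.IsQuasiStable g) (S : Set G.X) (hr : ∀ x ∈ S, G.r x ∈ S)
    (hi : ∀ x ∈ S, G.i x ∈ S)
    (hS : ∀ v ∈ S, G.Exc v → ∃ x ∈ S, G.r x ≠ x ∧ G.r x = v) :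
    hG.st.genusOn (hG.stSet S) = G.genusOn S := by
  classical
  have h1 := genus_om S hi
  have h2 := genus_om (hG.stSet S) (hG.stSet_i hi)
  rw [hG.sum_stSet S hr hi hS] at h2
  linarith

lemma conn_stSet (hG : G.IsQuasiStable g) (S : Set G.X) (hr : ∀ x ∈ S, G.r x ∈ S)
    (hi : ∀ x ∈ S, G.i x ∈ S)
    (hS : ∀ v ∈ S, G.Exc v → ∃ x ∈ S, G.r x ≠ x ∧ G.r x = v) (hc : G.ConnOn S) :
    hG.st.ConnOn (hG.stSet S) := by
  have hvert : ∀ v : hG.st.X, v.1 ∈ S → G.r v.1 = v.1 → v ∈ hG.stSet S := by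
    intro v hv hrv
    exact ⟨hv, fun h => absurd (by rwa [Hom.i_vertex hrv] at h) v.2⟩
  constructor
  · obtain ⟨v, hv, hrv⟩ := hc.1
    by_cases he : G.Exc v
    · obtain ⟨x, hxS, hxf, hx⟩ := hS v hv he
      have h1 := hG.nexc_i hxf (by rwa [hx])
      exact ⟨⟨G.r (G.i x), by rwa [G.r_r]⟩, hvert _ (hr _ (hi _ hxS)) (G.r_r _),
        Subtype.ext (G.r_r _)⟩
    · exact ⟨⟨v, by rwa [hrv]⟩, hvert _ hv hrv, Subtype.ext hrv⟩
  · rintro a ⟨haS, -⟩ b ⟨hbS, -⟩ hra hrb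
    have hra' : G.r a.1 = a.1 := congrArg Subtype.val hra
    have hrb' : G.r b.1 = b.1 := congrArg Subtype.val hrb
    have hp := hc.2 _ haS _ hbS hra' hrb'
    have claim : ∀ c, Relation.ReflTransGen (G.Step S) c b.1 → ∀ a : hG.st.X,
        (a.1 = c ∨ (G.Exc c ∧ ∃ x ∈ S, G.r x = c ∧ a.1 = G.r (G.i x))) →
        Relation.ReflTransGen (hG.st.Step (hG.stSet S)) a b := by
      intro c hcb
      induction hcb using Relation.ReflTransGen.head_induction_on with
      | refl =>
        rintro a (h | ⟨h, -⟩)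
        · rw [Subtype.ext h]
        · exact absurd (by rwa [← hrb'] at h) b.2
      | head h hrest ih =>
        rename_i c e
        obtain ⟨y, hyS, hy1, hy2⟩ := h
        intro a ha
        by_cases hyf : G.r y = y
        · have hce : c = e := by rw [← hy1, ← hy2, Hom.i_vertex hyf]
          rw [← hce] at ih
          exact ih a ha
        · rcases ha with ha | ⟨hexc, x, hxS, hx1, hx2⟩
          · by_cases hee : G.Exc e
            · exact ih a (Or.inr ⟨hee, G.i y, hi _ hyS, hy2, by rw [G.i_i, ha, hy1]⟩)
            · have hya : ¬ G.Exc (G.r y) := by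
                rw [hy1, ← ha]
                have h3 : G.r a.1 = a.1 := by rw [ha, ← hy1, G.r_r]
                rw [← h3]; exact a.2
              have hye : ¬ G.Exc (G.r (G.i y)) := by rwa [hy2]
              have hre : G.r e = e := by rw [← hy2, G.r_r]
              have hst : hG.st.Step (hG.stSet S) a ⟨e, by rwa [hre]⟩ := by
                refine ⟨⟨y, hya⟩, ⟨hyS, fun h => absurd h hye⟩, Subtype.ext ?_, Subtype.ext ?_⟩
                · change G.r y = a.1
                  rw [hy1, ha]
                · change G.r (G.stInv y) = e
                  rw [stInv_of_nexc hye, hy2]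
              exact (ih _ (Or.inl rfl)).head hst
          · have hexy : G.Exc (G.r y) := by rwa [hy1]
            have hxf : G.r x ≠ x := by
              intro hxf
              have : a.1 = c := by rw [hx2, Hom.i_vertex hxf, hx1]
              have hra2 : G.r a.1 = c := by rw [this, ← hx1, G.r_r]
              exact a.2 (by rwa [hra2])
            have hexx : G.Exc (G.r x) := by rwa [hx1]
            obtain ⟨s1, s2, s3, s4⟩ := sw_spec hxf hexx
            rcases s4 y hyf (by rw [hy1, hx1]) with h | h
            · exact ih a (Or.inl (by rw [hx2, ← h, hy2]))
            · have hn := hG.nexc_i hxf hexx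
              have hre : G.r e = e := by rw [← hy2, G.r_r]
              have hne : ¬ G.Exc e := by rw [← hy2]; exact hG.nexc_i hyf hexy
              have hii : G.Exc (G.r (G.i (G.i x))) := by rwa [G.i_i]
              have hst : hG.st.Step (hG.stSet S) a ⟨e, by rwa [hre]⟩ := by
                refine ⟨⟨G.i x, hn⟩, ⟨hi _ hxS, fun _ => ?_⟩, Subtype.ext ?_, Subtype.ext ?_⟩
                · rw [G.i_i, ← h]; exact hyS
                · exact hx2.symm
                · change G.r (G.stInv (G.i x)) = e
                  rw [stInv_of_exc hii, G.i_i, ← h, hy2]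
              exact (ih _ (Or.inl rfl)).head hst
    exact claim _ hp a (Or.inl rfl)

lemma stSet_univ (hG : G.IsQuasiStable g) : hG.stSet Set.univ = Set.univ := by
  ext x; simp [stSet]

open scoped Classical in
lemma val_st (hG : G.IsQuasiStable g) (v : hG.st.X) (hv : G.r v.1 = v.1) :
    hG.st.val v = G.val v.1 := by
  rw [val_eq, val_eq]
  refine Finset.card_bij (fun x _ => x.1) ?_ ?_ ?_
  · intro x hx
    simp only [Finset.mem_filter, Finset.mem_univ, true_and] at hx ⊢
    exact ⟨fun h => hx.1 (Subtype.ext h), congrArg Subtype.val hx.2⟩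
  · intro x _ y _ h; exact Subtype.ext h
  · intro x hx
    simp only [Finset.mem_filter, Finset.mem_univ, true_and] at hx
    refine ⟨⟨x, ?_⟩, ?_, rfl⟩
    · rw [hx.2]; intro h; exact v.2 (by rwa [hv])
    · exact Finset.mem_filter.2 ⟨Finset.mem_univ _,
        fun h => hx.1 (congrArg Subtype.val h), Subtype.ext hx.2⟩

lemma st_stable (hG : G.IsQuasiStable g) : hG.st.IsStable g := by
  classical
  have hS : ∀ v ∈ (Set.univ : Set G.X), G.Exc v → ∃ x ∈ (Set.univ : Set G.X),
      G.r x ≠ x ∧ G.r x = v := by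
    intro v _ hv
    obtain ⟨x, hx⟩ := exists_flag hv
    exact ⟨x, trivial, hx⟩
  refine ⟨hG.hyp, ?_, ?_, ?_⟩
  · rw [← hG.stSet_univ]
    exact hG.conn_stSet Set.univ (fun _ _ => trivial) (fun _ _ => trivial) hS hG.conn
  · rw [← hG.stSet_univ, hG.genus_stSet Set.univ (fun _ _ => trivial) (fun _ _ => trivial) hS, hG.genus]
  · rintro ⟨v, hv⟩
    have hv' : G.r v.1 = v.1 := congrArg Subtype.val hv
    rw [hG.val_st v hv']
    change 2 < 2 * G.h ⟨v.1, hv'⟩ + G.val v.1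
    have hne : ¬ G.Exc v.1 := by have := v.2; rwa [hv'] at this
    have h2 : G.h ⟨v.1, hv'⟩ = 0 → 2 ≤ G.val v.1 := hG.two_le_val ⟨v.1, hv'⟩
    by_contra hlt
    by_cases h0 : G.h ⟨v.1, hv'⟩ = 0
    · have := h2 h0
      exact hne ⟨hv', h0, by omega⟩
    · have h1 : G.h ⟨v.1, hv'⟩ = 1 := by omega
      have hval : G.val v.1 = 0 := by omega
      rw [val_eq, Finset.card_eq_zero] at hval
      have hno : ∀ x, G.r x = v.1 → x = v.1 := by
        intro x hx
        by_contra hxne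
        have : x ∈ (Finset.univ.filter fun x : G.X => G.r x ≠ x ∧ G.r x = v.1) := by
          simp only [Finset.mem_filter, Finset.mem_univ, true_and]
          exact ⟨by rw [hx]; exact fun h => hxne h.symm, hx⟩
        rw [hval] at this
        simp at this
      have hpath : ∀ b, Relation.ReflTransGen (G.Step Set.univ) v.1 b → b = v.1 := by
        intro b hb
        induction hb with
        | refl => rfl
        | tail _ h ih =>
          obtain ⟨x, _, hx1, hx2⟩ := h
          rw [ih] at hx1
          have := hno x hx1
          rw [← hx2, this, Hom.i_vertex hv', hv']
      have hall : ∀ x, x = v.1 := fun x =>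
        hno x (hpath _ (hG.conn.2 _ trivial _ trivial hv' (G.r_r _)))
      have hn : n = 0 := by
        by_contra hn
        have := G.m ⟨0, Nat.pos_of_ne_zero hn⟩
        exact this.2.2 (by rw [hall this.1, hv'])
      have hs := genus_om (G := G) Set.univ (fun _ _ => trivial)
      rw [hG.genus, Finset.sum_eq_single v.1] at hs
      · simp [om, hv', Hom.i_vertex hv', hX, h1] at hs
        have := hG.hyp
        omega
      · intro b _ hb; exact absurd (hall b) hb
      · simp

end IsQuasiStable

namespace Hom

variable {G₁ G₂ G₃ : MGraph n} {g : ℕ}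

open scoped Classical in
/-- The stabilization of a morphism `π`: a half-edge `x` that is contracted by `π` and whose
conjugate is rooted at an exceptional vertex is sent to the image of the other half-edge at that
vertex (so that an exceptional edge of the stabilization is contracted only if both of the
corresponding edges of the original graph are); all other elements `x` are sent to `π x`. -/
noncomputable def stFun (π : Hom G₁ G₂) (x : G₁.X) : G₂.X :=
  if G₂.r (π.f x) = π.f x ∧ G₁.Exc (G₁.r (G₁.i x)) then π.f (G₁.sw (G₁.i x)) else π.f x

lemma stFun_pos (π : Hom G₁ G₂) {x : G₁.X} (h1 : G₂.r (π.f x) = π.f x)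
    (h2 : G₁.Exc (G₁.r (G₁.i x))) : π.stFun x = π.f (G₁.sw (G₁.i x)) := if_pos ⟨h1, h2⟩

lemma stFun_flag (π : Hom G₁ G₂) {x : G₁.X} (h1 : G₂.r (π.f x) ≠ π.f x) :
    π.stFun x = π.f x := if_neg fun h => h1 h.1

lemma stFun_nexc (π : Hom G₁ G₂) {x : G₁.X} (h2 : ¬ G₁.Exc (G₁.r (G₁.i x))) :
    π.stFun x = π.f x := if_neg fun h => h2 h.2

lemma map_root_i (π : Hom G₁ G₂) {x : G₁.X} (h1 : G₂.r (π.f x) = π.f x) :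
    π.f (G₁.r (G₁.i x)) = π.f x := by rw [π.map_r, π.map_i, i_vertex h1, h1]

lemma flag_map_i (π : Hom G₁ G₂) {x : G₁.X} (h1 : G₂.r (π.f x) ≠ π.f x) :
    G₂.r (π.f (G₁.i x)) ≠ π.f (G₁.i x) := fun h => h1 (by
  have := π.i_of_vertex h
  rw [G₁.i_i] at this
  rw [this, h])

lemma nexc_map (hG : G₁.IsQuasiStable g) (π : Hom G₁ G₂) {x : G₁.X}
    (hx : ¬ G₁.Exc (G₁.r x)) : ¬ G₂.Exc (π.f (G₁.r x)) :=
  fun h => hx (hG.exc_of_map π (G₁.r_r _) h)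

lemma sw_map (π : Hom G₁ G₂) {x : G₁.X} (hx : G₁.r x ≠ x)
    (he : G₁.Exc (G₁.r x)) (h1 : G₂.r (π.f x) ≠ π.f x)
    (h2 : G₂.r (π.f (G₁.sw x)) ≠ π.f (G₁.sw x)) : G₂.sw (π.f x) = π.f (G₁.sw x) := by
  obtain ⟨s1, s2, s3, s4⟩ := sw_spec hx he
  have he2 := IsQuasiStable.exc_map π hx he h1 h2
  rw [π.map_r] at he2
  obtain ⟨t1, t2, t3, t4⟩ := sw_spec h1 he2
  rcases t4 _ h2 (by rw [← π.map_r, s3, π.map_r]) with h | h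
  · exact absurd ((π.flag _ h1).unique h rfl) s1
  · exact h.symm

lemma stFun_r (π : Hom G₁ G₂) {x : G₁.X} (hx : ¬ G₁.Exc (G₁.r x)) :
    G₂.r (π.stFun x) = π.f (G₁.r x) := by
  by_cases h1 : G₂.r (π.f x) = π.f x
  · by_cases h2 : G₁.Exc (G₁.r (G₁.i x))
    · obtain ⟨s1, s2, s3, s4⟩ := sw_spec (IsQuasiStable.flag_i hx h2) h2
      rw [π.stFun_pos h1 h2, ← π.map_r, s3, π.map_root_i h1, π.r_of_vertex h1]
    · rw [π.stFun_nexc h2, ← π.map_r]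
  · rw [π.stFun_flag h1, ← π.map_r]

lemma stFun_i (h₁ : G₁.IsQuasiStable g) (π : Hom G₁ G₂) {x : G₁.X}
    (hx : ¬ G₁.Exc (G₁.r x)) : π.stFun (G₁.stInv x) = G₂.stInv (π.stFun x) := by
  by_cases he : G₁.Exc (G₁.r (G₁.i x))
  · have hf := IsQuasiStable.flag_i hx he
    obtain ⟨s1, s2, s3, s4⟩ := sw_spec hf he
    obtain ⟨e1, e2⟩ := IsQuasiStable.stInv_exc_root hx he
    have hy := h₁.stInv_nexc hx
    set y := G₁.stInv x with hydef
    have hey : G₁.Exc (G₁.r (G₁.i y)) := by rwa [e1]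
    have e3 : G₁.sw (G₁.i y) = G₁.i x := by rw [e2, sw_sw hf he]
    by_cases hvx : G₂.r (π.f x) = π.f x
    · rw [π.stFun_pos hvx he, ← e2]
      by_cases hvy : G₂.r (π.f y) = π.f y
      · rw [π.stFun_pos hvy hey, e3, π.i_of_vertex hvx, π.i_of_vertex hvy,
          stInv_of_nexc, i_vertex hvy, ← π.map_root_i hvx, ← π.map_root_i hvy, e1]
        rw [i_vertex hvy, ← π.map_r]
        exact nexc_map h₁ π hy
      · rw [π.stFun_flag hvy, stInv_of_nexc, ← π.map_i, G₁.i_i]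
        rw [← π.map_i, G₁.i_i, ← π.map_r]
        exact nexc_map h₁ π hy
    · rw [π.stFun_flag hvx]
      by_cases hvy : G₂.r (π.f y) = π.f y
      · rw [π.stFun_pos hvy hey, e3, stInv_of_nexc, π.map_i]
        rw [← π.map_i, ← π.map_r, ← e1, π.map_root_i hvy, ← hvy, ← π.map_r]
        exact nexc_map h₁ π hy
      · have f1 := π.flag_map_i hvx
        have f2 := π.flag_map_i hvy
        rw [e2] at f2
        have hexc := IsQuasiStable.exc_map π hf he f1 f2
        rw [π.stFun_flag hvy, stInv_of_exc, ← π.map_i, π.sw_map hf he f1 f2, ← e2, π.map_i,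
          G₂.i_i]
        rwa [← π.map_i, ← π.map_r]
  · rw [stInv_of_nexc he, π.stFun_nexc he, π.stFun_nexc (by rwa [G₁.i_i]), stInv_of_nexc, π.map_i]
    rw [← π.map_i, ← π.map_r]
    exact nexc_map h₁ π he

lemma stFun_preimage (h₁ : G₁.IsQuasiStable g) (π : Hom G₁ G₂)
    {w : G₂.X} (hw : G₂.r w = w) (x : h₁.st.X) :
    π.stFun x.1 = w ↔ x ∈ h₁.stSet (π.f ⁻¹' {w}) := by
  change _ ↔ π.f x.1 = w ∧ (G₁.Exc (G₁.r (G₁.i x.1)) → π.f (G₁.sw (G₁.i x.1)) = w)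
  constructor
  · intro h
    by_cases hvx : G₂.r (π.f x.1) = π.f x.1
    · by_cases he : G₁.Exc (G₁.r (G₁.i x.1))
      · obtain ⟨s1, s2, s3, s4⟩ := sw_spec (IsQuasiStable.flag_i x.2 he) he
        rw [π.stFun_pos hvx he] at h
        refine ⟨?_, fun _ => h⟩
        rw [← π.map_root_i hvx, ← s3, π.map_r, h, hw]
      · rw [π.stFun_nexc he] at h
        exact ⟨h, fun h' => absurd h' he⟩
    · rw [π.stFun_flag hvx] at h
      exact absurd (by rw [h, hw]) hvx
  · rintro ⟨h, h'⟩
    by_cases he : G₁.Exc (G₁.r (G₁.i x.1))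
    · rw [π.stFun_pos (by rw [h, hw]) he, h' he]
    · rw [π.stFun_nexc he, h]

lemma stFun_unique (h₁ : G₁.IsQuasiStable g) (π : Hom G₁ G₂)
    {y : G₂.X} (hy : G₂.r y ≠ y) (hye : ¬ G₂.Exc (G₂.r y)) :
    ∃ x : h₁.st.X, π.stFun x.1 = y ∧ ∀ x' : h₁.st.X, π.stFun x'.1 = y → x' = x := by
  obtain ⟨x, hx, hu⟩ := π.flag y hy
  have hpx : G₂.r (π.f x) ≠ π.f x := by rwa [hx]
  have hxf := π.flag_of_flag hpx
  by_cases he : G₁.Exc (G₁.r x)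
  · obtain ⟨s1, s2, s3, s4⟩ := sw_spec hxf he
    have hsv : G₂.r (π.f (G₁.sw x)) = π.f (G₁.sw x) := by
      by_contra hc
      have := IsQuasiStable.exc_map π hxf he hpx hc
      rw [π.map_r, hx] at this
      exact hye this
    have hse : G₁.Exc (G₁.r (G₁.sw x)) := by rwa [s3]
    refine ⟨⟨G₁.i (G₁.sw x), h₁.nexc_i s2 hse⟩, ?_, ?_⟩
    · have hiv : G₂.r (π.f (G₁.i (G₁.sw x))) = π.f (G₁.i (G₁.sw x)) := by
        rw [π.i_of_vertex hsv, hsv]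
      rw [π.stFun_pos hiv (by rwa [G₁.i_i]), G₁.i_i, sw_sw hxf he, hx]
    · rintro ⟨z, hz⟩ hzy
      apply Subtype.ext
      by_cases hc : G₂.r (π.f z) = π.f z ∧ G₁.Exc (G₁.r (G₁.i z))
      · rw [π.stFun_pos hc.1 hc.2] at hzy
        have h3 := hu _ hzy
        change z = G₁.i (G₁.sw x)
        rw [← h3, sw_sw (IsQuasiStable.flag_i hz hc.2) hc.2, G₁.i_i]
      · have : π.stFun z = π.f z := if_neg hc
        rw [this] at hzy
        exact absurd (by rwa [hu _ hzy]) hz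
  · refine ⟨⟨x, he⟩, by rw [π.stFun_flag hpx, hx], ?_⟩
    rintro ⟨z, hz⟩ hzy
    apply Subtype.ext
    by_cases hc : G₂.r (π.f z) = π.f z ∧ G₁.Exc (G₁.r (G₁.i z))
    · rw [π.stFun_pos hc.1 hc.2] at hzy
      obtain ⟨s1, s2, s3, s4⟩ := sw_spec (IsQuasiStable.flag_i hz hc.2) hc.2
      have h3 := hu _ hzy
      exact absurd (by rw [← h3, s3]; exact hc.2) he
    · have : π.stFun z = π.f z := if_neg hc
      rw [this] at hzy
      exact hu _ hzy

lemma exists_flag_preimage (π : Hom G₁ G₂) {w : G₂.X} (hwe : ¬ G₂.Exc w) :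
    ∀ v ∈ π.f ⁻¹' {w}, G₁.Exc v → ∃ x ∈ π.f ⁻¹' {w}, G₁.r x ≠ x ∧ G₁.r x = v := by
  intro v hv he
  simp only [Set.mem_preimage, Set.mem_singleton_iff] at hv ⊢
  obtain ⟨x, hxf, hx⟩ := exists_flag he
  obtain ⟨s1, s2, s3, s4⟩ := sw_spec hxf (by rwa [hx])
  by_contra hc
  push Not at hc
  have key : ∀ y, G₁.r y ≠ y → G₁.r y = v → G₂.r (π.f y) ≠ π.f y := by
    intro y hy hyv h
    refine hc y ?_ hy hyv
    rw [← h, ← π.map_r, hyv, hv]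
  have := IsQuasiStable.exc_map π hxf (by rwa [hx]) (key x hxf hx) (key _ s2 (by rw [s3, hx]))
  rw [hx, hv] at this
  exact hwe this

lemma preimage_r (π : Hom G₁ G₂) {w : G₂.X} (hw : G₂.r w = w) :
    ∀ x ∈ π.f ⁻¹' {w}, G₁.r x ∈ π.f ⁻¹' {w} := by
  intro x hx
  simp only [Set.mem_preimage, Set.mem_singleton_iff] at hx ⊢
  rw [π.map_r, hx, hw]

lemma preimage_i (π : Hom G₁ G₂) {w : G₂.X} (hw : G₂.r w = w) :
    ∀ x ∈ π.f ⁻¹' {w}, G₁.i x ∈ π.f ⁻¹' {w} := by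
  intro x hx
  simp only [Set.mem_preimage, Set.mem_singleton_iff] at hx ⊢
  rw [π.map_i, hx, i_vertex hw]

/-- `stFun` as a map between the underlying sets of the stabilizations -/
noncomputable def stMap (h₁ : G₁.IsQuasiStable g) (h₂ : G₂.IsQuasiStable g) (π : Hom G₁ G₂)
    (x : h₁.st.X) : h₂.st.X :=
  ⟨π.stFun x.1, by rw [π.stFun_r x.2]; exact nexc_map h₁ π x.2⟩

lemma stFun_preimage_set (h₁ : G₁.IsQuasiStable g) (h₂ : G₂.IsQuasiStable g) (π : Hom G₁ G₂)
    (w : h₂.st.V) :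
    stMap h₁ h₂ π ⁻¹' {w.1} = h₁.stSet (π.f ⁻¹' {w.1.1}) := by
  ext x
  rw [← stFun_preimage h₁ π (congrArg Subtype.val w.2) x]
  exact Subtype.ext_iff

/-- the stabilization of a morphism of quasi-stable graphs -/
noncomputable def st (h₁ : G₁.IsQuasiStable g) (h₂ : G₂.IsQuasiStable g) (π : Hom G₁ G₂) :
    Hom h₁.st h₂.st where
  f := stMap h₁ h₂ π
  map_r x := Subtype.ext (by
    change π.stFun (G₁.r x.1) = G₂.r (π.stFun x.1)
    rw [π.stFun_r x.2, π.stFun_nexc]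
    rw [G₁.i_r, G₁.r_r]; exact x.2)
  map_i x := Subtype.ext (stFun_i h₁ π x.2)
  flag y hy := by
    obtain ⟨x, hx, hu⟩ := stFun_unique h₁ π (y := y.1) (fun h => hy (Subtype.ext h)) y.2
    exact ⟨x, Subtype.ext hx, fun x' hx' => hu x' (congrArg Subtype.val hx')⟩
  leg j := Subtype.ext (by
    change π.stFun (G₁.m j).1 = (G₂.m j).1
    rw [π.stFun_nexc, π.leg]
    rw [(G₁.m j).2.1]
    exact h₁.leg_nexc (G₁.m j).2.1 (G₁.m j).2.2)
  conn w := by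
    have hw : G₂.r w.1.1 = w.1.1 := congrArg Subtype.val w.2
    rw [stFun_preimage_set h₁ h₂ π w]
    exact h₁.conn_stSet _ (π.preimage_r hw) (π.preimage_i hw)
      (π.exists_flag_preimage (by have := w.1.2; rwa [hw] at this)) (π.conn ⟨_, hw⟩)
  genus w := by
    have hw : G₂.r w.1.1 = w.1.1 := congrArg Subtype.val w.2
    rw [stFun_preimage_set h₁ h₂ π w]
    rw [h₁.genus_stSet _ (π.preimage_r hw) (π.preimage_i hw)
      (π.exists_flag_preimage (by have := w.1.2; rwa [hw] at this)), π.genus ⟨_, hw⟩]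
    rfl

lemma st_id (h₁ : G₁.IsQuasiStable g) : st h₁ h₁ (Hom.id G₁) = Hom.id h₁.st := by
  refine Hom.ext (funext fun x => Subtype.ext ?_)
  change (Hom.id G₁).stFun x.1 = x.1
  by_cases hv : G₁.r x.1 = x.1
  · rw [stFun_nexc]; · rfl
    rw [i_vertex hv]; exact x.2
  · exact stFun_flag _ hv

lemma st_comp (h₁ : G₁.IsQuasiStable g) (h₂ : G₂.IsQuasiStable g) (h₃ : G₃.IsQuasiStable g)
    (π : Hom G₁ G₂) (ρ : Hom G₂ G₃) :
    st h₁ h₃ (π.comp ρ) = (st h₁ h₂ π).comp (st h₂ h₃ ρ) := by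
  refine Hom.ext (funext fun x => Subtype.ext ?_)
  obtain ⟨x, hx⟩ := x
  change (π.comp ρ).stFun x = ρ.stFun (π.stFun x)
  by_cases he : G₁.Exc (G₁.r (G₁.i x))
  · have hf := IsQuasiStable.flag_i hx he
    obtain ⟨s1, s2, s3, s4⟩ := sw_spec hf he
    by_cases hvx : G₂.r (π.f x) = π.f x
    · rw [π.stFun_pos hvx he]
      have h3 : G₃.r ((π.comp ρ).f x) = (π.comp ρ).f x := by
        change G₃.r (ρ.f (π.f x)) = ρ.f (π.f x)
        rw [← ρ.map_r, hvx]
      rw [stFun_pos _ h3 he, stFun_nexc]; · rfl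
      rw [← π.map_i, ← π.map_r]
      exact nexc_map h₁ π (h₁.nexc_i s2 (by rwa [s3]))
    · rw [π.stFun_flag hvx]
      have hvi := π.flag_map_i hvx
      by_cases h3 : G₃.r (ρ.f (π.f x)) = ρ.f (π.f x)
      · have h3' : G₃.r ((π.comp ρ).f x) = (π.comp ρ).f x := h3
        rw [stFun_pos _ h3' he]
        change ρ.f (π.f (G₁.sw (G₁.i x))) = _
        by_cases he2 : G₂.Exc (G₂.r (G₂.i (π.f x)))
        · rw [ρ.stFun_pos h3 he2, ← π.map_i, π.sw_map hf he hvi]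
          intro hc
          have hk := nexc_map h₁ π (h₁.nexc_i s2 (by rwa [s3]))
          rw [π.map_root_i hc, ← hc, ← π.map_r, s3, π.map_r, π.map_i] at hk
          exact hk he2
        · rw [ρ.stFun_nexc he2]
          have hc : G₂.r (π.f (G₁.sw (G₁.i x))) = π.f (G₁.sw (G₁.i x)) := by
            by_contra hc
            have := IsQuasiStable.exc_map π hf he hvi hc
            rw [π.map_r, π.map_i] at this
            exact he2 this
          rw [← hc, ← π.map_r, s3, π.map_r, π.map_i, ρ.map_root_i h3]
      · have h3' : G₃.r ((π.comp ρ).f x) ≠ (π.comp ρ).f x := h3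
        rw [stFun_flag _ h3', stFun_flag _ h3]; rfl
  · rw [stFun_nexc _ he, stFun_nexc _ he, stFun_nexc]; · rfl
    rw [← π.map_i, ← π.map_r]
    exact nexc_map h₁ π he

end Hom

end MGraph

end Graphs

section Lengths

namespace MGraph

variable {n : ℕ} {G G₁ G₂ G₃ : MGraph n} {g : ℕ}

open scoped Classical in
/-- the length of the edge of `x` if `x` is a half-edge, and zero otherwise -/
noncomputable def len (l : G.E → ℝ) (x : G.X) : ℝ :=
  if hx : G.i x ≠ x then l (G.edge x hx) else 0

lemma len_half (l : G.E → ℝ) {x : G.X} (hx : G.i x ≠ x) : G.len l x = l (G.edge x hx) :=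
  dif_pos hx

lemma len_zero (l : G.E → ℝ) {x : G.X} (hx : G.i x = x) : G.len l x = 0 :=
  dif_neg (not_not.2 hx)

lemma len_vertex (l : G.E → ℝ) {x : G.X} (hx : G.r x = x) : G.len l x = 0 :=
  len_zero l (Hom.i_vertex hx)

lemma len_i (l : G.E → ℝ) (x : G.X) : G.len l (G.i x) = G.len l x := by
  by_cases hx : G.i x = x
  · rw [hx]
  · rw [len_half l hx, len_half l (half_i hx), edge_i hx]

lemma len_nonneg {l : G.E → ℝ} (hl : ∀ e, 0 ≤ l e) (x : G.X) : 0 ≤ G.len l x := by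
  unfold len; split
  · exact hl _
  · exact le_rfl

/-- A morphism `π : G₁ ⟶ G₂` is compatible with the lengths `l` and `d` if `d` is the restriction
of `l` to the edges that are not contracted, and `l` is zero on the contracted edges (so `l` is
the image of `d` under the face inclusion of cones of edge lengths induced by `π`). -/
def Hom.Compat (π : Hom G₁ G₂) (l : G₁.E → ℝ) (d : G₂.E → ℝ) : Prop :=
  ∀ x, G₁.len l x = G₂.len d (π.f x)

lemma Hom.Compat.id (l : G.E → ℝ) : (Hom.id G).Compat l l := fun _ => rfl

lemma Hom.Compat.comp {π : Hom G₁ G₂} {ρ : Hom G₂ G₃} {l : G₁.E → ℝ} {d : G₂.E → ℝ}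
    {d' : G₃.E → ℝ} (h : π.Compat l d) (h' : ρ.Compat d d') : (π.comp ρ).Compat l d' :=
  fun x => (h x).trans (h' _)

namespace IsQuasiStable

open scoped Classical in
noncomputable def stLenAux (G : MGraph n) (l : G.E → ℝ) (x : G.X) : ℝ :=
  G.len l x + if G.Exc (G.r (G.i x)) then G.len l (G.stInv x) else 0

lemma stLenAux_stInv (l : G.E → ℝ) {x : G.X} (hx : ¬ G.Exc (G.r x)) :
    stLenAux G l (G.stInv x) = stLenAux G l x := by
  unfold stLenAux
  by_cases he : G.Exc (G.r (G.i x))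
  · rw [if_pos he, stInv_stInv hx, (stInv_exc_root hx he).1, if_pos he, add_comm]
  · rw [if_neg he, stInv_of_nexc he, G.i_i, if_neg hx, len_i]

/-- The lengths on the stabilization: a nonexceptional edge keeps its length, and the length of an
exceptional edge is the sum of the lengths of the two edges that it consists of. -/
noncomputable def stLen (hG : G.IsQuasiStable g) (l : G.E → ℝ) : hG.st.E → ℝ :=
  Quotient.lift (s := hG.st.edgeSetoid) (fun x => stLenAux G l x.1.1) (by
    rintro x y (h | h)
    · rw [h]
    · rw [h]; exact (stLenAux_stInv l x.1.2).symm)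

lemma len_stLen (hG : G.IsQuasiStable g) (l : G.E → ℝ) (x : hG.st.X) :
    hG.st.len (hG.stLen l) x = stLenAux G l x.1 := by
  by_cases hx : hG.st.i x = x
  · have h : G.i x.1 = x.1 := (stInv_eq_iff x.2).1 (congrArg Subtype.val hx)
    rw [len_zero _ hx]
    unfold stLenAux
    rw [len_zero _ h, h, if_neg x.2, add_zero]
  · rw [len_half _ hx]; rfl

lemma stLen_pos (hG : G.IsQuasiStable g) {l : G.E → ℝ} (hl : ∀ e, 0 < l e) (e : hG.st.E) :
    0 < hG.stLen l e := by
  induction e using edge_ind with | H x hx =>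
  have h : G.i x.1 ≠ x.1 := fun h => hx (Subtype.ext ((stInv_eq_iff x.2).2 h))
  rw [← len_half (hG.stLen l) hx, len_stLen]
  unfold stLenAux
  have h1 : 0 < G.len l x.1 := by rw [len_half l h]; exact hl _
  have h2 : 0 ≤ G.len l (G.stInv x.1) := len_nonneg (fun e => (hl e).le) _
  split <;> linarith

lemma compat_st (h₁ : G₁.IsQuasiStable g) (h₂ : G₂.IsQuasiStable g) {π : Hom G₁ G₂}
    {l : G₁.E → ℝ} {d : G₂.E → ℝ} (h : π.Compat l d) :
    (Hom.st h₁ h₂ π).Compat (h₁.stLen l) (h₂.stLen d) := by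
  intro z
  refine (h₁.len_stLen l z).trans (Eq.trans ?_ (h₂.len_stLen d _).symm)
  obtain ⟨x, hx⟩ := z
  change stLenAux G₁ l x = stLenAux G₂ d (π.stFun x)
  by_cases he : G₁.Exc (G₁.r (G₁.i x))
  · have hf := flag_i hx he
    obtain ⟨e1, e2⟩ := stInv_exc_root hx he
    have hi := Hom.stFun_i h₁ π hx
    have hy := h₁.stInv_nexc hx
    have hLHS : stLenAux G₁ l x = G₂.len d (π.f x) + G₂.len d (π.f (G₁.stInv x)) := by
      unfold stLenAux; rw [if_pos he, h, h]
    rw [hLHS]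
    set y := G₁.stInv x with hydef
    by_cases hvx : G₂.r (π.f x) = π.f x
    · rw [len_vertex d hvx, zero_add, π.stFun_pos hvx he, ← e2, π.map_i]
      unfold stLenAux
      rw [len_i, if_neg, add_zero]
      rw [G₂.i_i, ← π.map_r]
      exact Hom.nexc_map h₁ π hy
    · rw [π.stFun_flag hvx] at hi ⊢
      by_cases hvy : G₂.r (π.f y) = π.f y
      · rw [len_vertex d hvy, add_zero]
        unfold stLenAux
        rw [if_neg, add_zero]
        rw [← π.map_i, ← π.map_r, ← e1, π.map_root_i hvy, ← hvy, ← π.map_r]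
        exact Hom.nexc_map h₁ π hy
      · rw [π.stFun_flag hvy] at hi
        have f1 := π.flag_map_i hvx
        have f2 := π.flag_map_i hvy
        rw [e2] at f2
        have hexc := exc_map π hf he f1 f2
        unfold stLenAux
        rw [if_pos, hi]
        rwa [← π.map_i, ← π.map_r]
  · rw [π.stFun_nexc he]
    unfold stLenAux
    rw [if_neg he, add_zero, if_neg, add_zero, h]
    rw [← π.map_i, ← π.map_r]
    exact Hom.nexc_map h₁ π he

end IsQuasiStable

end MGraph

end Lengths

section Categories

/-- stable graphs of type `(g, n)` -/
structure SG (g n : ℕ) where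
  G : MGraph n
  stable : G.IsStable g

/-- quasi-stable graphs of type `(g, n)` together with an admissible divisor -/
structure QD (g n : ℕ) where
  G : MGraph n
  qs : G.IsQuasiStable g
  D : G.V → ℤ
  adm : ∀ v : G.V, G.Exc v.1 → D v = 1

variable {g n : ℕ}

@[ext]
structure SG.Hom (A B : SG g n) where
  π : A.G ⟶ B.G

instance : Category (SG g n) where
  Hom := SG.Hom
  id A := ⟨𝟙 A.G⟩
  comp f f' := ⟨f.π ≫ f'.π⟩

open scoped Classical in
/-- morphisms of graphs such that the push-forward of the divisor of `A` is that of `B` -/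
@[ext]
structure QD.Hom (A B : QD g n) where
  π : A.G ⟶ B.G
  push : ∀ v : B.G.V, B.D v = ∑ w : A.G.V, if MGraph.Hom.f π w.1 = v.1 then A.D w else 0

namespace MGraph

lemma Hom.map_vertex {G₁ G₂ : MGraph n} (π : Hom G₁ G₂) {v : G₁.X} (hv : G₁.r v = v) :
    G₂.r (π.f v) = π.f v := by rw [← π.map_r, hv]

open scoped Classical in
lemma push_id {M : Type*} [AddCommMonoid M] {G : MGraph n} (D : G.V → M) (v : G.V) :
    D v = ∑ w : G.V, if Hom.f (𝟙 G) w.1 = v.1 then D w else 0 := by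
  rw [Finset.sum_eq_single v]
  · rw [if_pos]; rfl
  · intro w _ hw
    rw [if_neg]
    exact fun h => hw (Subtype.ext h)
  · simp

open scoped Classical in
lemma push_comp {M : Type*} [AddCommMonoid M] {G₁ G₂ G₃ : MGraph n} (π : G₁ ⟶ G₂) (ρ : G₂ ⟶ G₃)
    (D₁ : G₁.V → M) (D₂ : G₂.V → M) (D₃ : G₃.V → M)
    (h : ∀ v : G₂.V, D₂ v = ∑ w : G₁.V, if Hom.f π w.1 = v.1 then D₁ w else 0)
    (h' : ∀ v : G₃.V, D₃ v = ∑ w : G₂.V, if Hom.f ρ w.1 = v.1 then D₂ w else 0) (v : G₃.V) :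
    D₃ v = ∑ w : G₁.V, if Hom.f (π ≫ ρ) w.1 = v.1 then D₁ w else 0 := by
  rw [h']
  have e : ∀ w : G₂.V, (if Hom.f ρ w.1 = v.1 then D₂ w else 0)
      = ∑ u : G₁.V, if Hom.f π u.1 = w.1 then (if Hom.f ρ w.1 = v.1 then D₁ u else 0) else 0 := by
    intro w
    by_cases hw : Hom.f ρ w.1 = v.1
    · simp [hw, h]
    · simp [hw]
  rw [Finset.sum_congr rfl fun w _ => e w, Finset.sum_comm]
  refine Finset.sum_congr rfl fun u _ => ?_
  rw [Finset.sum_eq_single ⟨Hom.f π u.1, Hom.map_vertex π u.2⟩]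
  · rw [if_pos rfl]; rfl
  · intro w _ hw
    rw [if_neg]
    exact fun h => hw (Subtype.ext h.symm)
  · simp

end MGraph

instance : Category (QD g n) where
  Hom := QD.Hom
  id A := ⟨𝟙 A.G, fun v => MGraph.push_id A.D v⟩
  comp f f' := ⟨f.π ≫ f'.π, MGraph.push_comp f.π f'.π _ _ _ f.push f'.push⟩

/-- the underlying graph -/
def SG.forget : SG g n ⥤ MGraph n where
  obj A := A.G
  map f := SG.Hom.π f

/-- the underlying graph -/
def QD.forget : QD g n ⥤ MGraph n where
  obj A := A.G
  map f := QD.Hom.π f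

/-- forgetting the divisor and stabilizing the graph -/
noncomputable def QD.st : QD g n ⥤ SG g n where
  obj A := ⟨A.qs.st, A.qs.st_stable⟩
  map {A B} f := ⟨MGraph.Hom.st A.qs B.qs (QD.Hom.π f)⟩
  map_id A := SG.Hom.ext (MGraph.Hom.st_id A.qs)
  map_comp {A B C} _ _ := SG.Hom.ext (MGraph.Hom.st_comp A.qs B.qs C.qs _ _)

end Categories

section Stability

variable {g n : ℕ}

open scoped Classical in
/-- Universal stability conditions of type `(g, n)`: real-valued functions on the vertices of all
stable graphs of type `(g, n)`, with integral total degree, compatible with all morphisms. -/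
structure StabCond (g n : ℕ) where
  φ : ∀ A : SG g n, A.G.V → ℝ
  integral : ∀ A, ∃ k : ℤ, ∑ v, φ A v = k
  push : ∀ {A B : SG g n} (f : A ⟶ B) (v : B.G.V),
    φ B v = ∑ w : A.G.V, if MGraph.Hom.f (SG.Hom.π f) w.1 = v.1 then φ A w else 0

open scoped Classical in
/-- The value at a vertex of a quasi-stable graph of a stability condition: zero at the
exceptional vertices, and the value at the corresponding vertex of the stabilization at the
other ones. -/
noncomputable def StabCond.ext (s : StabCond g n) (A : QD g n) (v : A.G.V) : ℝ :=
  if h : A.G.Exc v.1 then 0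
  else s.φ (QD.st.obj A) ⟨⟨v.1, by rw [v.2]; exact h⟩, Subtype.ext v.2⟩

/-- the degree of the divisor -/
noncomputable def QD.deg (A : QD g n) : ℤ := ∑ v, A.D v

open scoped Classical in
/-- the number of edges of `G` joining a vertex in `S` to a vertex in the complement of `S` -/
noncomputable def MGraph.cut (G : MGraph n) (S : Finset G.V) : ℕ :=
  (Finset.univ.filter fun e : G.E => ∃ x hx, G.edge x hx = e ∧
    ⟨G.r x, G.r_r x⟩ ∈ S ∧ ⟨G.r (G.i x), G.r_r _⟩ ∉ S).card

/-- semistability of the divisor with respect to a universal stability condition -/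
def QD.IsSemistable (s : StabCond g n) (A : QD g n) : Prop :=
  (A.deg : ℝ) = ∑ v, s.ext A v ∧
    ∀ S : Finset A.G.V,
      ∑ v ∈ S, s.ext A v - (A.G.cut S : ℝ) / 2 ≤ ((∑ v ∈ S, A.D v : ℤ) : ℝ) ∧
      ((∑ v ∈ S, A.D v : ℤ) : ℝ) ≤ ∑ v ∈ S, s.ext A v + (A.G.cut S : ℝ) / 2

/-- simplicity: the graph obtained by removing all exceptional vertices, together with the edges
incident to them, is connected -/
def QD.IsSimple (A : QD g n) : Prop :=
  A.G.ConnOn {x | ¬ A.G.Exc (A.G.r x) ∧ ¬ A.G.Exc (A.G.r (A.G.i x))}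

end Stability

/-! ### Topological realizations -/

section Realization

open Topology

universe u v

variable {n : ℕ} {C : Type u} [Category.{v} C]

/-- Points: graphs with real edge lengths.  Here `C` is a category of graphs with additional
structure, and `U` is the functor to the underlying graphs. -/
structure Pt (U : C ⥤ MGraph n) where
  x : C
  d : (U.obj x).E → ℝ
  pos : ∀ e, 0 < d e

variable (U : C ⥤ MGraph n)

/-- A chart on a space `Z` of a collection of points `pt` of the realization, with specialization
maps `sp`: a graph `x` with continuously varying edge lengths `l` (which may be zero), i.e. a
continuous map from `Z` to the cone of `x`, such that the curve at `t` is obtained by contracting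
the edges of length zero and such that the specialization maps are those induced by the
contractions of `x`. -/
structure Chart {Z : Type*} [TopologicalSpace Z] (pt : Z → Pt U)
    (sp : ∀ t₀ t, Option ((pt t).x ⟶ (pt t₀).x)) where
  x : C
  l : Z → (U.obj x).E → ℝ
  cont : Continuous l
  π : ∀ t, x ⟶ (pt t).x
  compat : ∀ t, (U.map (π t)).Compat (l t) (pt t).d
  spec : ∀ t₀, ∀ᶠ t in 𝓝 t₀, ∃ κ, sp t₀ t = some κ ∧ π t ≫ κ = π t₀

/-- A continuous family of points of the realization over a space `T`: a point for each `t`,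
together with specialization maps, defined for `t` near `t₀`, from the curve at `t` to the curve
at `t₀` (only their germs at `t₀` will matter), such that locally `T` is covered by finitely many
closed subsets on which there are charts.  In other words, this is an object over `T` of the stack
associated with the cone stack for the topology that is generated by open coverings and by
coverings by finitely many closed subsets. -/
structure Fam (T : TopCat.{1}) where
  pt : T → Pt U
  sp : ∀ t₀ t, Option ((pt t).x ⟶ (pt t₀).x)
  charts : ∀ t₀, ∃ N : Set T, IsOpen N ∧ t₀ ∈ N ∧ ∃ (k : ℕ) (F : Fin k → Set T),
    (∀ j, IsClosed (F j)) ∧ N ⊆ ⋃ j, F j ∧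
    ∀ j, Nonempty (Chart U (Z := (F j ∩ N : Set T)) (fun t => pt t.1) (fun t₀ t => sp t₀.1 t.1))

variable {U}

lemma Fam.eventually_sp {T : TopCat.{1}} (A : Fam U T) (t₀ : T) :
    ∀ᶠ t in 𝓝 t₀, ∃ κ, A.sp t₀ t = some κ := by
  obtain ⟨N, hN, hN₀, k, F, hF, hNF, hc⟩ := A.charts t₀
  have h : ∀ j, ∀ᶠ t in 𝓝 t₀, t ∈ F j ∩ N → ∃ κ, A.sp t₀ t = some κ := by
    intro j
    by_cases hj : t₀ ∈ F j
    · obtain ⟨c⟩ := hc j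
      have h1 := Filter.eventually_comap.1 (nhds_subtype_eq_comap (X := T) (p := fun t =>
        t ∈ F j ∩ N) ▸ c.spec ⟨t₀, hj, hN₀⟩)
      filter_upwards [h1] with t ht htF
      obtain ⟨κ, hκ, _⟩ := ht ⟨t, htF⟩ rfl
      exact ⟨κ, hκ⟩
    · filter_upwards [(hF j).isOpen_compl.mem_nhds hj] with t ht htF
      exact absurd htF.1 ht
  filter_upwards [Filter.eventually_all.2 h, hN.mem_nhds hN₀] with t ht htN
  obtain ⟨j, hj⟩ := Set.mem_iUnion.1 (hNF htN)
  exact ht j ⟨hj, htN⟩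

variable (U)

/-- The topological realization, as a category over the category of topological spaces: the
objects are the continuous families over topological spaces. -/
structure Realization where
  T : TopCat.{1}
  fam : Fam U T

variable {U}

/-- A morphism of families: a continuous map `base` between the base spaces and, for all `t`, an
isomorphism `φ t` from the curve at `t` to the curve at `base t`, preserving the lengths, such
that these isomorphisms are compatible with the specialization maps. -/
structure Realization.Hom (A B : Realization U) where
  base : A.T ⟶ B.T
  φ : ∀ t, (A.fam.pt t).x ≅ (B.fam.pt (base t)).x
  isom : ∀ t, (U.map (φ t).hom).Compat (A.fam.pt t).d (B.fam.pt (base t)).d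
  germ : ∀ t₀, ∀ᶠ t in 𝓝 t₀, ∃ κ κ', A.fam.sp t₀ t = some κ ∧
    B.fam.sp (base t₀) (base t) = some κ' ∧ κ ≫ (φ t₀).hom = (φ t).hom ≫ κ'

namespace Realization

lemma Hom.ext' {A B : Realization U} {f f' : Hom A B} (h : f.base = f'.base)
    (h' : ∀ t, HEq (f.φ t).hom (f'.φ t).hom) : f = f' := by
  obtain ⟨b, φ, _, _⟩ := f
  obtain ⟨b', φ', _, _⟩ := f'
  obtain rfl : b = b' := h
  have : φ = φ' := funext fun t => Iso.ext (eq_of_heq (h' t))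
  subst this
  rfl

lemma compat_id (p : Pt U) : (U.map (𝟙 p.x)).Compat p.d p.d := by
  rw [U.map_id]; exact MGraph.Hom.Compat.id _

lemma compat_comp {x y z : C} {f : x ⟶ y} {f' : y ⟶ z} {l d e} (h : (U.map f).Compat l d)
    (h' : (U.map f').Compat d e) : (U.map (f ≫ f')).Compat l e := by
  rw [U.map_comp]; exact MGraph.Hom.Compat.comp h h'

def Hom.id (A : Realization U) : Hom A A where
  base := 𝟙 A.T
  φ _ := Iso.refl _
  isom t := compat_id _
  germ t₀ := by
    filter_upwards [A.fam.eventually_sp t₀] with t ⟨κ, hκ⟩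
    exact ⟨κ, κ, hκ, hκ, (Category.comp_id κ).trans (Category.id_comp κ).symm⟩

def Hom.comp {A B D : Realization U} (f : Hom A B) (f' : Hom B D) : Hom A D where
  base := f.base ≫ f'.base
  φ t := f.φ t ≪≫ f'.φ (f.base t)
  isom t := compat_comp (f.isom t) (f'.isom _)
  germ t₀ := by
    have h := f.base.hom.continuous.continuousAt (x := t₀)
    filter_upwards [f.germ t₀, h.eventually (f'.germ (f.base t₀))] with t
      ⟨κ, κ₁, h1, h2, h3⟩ ⟨κ₂, κ', h4, h5, h6⟩
    obtain rfl : κ₁ = κ₂ := Option.some.inj (h2.symm.trans h4)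
    refine ⟨κ, κ', h1, h5, ?_⟩
    rw [Iso.trans_hom, Iso.trans_hom, Category.assoc, ← h6, ← Category.assoc, h3, Category.assoc]

instance : Category (Realization U) where
  Hom := Hom
  id := Hom.id
  comp := Hom.comp
  id_comp _ := Hom.ext' rfl fun _ => heq_of_eq (Category.id_comp _)
  comp_id _ := Hom.ext' rfl fun _ => heq_of_eq (Category.comp_id _)
  assoc _ _ _ := Hom.ext' rfl fun _ => heq_of_eq (Category.assoc _ _ _)

/-- the projection to topological spaces -/
def proj : Realization U ⥤ TopCat.{1} where
  obj A := A.T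
  map f := Hom.base f

/-- The morphism from the one-point space to the realization that corresponds to a point `p`: a
space `T` (over the one-point space) is sent to the constant family `p` over `T`. -/
def point (p : Pt U) : Over (TopCat.of PUnit.{2}) ⥤ Realization U where
  obj T :=
    { T := T.left
      fam :=
        { pt := fun _ => p
          sp := fun _ _ => some (𝟙 _)
          charts := fun _ => ⟨Set.univ, isOpen_univ, trivial, 1, fun _ => Set.univ,
            fun _ => isClosed_univ, fun _ _ => Set.mem_iUnion.2 ⟨0, trivial⟩, fun _ =>
            ⟨{  x := p.x
                l := fun _ => p.d
                cont := continuous_const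
                π := fun _ => 𝟙 _
                compat := fun _ => compat_id _
                spec := fun _ => Filter.Eventually.of_forall fun _ => ⟨𝟙 _, rfl, Category.comp_id _⟩ }⟩⟩ } }
  map f :=
    { base := f.left
      φ := fun _ => Iso.refl _
      isom := fun _ => compat_id p
      germ := fun _ => Filter.Eventually.of_forall fun _ => ⟨𝟙 p.x, 𝟙 p.x, rfl, rfl, rfl⟩ }
  map_id _ := Hom.ext' rfl fun _ => HEq.rfl
  map_comp _ _ := Hom.ext' rfl fun _ => heq_of_eq (Category.comp_id (𝟙 p.x)).symm

end Realization

/-- A morphism of combinatorial cone stacks: a functor `W`, together with compatible maps between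
the cones of edge lengths, sending interior points to interior points. -/
structure ConeMap {C' : Type*} [Category C'] (U : C ⥤ MGraph n) (U' : C' ⥤ MGraph n) where
  W : C ⥤ C'
  len : ∀ x, ((U.obj x).E → ℝ) → (U'.obj (W.obj x)).E → ℝ
  cont : ∀ x, Continuous (len x)
  pos : ∀ x d, (∀ e, 0 < d e) → ∀ e, 0 < len x d e
  compat : ∀ {x y} (π : x ⟶ y) l d, (U.map π).Compat l d →
    (U'.map (W.map π)).Compat (len x l) (len y d)

namespace ConeMap

variable {C' : Type*} [Category C'] {U' : C' ⥤ MGraph n} (M : ConeMap U U')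

/-- the morphism of realizations induced by a morphism of combinatorial cone stacks, on points -/
def mapPt (p : Pt U) : Pt U' := ⟨M.W.obj p.x, M.len p.x p.d, M.pos _ _ p.pos⟩

/-- the morphism of realizations induced by a morphism of combinatorial cone stacks, on families -/
def mapFam {T : TopCat.{1}} (A : Fam U T) : Fam U' T where
  pt t := M.mapPt (A.pt t)
  sp t₀ t := (A.sp t₀ t).map fun κ => M.W.map κ
  charts t₀ := by
    obtain ⟨N, hN, hN₀, k, F, hF, hNF, hc⟩ := A.charts t₀
    refine ⟨N, hN, hN₀, k, F, hF, hNF, fun j => ?_⟩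
    obtain ⟨c⟩ := hc j
    exact ⟨{  x := M.W.obj c.x
              l := fun t => M.len c.x (c.l t)
              cont := (M.cont c.x).comp c.cont
              π := fun t => M.W.map (c.π t)
              compat := fun t => M.compat _ _ _ (c.compat t)
              spec := fun t₀ => by
                filter_upwards [c.spec t₀] with t ⟨κ, h1, h2⟩
                exact ⟨M.W.map κ, by rw [h1]; rfl, (M.W.map_comp _ _).symm.trans (congrArg _ h2)⟩ }⟩

/-- the morphism of realizations induced by a morphism of combinatorial cone stacks -/
def realize : Realization U ⥤ Realization U' where
  obj A := ⟨A.T, M.mapFam A.fam⟩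
  map {A B} (f : Realization.Hom A B) :=
    { base := f.base
      φ := fun t => M.W.mapIso (f.φ t)
      isom := fun t => M.compat _ _ _ (f.isom t)
      germ := fun t₀ => by
        filter_upwards [f.germ t₀] with t ⟨κ, κ', h1, h2, h3⟩
        refine ⟨M.W.map κ, M.W.map κ', ?_, ?_, ?_⟩
        · change Option.map _ (A.fam.sp t₀ t) = _
          rw [h1]; rfl
        · change Option.map _ (B.fam.sp _ _) = _
          rw [h2]; rfl
        · exact (M.W.map_comp _ _).symm.trans ((congrArg _ h3).trans (M.W.map_comp _ _)) }
  map_id _ := Realization.Hom.ext' rfl fun _ => heq_of_eq (M.W.map_id _)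
  map_comp _ _ := Realization.Hom.ext' rfl fun _ => heq_of_eq (M.W.map_comp _ _)

end ConeMap

end Realization

/-! ### The Jacobian topological space -/

section Jacobian

variable {g n : ℕ}

/-- For a stable graph `B`: the objects `obj` of the full subcategory `Q` of the category of
quasi-stable graphs with an admissible divisor, together with an isomorphism from `B` to the
stabilization of `obj`. -/
structure QDFib (Q : ObjectProperty (QD g n)) (B : SG g n) where
  obj : QD g n
  prop : Q obj
  ρ : B ≅ QD.st.obj obj

namespace QDFib

variable {Q : ObjectProperty (QD g n)} {B : SG g n}

@[ext]
structure Hom (X Y : QDFib Q B) where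
  π : X.obj ⟶ Y.obj
  comm : X.ρ.hom ≫ QD.st.map π = Y.ρ.hom

instance : Category (QDFib Q B) where
  Hom := Hom
  id X := ⟨𝟙 _, by rw [QD.st.map_id, Category.comp_id]⟩
  comp f f' := ⟨f.π ≫ f'.π, by rw [QD.st.map_comp, ← Category.assoc, f.comm, f'.comm]⟩

variable (o : B.G.E → B.G.H)

/-- Let `o` be a choice of a half-edge in each edge of `B`.  The non-exceptional half-edge of
`X` that corresponds to the half-edge `o e` under the isomorphism from `B` to the stabilization
of `X`. -/
noncomputable def flag (X : QDFib Q B) (e : B.G.E) : X.obj.G.X :=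
  (MGraph.Hom.f (SG.Hom.π X.ρ.hom) (o e).1).1

/-- The edge of the stabilization of `X` that corresponds to `e` is exceptional.  Then the
exceptional vertex is `r (i (X.flag o e))`, and we call the edge through `X.flag o e` the first
edge at this vertex. -/
def IsExc (X : QDFib Q B) (e : B.G.E) : Prop :=
  X.obj.G.Exc (X.obj.G.r (X.obj.G.i (X.flag o e)))

lemma flag_nexc (X : QDFib Q B) (e : B.G.E) : ¬ X.obj.G.Exc (X.obj.G.r (X.flag o e)) :=
  (MGraph.Hom.f (SG.Hom.π X.ρ.hom) (o e).1).2

lemma flag_flag (X : QDFib Q B) (e : B.G.E) : X.obj.G.r (X.flag o e) ≠ X.flag o e := by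
  intro h
  have h1 : (QD.st.obj X.obj).G.r (MGraph.Hom.f (SG.Hom.π X.ρ.hom) (o e).1)
      = MGraph.Hom.f (SG.Hom.π X.ρ.hom) (o e).1 := Subtype.ext h
  have h2 : ∀ x, MGraph.Hom.f (SG.Hom.π X.ρ.inv) (MGraph.Hom.f (SG.Hom.π X.ρ.hom) x) = x :=
    fun x => congrFun (congrArg (fun f => MGraph.Hom.f (SG.Hom.π f)) X.ρ.hom_inv_id) x
  have h3 := MGraph.Hom.map_vertex (SG.Hom.π X.ρ.inv) h1
  rw [h2] at h3
  exact MGraph.flag_of_half (o e).2 h3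

variable {o}

lemma Hom.flag {X Y : QDFib Q B} (f : Hom X Y) (e : B.G.E) :
    MGraph.Hom.stFun (QD.Hom.π f.π) (X.flag o e) = Y.flag o e :=
  congrArg Subtype.val (congrFun (congrArg (fun f => MGraph.Hom.f (SG.Hom.π f)) f.comm) (o e).1)

lemma Hom.isExc {X Y : QDFib Q B} (f : Hom X Y) {e : B.G.E} (h : Y.IsExc o e) : X.IsExc o e := by
  by_contra hc
  have h1 := f.flag (o := o) e
  rw [MGraph.Hom.stFun_nexc _ hc] at h1
  unfold IsExc at h
  rw [← h1, ← MGraph.Hom.map_i, ← MGraph.Hom.map_r] at h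
  exact MGraph.Hom.nexc_map X.obj.qs _ hc h

/-- the first edge of the edge `e` is contracted -/
def Hom.Contr {X Y : QDFib Q B} (o : B.G.E → B.G.H) (f : Hom X Y) (e : B.G.E) : Prop :=
  Y.obj.G.r (MGraph.Hom.f (QD.Hom.π f.π) (X.flag o e)) = MGraph.Hom.f (QD.Hom.π f.π) (X.flag o e)

lemma Hom.not_contr {X Y : QDFib Q B} (f : Hom X Y) {e : B.G.E} (h : Y.IsExc o e) :
    ¬ f.Contr o e := by
  intro hv
  have hx := f.isExc h
  have hn := X.flag_nexc o e
  have h1 := f.flag (o := o) e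
  obtain ⟨e1, e2⟩ := MGraph.IsQuasiStable.stInv_exc_root hn hx
  rw [MGraph.Hom.stFun_pos _ hv hx, ← e2] at h1
  unfold IsExc at h
  rw [← h1, ← MGraph.Hom.map_i, MGraph.i_i, ← MGraph.Hom.map_r] at h
  exact MGraph.Hom.nexc_map X.obj.qs _ (X.obj.qs.stInv_nexc hn) h

lemma Hom.flag_eq {X Y : QDFib Q B} (f : Hom X Y) {e : B.G.E}
    (h : ¬ f.Contr o e) : MGraph.Hom.f (QD.Hom.π f.π) (X.flag o e) = Y.flag o e := by
  rw [← f.flag, MGraph.Hom.stFun_flag _ h]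

lemma Hom.not_contr_of_nexc {X Y : QDFib Q B} (f : Hom X Y) {e : B.G.E} (h : ¬ X.IsExc o e) :
    ¬ f.Contr o e := by
  unfold Contr
  rw [← MGraph.Hom.stFun_nexc _ h, f.flag]
  exact Y.flag_flag o e

lemma contr_comp {X Y Z : QDFib Q B} (f : X ⟶ Y) (f' : Y ⟶ Z) {e : B.G.E} :
    Hom.Contr o (f ≫ f') e ↔ Hom.Contr o f e ∨ Hom.Contr o f' e := by
  by_cases h : Hom.Contr o f e
  · simp only [h, true_or, iff_true]
    exact MGraph.Hom.map_vertex (QD.Hom.π (Hom.π f')) h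
  · simp only [h, false_or]
    unfold Hom.Contr
    rw [← Hom.flag_eq f h]
    rfl

variable (o) (d : B.G.E → ℝ)

/-- the polytope of `X`: the product of the intervals `[0, d e]` over the exceptional edges -/
abbrev P (X : QDFib Q B) : Type := ∀ e : {e : B.G.E // X.IsExc o e}, Set.Icc (0 : ℝ) (d e.1)

variable {d}

open scoped Classical in
/-- The inclusion of a face of the polytope: at an edge that is no longer exceptional in `Y`, the
coordinate is `0` if the first edge is contracted, and `d e` if the second edge is contracted. -/
noncomputable def mapP (hd : ∀ e, 0 < d e) {X Y : QDFib Q B} (f : X ⟶ Y) (p : Y.P o d) :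
    X.P o d := fun e =>
  if h : Y.IsExc o e.1 then p ⟨e.1, h⟩
  else if Hom.Contr o f e.1 then ⟨0, le_rfl, (hd _).le⟩ else ⟨d e.1, (hd _).le, le_rfl⟩

lemma continuous_mapP (hd : ∀ e, 0 < d e) {X Y : QDFib Q B} (f : X ⟶ Y) :
    Continuous (mapP o hd f) := by
  refine continuous_pi fun e => ?_
  unfold mapP
  split
  · exact continuous_apply _
  · exact continuous_const

lemma mapP_id (hd : ∀ e, 0 < d e) (X : QDFib Q B) (p : X.P o d) : mapP o hd (𝟙 X) p = p :=
  funext fun e => dif_pos e.2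

open scoped Classical in
lemma mapP_comp (hd : ∀ e, 0 < d e) {X Y Z : QDFib Q B} (f : X ⟶ Y) (f' : Y ⟶ Z) (p : Z.P o d) :
    mapP o hd (f ≫ f') p = mapP o hd f (mapP o hd f' p) := by
  funext e
  unfold mapP
  by_cases h1 : Z.IsExc o e.1
  · rw [dif_pos h1, dif_pos (Hom.isExc f' h1), dif_pos h1]
  · rw [dif_neg h1]
    by_cases h2 : Y.IsExc o e.1
    · rw [dif_pos h2, dif_neg h1]
      refine if_congr ?_ rfl rfl
      rw [contr_comp]
      exact or_iff_right (Hom.not_contr f h2)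
    · rw [dif_neg h2]
      refine if_congr ?_ rfl rfl
      rw [contr_comp]
      exact or_iff_left (Hom.not_contr_of_nexc f' h2)

/-- the functor of polytopes -/
noncomputable def polytope (hd : ∀ e, 0 < d e) : (QDFib Q B)ᵒᵖ ⥤ TopCat.{1} where
  obj X := TopCat.of (ULift.{1} (X.unop.P o d))
  map f := TopCat.ofHom ⟨fun p => ULift.up (mapP o hd f.unop p.down),
    continuous_uliftUp.comp ((continuous_mapP o hd f.unop).comp continuous_uliftDown)⟩
  map_id X := TopCat.hom_ext (ContinuousMap.ext fun p =>
    congrArg ULift.up (mapP_id o hd X.unop p.down))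
  map_comp f f' := TopCat.hom_ext (ContinuousMap.ext fun p =>
    congrArg ULift.up (mapP_comp o hd f'.unop f.unop p.down))

end QDFib

end Jacobian

section Fiber

variable {g n : ℕ}

/-- stable tropical curves of type `(g, n)` with real edge lengths -/
abbrev StableCurve (g n : ℕ) := Pt (SG.forget (g := g) (n := n))

/-- the topological realization of the stack of stable tropical curves -/
abbrev MTrop (g n : ℕ) := Realization (SG.forget (g := g) (n := n))

/-- the topological realization of the universal tropical Jacobian, or more precisely of its
substack that is given by `Q` -/
abbrev JTrop (Q : ObjectProperty (QD g n)) := Realization (Q.ι ⋙ QD.forget)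

/-- the forgetful-stabilization morphism on cones -/
noncomputable def stabilization (Q : ObjectProperty (QD g n)) :
    ConeMap (Q.ι ⋙ QD.forget) (SG.forget (g := g) (n := n)) where
  W := Q.ι ⋙ QD.st
  len x l := x.obj.qs.stLen l
  cont x := continuous_pi fun e => by
    induction e using MGraph.edge_ind with | H y hy =>
    change Continuous fun l => MGraph.IsQuasiStable.stLenAux x.obj.G l y.1
    have h : ∀ z, Continuous fun l : x.obj.G.E → ℝ => x.obj.G.len l z := by
      intro z
      unfold MGraph.len
      split
      · exact continuous_apply _
      · exact continuous_const
    unfold MGraph.IsQuasiStable.stLenAux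
    refine (h _).add ?_
    split
    · exact h _
    · exact continuous_const
  pos x _ hd := x.obj.qs.stLen_pos hd
  compat {x y} _ _ _ h := MGraph.IsQuasiStable.compat_st x.obj.qs y.obj.qs h

/-- the topological realization of the forgetful-stabilization morphism -/
noncomputable abbrev Phi (Q : ObjectProperty (QD g n)) : JTrop Q ⥤ MTrop g n :=
  (stabilization Q).realize

/-- the Jacobian topological space of a stable tropical curve (or its variant that is given
by `Q`); `o` is a choice of a half-edge in each edge -/
noncomputable def Jac (Q : ObjectProperty (QD g n)) (Γ : StableCurve g n)
    (o : Γ.x.G.E → Γ.x.G.H) : TopCat.{1} :=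
  Limits.colimit (QDFib.polytope (Q := Q) o Γ.pos)

/-- There is a cartesian square of stacks over the category of topological spaces, with the
Jacobian topological space of `Γ` in the upper left corner, the one-point space in the lower left
corner, the modular morphism of `Γ` below, and the realization of the forgetful-stabilization
morphism on the right.  Topological spaces are identified with the stacks that they represent. -/
def IsFiber (Q : ObjectProperty (QD g n)) (Γ : StableCurve g n) (o : Γ.x.G.E → Γ.x.G.H) : Prop :=
  ∃ (a : Over (Jac Q Γ o) ⥤ JTrop Q)
    (sq : Over.map (TopCat.isTerminalPUnit.from (Jac Q Γ o)) ⋙ Realization.point Γ ≅ a ⋙ Phi Q),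
    ((Limits.CategoricalPullback.CatCommSqOver.toFunctorToCategoricalPullback
      (Realization.point Γ) (Phi Q) (Over (Jac Q Γ o))).obj ⟨_, a, sq⟩).IsEquivalence

end Fiber

end Trop

/-! A point of the fibre of `Phi Q` over Γ is a triple (G, D, ρ) with positive edge lengths on G
whose stabilization is Γ. Such lengths amount to dividing d(e) into two positive parts for each
exceptional edge e, that is, to an interior point of the polytope P(G, D, ρ). At a boundary point
some of the parts vanish, and contracting the edges of length zero turns it into an interior point
of a smaller polytope. Therefore the points of the colimit are the isomorphism classes of points of
the fibre, provided that `Q` is stable under push-forward. This is the only property of `Q` that is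
needed, and it is checked at the end for degree, simplicity and semistability.

Two facts make this precise. Existence is `exists_interior`. Uniqueness is `exists_factor_of_eq`: a
contraction leading to an interior point factors through every other polytope containing that point.
Moreover the fibre is rigid, so that it can be a space rather than a stack. A morphism over Γ is
determined by the set of edges whose first half it contracts, and if two morphisms differ at e, then
the lengths they induce differ by d(e) somewhere (`eq_of_near`). In particular no nontrivial
automorphism over Γ fixes a point.

For the topology, there may be infinitely many polytopes, but the objects with a contraction to a
fixed object fall into finitely many types, given by the exceptional and the contracted edges
(`exists_hom_over`). The divisor is recovered as well, since it equals 1 at exceptional vertices and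
its push-forward is known. Consequently the stars, defined by closeness of lengths along a
contraction, control the neighbourhoods of a point (`star_mem_nhds`, `exists_near_mem`), and the
maps from the polytopes to the colimit are closed (`isClosedMap_glue`). Images of finitely many
closed boxes then serve as charts for a universal family on the colimit, whose specialization maps
are the contractions that change the lengths by less than a small constant.

This family yields the functor from spaces over the Jacobian to the fibre product. It is full and
faithful by rigidity. It is essentially surjective because a family with stabilization Γ determines
pointwise an element of the colimit, and this classifying map is continuous. -/

namespace Trop

open CategoryTheory

/-! ### Factorization of contractions, and quasi-stability of contracted graphs -/

namespace MGraph

variable {n g : ℕ} {G G₁ G₂ G₃ : MGraph n}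

namespace Hom

/-- Fibres over vertices are connected, hence nonempty, and fibres over flags are singletons. -/
lemma surjective (π : Hom G₁ G₂) : Function.Surjective π.f := by
  intro y
  by_cases hy : G₂.r y = y
  · obtain ⟨x, hx, -⟩ := (π.conn ⟨y, hy⟩).1
    exact ⟨x, hx⟩
  · obtain ⟨x, hx, -⟩ := π.flag y hy
    exact ⟨x, hx⟩

lemma exists_vertex (π : Hom G₁ G₂) {w : G₂.X} (hw : G₂.r w = w) :
    ∃ v, G₁.r v = v ∧ π.f v = w := by
  obtain ⟨x, hx⟩ := π.surjective w
  exact ⟨G₁.r x, G₁.r_r x, by rw [π.map_r, hx, hw]⟩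

lemma eq_of_flag (π : Hom G₁ G₂) {x y : G₁.X} (hx : G₂.r (π.f x) ≠ π.f x) (h : π.f y = π.f x) :
    y = x := (π.flag _ hx).unique h rfl

lemma step_image (π : Hom G₁ G₂) {S : Set G₁.X} {T : Set G₂.X} (h : ∀ x ∈ S, π.f x ∈ T)
    {a b : G₁.X} (hp : Relation.ReflTransGen (G₁.Step S) a b) :
    Relation.ReflTransGen (G₂.Step T) (π.f a) (π.f b) := by
  induction hp with
  | refl => exact .refl
  | tail _ h2 ih =>
    obtain ⟨z, hz, h3, h4⟩ := h2
    exact ih.tail ⟨π.f z, h z hz, by rw [← π.map_r, h3], by rw [← π.map_i, ← π.map_r, h4]⟩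

lemma conn_image (π : Hom G₁ G₂) (T : Set G₂.X)
    (h : G₁.ConnOn (π.f ⁻¹' T)) : G₂.ConnOn T := by
  constructor
  · obtain ⟨v, hv, hrv⟩ := h.1
    exact ⟨π.f v, hv, π.map_vertex hrv⟩
  · intro a ha b hb hra hrb
    obtain ⟨a', ha', rfl⟩ := π.exists_vertex hra
    obtain ⟨b', hb', rfl⟩ := π.exists_vertex hrb
    exact π.step_image (fun _ hx => hx) (h.2 a' ha b' hb ha' hb')

/-- Twice the genus minus two is a sum of the weights `om`, and these are preserved by
`sum_preimage`. -/
lemma genus_image (π : Hom G₁ G₂) (T : Set G₂.X) (hT : ∀ x ∈ T, G₂.i x ∈ T) :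
    G₁.genusOn (π.f ⁻¹' T) = G₂.genusOn T := by
  classical
  have h1 := genus_om T hT
  have h2 := genus_om (π.f ⁻¹' T) (fun x hx => by
    simp only [Set.mem_preimage] at hx ⊢
    rw [π.map_i]; exact hT _ hx)
  rw [π.sum_preimage] at h2
  linarith

/-- This is the well-definedness behind `exists_factor`. Over a flag the fibre is a singleton. Over
a vertex, the roots of the two elements are joined by a path in the fibre; every element used by it
is contracted by `π`, hence by `π'`, so `π'` is constant along the path. -/
lemma eq_of_contracts (π : Hom G₁ G₂) (π' : Hom G₁ G₃)
    (h : ∀ x, G₂.r (π.f x) = π.f x → G₃.r (π'.f x) = π'.f x) {x y : G₁.X} (hxy : π.f x = π.f y) :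
    π'.f x = π'.f y := by
  by_cases hv : G₂.r (π.f y) = π.f y
  · have hvx : G₂.r (π.f x) = π.f x := by rw [hxy, hv]
    rw [← π'.r_of_vertex (h y hv), ← π'.r_of_vertex (h x hvx)]
    have hp := (π.conn ⟨_, hv⟩).2 (G₁.r x) (by
      simp only [Set.mem_preimage, Set.mem_singleton_iff]; rw [π.r_of_vertex hvx, hxy])
      (G₁.r y) (by simp only [Set.mem_preimage, Set.mem_singleton_iff]; rw [π.r_of_vertex hv])
      (G₁.r_r _) (G₁.r_r _)
    generalize G₁.r y = b at hp
    induction hp with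
    | refl => rfl
    | tail _ h2 ih =>
      obtain ⟨z, hz, h3, h4⟩ := h2
      simp only [Set.mem_preimage, Set.mem_singleton_iff] at hz
      have hz' := h z (by rw [hz, hv])
      rw [ih, ← h3, ← h4, π'.r_of_vertex hz', π'.map_root_i hz']
  · rw [π.eq_of_flag hv hxy]

/-- A morphism contracting everything that `π` contracts factors through `π`. -/
lemma exists_factor (π : Hom G₁ G₂) (π' : Hom G₁ G₃)
    (h : ∀ x, G₂.r (π.f x) = π.f x → G₃.r (π'.f x) = π'.f x) :
    ∃ ψ : Hom G₂ G₃, π.comp ψ = π' := by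
  classical
  choose s hs using π.surjective
  let f : G₂.X → G₃.X := fun y => π'.f (s y)
  -- The section `s` is arbitrary; from here on `f` no longer depends on it and inherits the axioms
  -- from `π'`.
  have hf : ∀ x, f (π.f x) = π'.f x := fun x => eq_of_contracts π π' h (hs _)
  have hpre : ∀ T : Set G₃.X, π.f ⁻¹' (f ⁻¹' T) = π'.f ⁻¹' T := by
    intro T; ext x
    simp only [Set.mem_preimage, hf]
  have map_r : ∀ y, f (G₂.r y) = G₃.r (f y) := by
    intro y
    obtain ⟨x, rfl⟩ := π.surjective y
    rw [← π.map_r, hf, hf, π'.map_r]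
  have map_i : ∀ y, f (G₂.i y) = G₃.i (f y) := by
    intro y
    obtain ⟨x, rfl⟩ := π.surjective y
    rw [← π.map_i, hf, hf, π'.map_i]
  refine ⟨{ f := f, map_r := map_r, map_i := map_i, flag := ?_, leg := ?_, conn := ?_,
            genus := ?_ }, Hom.ext (funext hf)⟩
  · intro y hy
    obtain ⟨x, hx, hu⟩ := π'.flag y hy
    refine ⟨π.f x, (hf x).trans hx, fun z hz => ?_⟩
    obtain ⟨x', rfl⟩ := π.surjective z
    rw [hu x' ((hf x').symm.trans hz)]
  · intro j
    rw [← π.leg, hf, π'.leg]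
  · intro v
    refine π.conn_image _ ?_
    rw [hpre]; exact π'.conn v
  · intro v
    rw [← π.genus_image, hpre]
    · exact π'.genus v
    · intro x hx
      simp only [Set.mem_preimage, Set.mem_singleton_iff] at hx ⊢
      rw [map_i, hx, i_vertex v.2]

lemma comp_right_cancel (π : Hom G₁ G₂) {ψ ψ' : Hom G₂ G₃} (h : π.comp ψ = π.comp ψ') :
    ψ = ψ' := by
  refine Hom.ext (funext fun y => ?_)
  obtain ⟨x, rfl⟩ := π.surjective y
  exact congrFun (congrArg Hom.f h) x

/-- a morphism that contracts nothing is an isomorphism -/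
lemma exists_inverse (π : Hom G₁ G₂) (h : ∀ x, G₂.r (π.f x) = π.f x → G₁.r x = x) :
    ∃ ψ : Hom G₂ G₁, π.comp ψ = Hom.id G₁ ∧ ψ.comp π = Hom.id G₂ := by
  obtain ⟨ψ, hψ⟩ := π.exists_factor (Hom.id G₁) h
  refine ⟨ψ, hψ, π.comp_right_cancel ?_⟩
  change (π.comp ψ).comp π = _
  rw [hψ]; rfl

end Hom

namespace IsQuasiStable

-- The identity `sum_root_nu`, regrouped by vertices: the weights 2h(v) - 2 + val(v) of the vertices
-- over `w` add up to the weight of `w`. On a quasi-stable graph they are nonnegative, so a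
-- contraction inherits this.
open scoped Classical in
lemma sum_vertices (π : Hom G₁ G₂) {w : G₂.X} (hw : G₂.r w = w) :
    (∑ a : G₁.X, if G₁.r a = a ∧ π.f a = w then (G₁.val a : ℤ) + 2 * G₁.hX a - 2 else 0)
      = G₂.val w + 2 * G₂.hX w - 2 := by
  rw [← π.sum_root_nu _ hw, ← Finset.sum_fiberwise (s := Finset.univ) (g := G₁.r)
    (f := fun x => if π.f (G₁.r x) = w then G₁.nu x else 0)]
  refine Finset.sum_congr rfl fun a _ => ?_
  rw [Finset.sum_filter]
  by_cases ha : G₁.r a = a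
  · by_cases hb : π.f a = w
    · rw [if_pos ⟨ha, hb⟩, ← sum_nu a ha]
      refine Finset.sum_congr rfl fun x _ => ?_
      by_cases hx : G₁.r x = a
      · rw [if_pos hx, if_pos hx, hx, if_pos hb]
      · rw [if_neg hx, if_neg hx]
    · rw [if_neg (fun h => hb h.2)]
      refine (Finset.sum_eq_zero fun x _ => ?_).symm
      by_cases hx : G₁.r x = a
      · rw [if_pos hx, hx, if_neg hb]
      · rw [if_neg hx]
  · rw [if_neg (fun h => ha h.1)]
    refine (Finset.sum_eq_zero fun x _ => ?_).symm
    rw [if_neg]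
    intro hx
    exact ha (by rw [← hx, G₁.r_r])

/-- contractions of quasi-stable graphs are quasi-stable -/
lemma of_hom (h : G₁.IsQuasiStable g) (π : Hom G₁ G₂) : G₂.IsQuasiStable g where
  hyp := h.hyp
  conn := π.conn_image _ h.conn
  genus := (π.genus_image Set.univ (fun _ _ => trivial)).symm.trans h.genus
  two_le_val v hv := by
    classical
    have h1 := sum_vertices π v.2
    have h2 : 0 ≤ (G₂.val v.1 : ℤ) + 2 * G₂.hX v.1 - 2 := by
      rw [← h1]
      refine Finset.sum_nonneg fun a _ => ?_
      split_ifs with ha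
      · exact h.nonneg ha.1
      · exact le_rfl
    have h3 : G₂.hX v.1 = 0 := by simp [hX, v.2, hv]
    rw [h3] at h2
    omega
  exc_edges x hx he := by
    obtain ⟨y, rfl⟩ := π.surjective x
    rw [← π.map_r] at he
    have hy := h.exc_of_map π (G₁.r_r _) he
    obtain ⟨h1, h2⟩ := h.exc_edges y (π.flag_of_flag hx) hy
    refine ⟨(π.half_iff hx).2 h1, fun h3 => ?_⟩
    rw [← π.map_i, ← π.map_r, ← π.map_r] at h3
    -- If the image were a loop, the other end of `y` would lie over the same exceptional vertex, so
    -- both ends of `y` would be exceptional.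
    exact h.nexc_i (π.flag_of_flag hx) hy (h.exc_of_map π (G₁.r_r _) (by rwa [h3]))
  exc_not_adj x hx he he' := by
    obtain ⟨y, rfl⟩ := π.surjective x
    rw [← π.map_i, ← π.map_r] at he'
    rw [← π.map_i, ← π.map_r, ← π.map_r] at hx
    rw [← π.map_r] at he
    exact h.exc_not_adj y (fun h' => hx (by rw [h'])) (h.exc_of_map π (G₁.r_r _) he)
      (h.exc_of_map π (G₁.r_r _) he')

/-- All vertices over an exceptional vertex are exceptional, by `exc_of_map`. A contracted edge
between two of them would join exceptional vertices, so there is only one vertex in the fibre. The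
push-forward of an admissible divisor therefore takes the value 1 there. -/
lemma eq_of_exc_map (h : G₁.IsQuasiStable g) (π : Hom G₁ G₂) {a b : G₁.X} (ha : G₁.r a = a)
    (hb : G₁.r b = b) (hab : π.f a = π.f b) (he : G₂.Exc (π.f b)) : b = a := by
  have hp := (π.conn ⟨π.f b, he.vertex⟩).2 a hab b rfl ha hb
  have key : ∀ c, Relation.ReflTransGen (G₁.Step (π.f ⁻¹' {π.f b})) a c → c = a := by
    intro c hc
    induction hc with
    | refl => rfl
    | tail _ h2 ih =>
      obtain ⟨z, hz, h3, h4⟩ := h2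
      simp only [Set.mem_preimage, Set.mem_singleton_iff] at hz
      rw [ih] at h3
      have hv : G₂.r (π.f z) = π.f z := by rw [hz, he.vertex]
      by_cases hzf : G₁.r z = z
      · rw [← h4, Hom.i_vertex hzf, h3]
      · exfalso
        refine h.nexc_i hzf (h.exc_of_map π (G₁.r_r _) ?_) (h.exc_of_map π (G₁.r_r _) ?_)
        · rw [π.r_of_vertex hv, hz]; exact he
        · rw [π.map_root_i hv, hz]; exact he
  exact key b hp

end IsQuasiStable

end MGraph

open scoped Classical in
/-- the push-forward of an admissible divisor under a contraction -/
noncomputable def QD.push {g n : ℕ} (A : QD g n) {G' : MGraph n} (π : A.G.Hom G') : QD g n where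
  G := G'
  qs := A.qs.of_hom π
  D v := ∑ w : A.G.V, if π.f w.1 = v.1 then A.D w else 0
  adm v hv := by
    obtain ⟨a, ha, hav⟩ := π.exists_vertex v.2
    rw [Finset.sum_eq_single ⟨a, ha⟩]
    · rw [if_pos hav]
      exact A.adm _ (A.qs.exc_of_map π ha (by rwa [hav]))
    · intro b _ hb
      rw [if_neg]
      intro hbv
      exact hb (Subtype.ext (A.qs.eq_of_exc_map π ha b.2 (by rw [hav, hbv]) (by rwa [hbv])))
    · simp

/-- the contraction as a morphism to the push-forward -/
noncomputable def QD.toPush {g n : ℕ} (A : QD g n) {G' : MGraph n} (π : A.G.Hom G') :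
    A ⟶ A.push π := QD.Hom.mk π fun _ => rfl

/-! ### Contraction of a single non-loop edge, and descent of edge lengths -/

namespace MGraph

variable {n g : ℕ} {G G' : MGraph n}

/-- the half-edges of a non-loop edge and the vertex at its end that are removed when the edge is
contracted -/
def Removed (G : MGraph n) (y x : G.X) : Prop := x = G.r y ∨ x = y ∨ x = G.i y

lemma removed_i {y x : G.X} : G.Removed y (G.i x) ↔ G.Removed y x := by
  have h : ∀ x, G.Removed y x → G.Removed y (G.i x) := by
    rintro x (h | h | h)
    · left; rw [h, G.i_r]
    · right; right; rw [h]
    · right; left; rw [h, G.i_i]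
  exact ⟨fun hx => by have := h _ hx; rwa [G.i_i] at this, h x⟩

lemma not_removed_root {y : G.X} (hy : G.i y ≠ y) (hl : G.r (G.i y) ≠ G.r y) :
    ¬ G.Removed y (G.r (G.i y)) := by
  rintro (h | h | h)
  · exact hl h
  · exact flag_of_half hy (by rw [← h, G.r_r])
  · exact flag_of_half (half_i hy) h

lemma not_removed_leg {y x : G.X} (hy : G.i y ≠ y) (hx : G.i x = x) (hr : G.r x ≠ x) :
    ¬ G.Removed y x := by
  rintro (h | h | h)
  · exact hr (by rw [h, G.r_r])
  · exact hy (by rw [← h, hx])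
  · exact half_i hy (by rw [← h, hx])

open scoped Classical in
/-- the retraction onto the complement of the removed elements -/
noncomputable def retract {y : G.X} (hy : G.i y ≠ y) (hl : G.r (G.i y) ≠ G.r y) (x : G.X) :
    {x : G.X // ¬ G.Removed y x} :=
  if h : G.Removed y x then ⟨G.r (G.i y), not_removed_root hy hl⟩ else ⟨x, h⟩

section

variable {y : G.X} (hy : G.i y ≠ y) (hl : G.r (G.i y) ≠ G.r y)

lemma retract_removed {x : G.X} (h : G.Removed y x) :
    (retract hy hl x).1 = G.r (G.i y) := by rw [retract, dif_pos h]

lemma retract_not_removed {x : G.X} (h : ¬ G.Removed y x) :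
    retract hy hl x = ⟨x, h⟩ := by rw [retract, dif_neg h]

lemma removed_root {x : G.X} (h : G.Removed y x) :
    G.Removed y (G.r x) ∨ G.r x = G.r (G.i y) := by
  rcases h with h | h | h
  · left; left; rw [h, G.r_r]
  · left; left; rw [h]
  · right; rw [h]

/-- All removed elements retract to the surviving end `r (i y)`, and the root of a removed element
is either removed or equal to that end. This gives both the axiom `r_r` of the contraction and the
compatibility of the retraction with roots. -/
lemma retract_root (x : G.X) :
    retract hy hl (G.r (retract hy hl x).1) = retract hy hl (G.r x) := by
  by_cases h : G.Removed y x
  · rw [retract_removed hy hl h, G.r_r, retract_not_removed hy hl (not_removed_root hy hl)]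
    rcases removed_root h with h1 | h1
    · exact Subtype.ext (retract_removed hy hl h1).symm
    · rw [h1, retract_not_removed hy hl (not_removed_root hy hl)]
  · rw [retract_not_removed hy hl h]

lemma retract_vertex {x : G.X} (hx : ¬ G.Removed y x) :
    (retract hy hl (G.r x)).1 = x ↔ G.r x = x := by
  constructor
  · intro h
    by_cases hr : G.Removed y (G.r x)
    · rw [retract_removed hy hl hr] at h
      rw [← h, G.r_r]
    · rwa [retract_not_removed hy hl hr] at h
  · intro h
    rw [h, retract_not_removed hy hl hx]

/-- the contraction of a non-loop edge, seen as a graph on the complement of the edge and one of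
its end points -/
noncomputable def contraction : MGraph n where
  X := {x : G.X // ¬ G.Removed y x}
  finite_X := have := G.finite_X; inferInstance
  r x := retract hy hl (G.r x.1)
  i x := ⟨G.i x.1, fun h => x.2 (removed_i.1 h)⟩
  r_r x := by rw [retract_root, G.r_r]
  i_i x := Subtype.ext (G.i_i _)
  i_r x := Subtype.ext (by
    change G.i (retract hy hl (G.r x.1)).1 = (retract hy hl (G.r x.1)).1
    by_cases h : G.Removed y (G.r x.1)
    · rw [retract_removed hy hl h, G.i_r]
    · rw [retract_not_removed hy hl h]; exact G.i_r _)
  h v := G.h ⟨v.1.1, (retract_vertex hy hl v.1.2).1 (congrArg Subtype.val v.2)⟩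
  m := G.m.trans
    { toFun := fun x => ⟨⟨x.1, not_removed_leg hy x.2.1 x.2.2⟩, Subtype.ext x.2.1,
        fun h => x.2.2 ((retract_vertex hy hl (not_removed_leg hy x.2.1 x.2.2)).1
          (congrArg Subtype.val h))⟩
      invFun := fun x => ⟨x.1.1, congrArg Subtype.val x.2.1,
        fun h => x.2.2 (Subtype.ext ((retract_vertex hy hl x.1.2).2 h))⟩
      left_inv := fun _ => rfl
      right_inv := fun _ => rfl }

lemma contraction_r_iff (x : (contraction hy hl).X) :
    (contraction hy hl).r x = x ↔ G.r x.1 = x.1 :=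
  Subtype.ext_iff.trans (retract_vertex hy hl x.2)

/-- the retraction, as a map to the contraction -/
noncomputable def toContraction (x : G.X) : (contraction hy hl).X := retract hy hl x

lemma toContraction_of_not_removed {x : G.X} (h : ¬ G.Removed y x) :
    toContraction hy hl x = ⟨x, h⟩ := retract_not_removed hy hl h

lemma toContraction_eq_iff {x : G.X} {z : (contraction hy hl).X} :
    toContraction hy hl x = z ↔ x = z.1 ∨ (G.Removed y x ∧ z.1 = G.r (G.i y)) := by
  by_cases h : G.Removed y x
  · unfold toContraction
    constructor
    · intro hx; right; exact ⟨h, by rw [← hx, retract_removed hy hl h]⟩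
    · rintro (hx | hx)
      · exact absurd (by rwa [← hx]) z.2
      · exact Subtype.ext ((retract_removed hy hl h).trans hx.2.symm)
  · rw [toContraction_of_not_removed hy hl h]
    constructor
    · intro hx; left; rw [← hx]
    · rintro (hx | hx)
      · exact Subtype.ext hx
      · exact absurd hx.1 h

/-- the contraction of a non-loop edge, one of whose end points has genus zero -/
noncomputable def contractionMap (h0 : G.hX (G.r y) = 0) : Hom G (contraction hy hl) where
  f := toContraction hy hl
  map_r x := (retract_root hy hl x).symm
  map_i x := Subtype.ext (by
    change (retract hy hl (G.i x)).1 = G.i (retract hy hl x).1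
    by_cases h : G.Removed y x
    · rw [retract_removed hy hl h, retract_removed hy hl (removed_i.2 h), G.i_r]
    · rw [retract_not_removed hy hl h, retract_not_removed hy hl (fun h' => h (removed_i.1 h'))])
  flag z hz := by
    refine ⟨z.1, toContraction_of_not_removed hy hl z.2, fun x hx => ?_⟩
    rcases (toContraction_eq_iff hy hl).1 hx with h | ⟨_, h⟩
    · exact h
    · exact absurd ((contraction_r_iff hy hl z).2 (by rw [h, G.r_r])) hz
  leg j := retract_not_removed hy hl (not_removed_leg hy (G.m j).2.1 (G.m j).2.2)
  conn v := by
    have hv : G.r v.1.1 = v.1.1 := (contraction_r_iff hy hl v.1).1 v.2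
    refine ⟨⟨v.1.1, toContraction_of_not_removed hy hl v.1.2, hv⟩, fun a ha b hb hra hrb => ?_⟩
    simp only [Set.mem_preimage, Set.mem_singleton_iff] at ha hb
    have hm : ∀ a, G.r a = a → toContraction hy hl a = v.1 →
        a = v.1.1 ∨ (a = G.r y ∧ v.1.1 = G.r (G.i y)) := by
      intro a hra ha
      rcases (toContraction_eq_iff hy hl).1 ha with h | ⟨h | h | h, h'⟩
      · exact Or.inl h
      · exact Or.inr ⟨h, h'⟩
      · exact absurd (by rwa [h] at hra) (flag_of_half hy)
      · exact absurd (by rwa [h] at hra) (flag_of_half (half_i hy))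
    have hS : v.1.1 = G.r (G.i y) → y ∈ toContraction hy hl ⁻¹' {v.1} ∧ G.i y ∈ toContraction hy hl ⁻¹' {v.1} :=
      fun h => ⟨(toContraction_eq_iff hy hl).2 (Or.inr ⟨Or.inr (Or.inl rfl), h⟩),
        (toContraction_eq_iff hy hl).2 (Or.inr ⟨Or.inr (Or.inr rfl), h⟩)⟩
    rcases hm a hra ha with h1 | ⟨h1, h1'⟩ <;> rcases hm b hrb hb with h2 | ⟨h2, h2'⟩
    · rw [h1, h2]
    · rw [h1, h2]
      exact .single ⟨G.i y, (hS h2').2, h2'.symm, by rw [G.i_i]⟩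
    · rw [h1, h2]
      exact .single ⟨y, (hS h1').1, rfl, h1'.symm⟩
    · rw [h1, h2]
  genus v := by
    classical
    have hv : G.r v.1.1 = v.1.1 := (contraction_r_iff hy hl v.1).1 v.2
    have hi : ∀ x ∈ toContraction hy hl ⁻¹' {v.1}, G.i x ∈ toContraction hy hl ⁻¹' {v.1} := by
      intro x hx
      rcases (toContraction_eq_iff hy hl).1 hx with h | ⟨h, h'⟩
      · rw [h, Hom.i_vertex hv]; exact toContraction_of_not_removed hy hl v.1.2
      · exact (toContraction_eq_iff hy hl).2 (Or.inr ⟨removed_i.2 h, h'⟩)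
    have h1 := genus_om _ hi
    have h2 : (∑ x : G.X, if x ∈ toContraction hy hl ⁻¹' {v.1} then G.om x else 0) = G.om v.1.1 := by
      have e : ∀ x : G.X, (if x ∈ toContraction hy hl ⁻¹' {v.1} then G.om x else 0) =
          (if x = v.1.1 then G.om x else 0) +
          if v.1.1 = G.r (G.i y) then (if G.Removed y x then G.om x else 0) else 0 := by
        intro x
        have := toContraction_eq_iff hy hl (x := x) (z := v.1)
        simp only [Set.mem_preimage, Set.mem_singleton_iff]
        rw [if_congr this rfl rfl]
        by_cases a : x = v.1.1
        · have : ¬ G.Removed y x := by rw [a]; exact v.1.2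
          simp only [a, true_or, if_true]
          rw [a] at this
          simp [this]
        · by_cases b : v.1.1 = G.r (G.i y)
          · have a' : ¬ x = G.r (G.i y) := b ▸ a
            by_cases c : G.Removed y x <;> simp [a', b, c]
          · simp [a, b]
      rw [Finset.sum_congr rfl fun x _ => e x, Finset.sum_add_distrib, Finset.sum_ite_eq',
        if_pos (Finset.mem_univ _)]
      -- The removed vertex has genus zero and weight -2, and its edge contributes two half-edges of
      -- weight 1, so the fibre over the surviving end has the weight of that end alone.
      have h3 : (∑ x : G.X, if G.Removed y x then G.om x else 0) = 0 := by
        rw [← Finset.sum_filter]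
        have : (Finset.univ.filter fun x => G.Removed y x) = {G.r y, y, G.i y} := by
          ext x
          rw [Finset.mem_filter]
          simp [Removed]
        rw [this, Finset.sum_insert, Finset.sum_insert, Finset.sum_singleton]
        · have e1 : G.om y = 1 := by simp [om, hy, flag_of_half hy]
          have e2 : G.om (G.i y) = 1 := by
            simp only [om, if_pos (half_i hy), if_neg (flag_of_half (half_i hy)), add_zero]
          have e3 : G.om (G.r y) = -2 := by simp [om, G.i_r, G.r_r, h0]
          rw [e1, e2, e3]; norm_num
        · simpa using fun h => hy h.symm
        · simp only [Finset.mem_insert, Finset.mem_singleton, not_or]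
          exact ⟨flag_of_half hy, fun h => flag_of_half (half_i hy) (by rw [← h, G.r_r])⟩
      by_cases b : v.1.1 = G.r (G.i y)
      · simp only [b, if_true]; rw [h3, add_zero]
      · simp [b]
    rw [h2] at h1
    have h4 : (contraction hy hl).h v = G.h ⟨v.1.1, hv⟩ := rfl
    rw [h4]
    clear h4 h2
    simp only [om, Hom.i_vertex hv, hv, hX] at h1
    simp at h1
    exact h1

end

/-- the lengths given by a function on the half-edges that is invariant under conjugation -/
def edgeFun (F : G.X → ℝ) (hF : ∀ x, G.i x ≠ x → F (G.i x) = F x) : G.E → ℝ :=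
  Quotient.lift (s := G.edgeSetoid) (fun x => F x.1) fun x y h => by
    rcases (h : y.1 = x.1 ∨ y.1 = G.i x.1) with h | h
    · rw [h]
    · rw [h, hF _ x.2]

lemma len_edgeFun (F : G.X → ℝ) (hF : ∀ x, G.i x ≠ x → F (G.i x) = F x) {x : G.X}
    (hx : G.i x ≠ x) : G.len (G.edgeFun F hF) x = F x := by
  rw [len_half _ hx]; rfl

/-- Lengths that vanish on the contracted edges descend along a contraction. -/
lemma Hom.exists_compat {G' : MGraph n} (π : Hom G G') (l : G.E → ℝ)
    (h : ∀ x, G'.r (π.f x) = π.f x → G.len l x = 0) : ∃ l' : G'.E → ℝ, π.Compat l l' := by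
  choose s hs using π.surjective
  refine ⟨G'.edgeFun (fun y => G.len l (s y)) fun y hy => ?_, fun x => ?_⟩
  -- A flag has only one preimage, so the arbitrary section commutes with conjugation on half-edges.
  · have h1 : G.i (s y) = s (G'.i y) := by
      refine π.eq_of_flag ?_ ?_
      · rw [hs]; exact flag_of_half (half_i hy)
      · rw [π.map_i, hs, hs]
    rw [← h1, len_i]
  · by_cases hx : G'.i (π.f x) = π.f x
    · rw [len_zero _ hx]
      by_cases hv : G'.r (π.f x) = π.f x
      · exact h x hv
      · exact len_zero _ (not_not.1 fun hc => (π.half_iff hv).2 hc hx)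
    · rw [len_edgeFun _ _ hx, π.eq_of_flag (x := x) (flag_of_half hx) (hs _)]

end MGraph

end Trop

/-! ### Lifting isomorphisms of stabilizations to quasi-stable graphs -/

namespace Trop

open CategoryTheory

namespace MGraph

variable {n g : ℕ} {G G' : MGraph n}

/-- a weight-preserving bijection of graphs is a morphism -/
def Hom.ofInverse (f : G.X → G'.X) (f' : G'.X → G.X) (h : ∀ x, f' (f x) = x)
    (h' : ∀ y, f (f' y) = y) (map_r : ∀ x, f (G.r x) = G'.r (f x))
    (map_i : ∀ x, f (G.i x) = G'.i (f x)) (leg : ∀ j, f (G.m j).1 = (G'.m j).1)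
    (om : ∀ x, G'.om (f x) = G.om x) : Hom G G' where
  f := f
  map_r := map_r
  map_i := map_i
  flag y _ := ⟨f' y, h' y, fun x hx => by rw [← hx, h]⟩
  leg := leg
  conn v := by
    have hv : ∀ x, x ∈ f ⁻¹' {v.1} → x = f' v.1 := fun x hx => by
      rw [← h x]; exact congrArg f' hx
    refine ⟨⟨f' v.1, h' v.1, ?_⟩, fun a ha b hb _ _ => ?_⟩
    · rw [← h (G.r (f' v.1)), map_r, h', v.2]
    · rw [hv a ha, hv b hb]
  genus v := by
    classical
    have hi : ∀ x ∈ f ⁻¹' {v.1}, G.i x ∈ f ⁻¹' {v.1} := by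
      intro x hx
      simp only [Set.mem_preimage, Set.mem_singleton_iff] at hx ⊢
      rw [map_i, hx, i_vertex v.2]
    have h1 := genus_om _ hi
    rw [Finset.sum_eq_single (f' v.1), if_pos (show f' v.1 ∈ f ⁻¹' {v.1} from h' v.1), ← om,
      h'] at h1
    · simp only [MGraph.om, i_vertex v.2, v.2, hX] at h1
      simp at h1
      exact h1
    · intro x _ hx
      rw [if_neg]
      intro hxv
      exact hx (by rw [← h x]; exact congrArg f' hxv)
    · simp

namespace IsQuasiStable

variable (h : G.IsQuasiStable g) (h' : G'.IsQuasiStable g)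

/-- an element that is not rooted at an exceptional vertex, seen in the stabilization -/
def toSt {x : G.X} (he : ¬ G.Exc (G.r x)) : h.st.X := ⟨x, he⟩

@[simp] lemma toSt_self (x : h.st.X) : h.toSt x.2 = x := rfl

open scoped Classical in
/-- the extension of a map of stabilizations to the exceptional vertices and their half-edges -/
noncomputable def extend (τ : h.st.X → h'.st.X) (x : G.X) : G'.X :=
  if he : G.Exc (G.r x) then
    if hx : G.r x ≠ x then G'.i (τ (h.toSt (h.nexc_i hx he))).1
    else G'.r (G'.i (τ (h.toSt (x := G.i (exists_flag he).choose)
      (h.nexc_i (exists_flag he).choose_spec.1 (by rwa [(exists_flag he).choose_spec.2])))).1)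
  else (τ (h.toSt he)).1

lemma extend_nexc (τ : h.st.X → h'.st.X) {x : G.X} (he : ¬ G.Exc (G.r x)) :
    h.extend h' τ x = (τ (h.toSt he)).1 := dif_neg he

lemma extend_flag (τ : h.st.X → h'.st.X) {x : G.X} (hx : G.r x ≠ x) (he : G.Exc (G.r x)) :
    h.extend h' τ x = G'.i (τ (h.toSt (h.nexc_i hx he))).1 := by
  rw [extend, dif_pos he, dif_pos hx]

variable {h h'} (τ : Hom h.st h'.st)
  (hτ : ∀ x, G.Exc (G.r (G.i x.1)) ↔ G'.Exc (G'.r (G'.i (τ.f x).1)))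

include hτ

lemma exc_i_map {x : G.X} (hx : G.r x ≠ x) (he : G.Exc (G.r x)) :
    G'.Exc (G'.r (G'.i (τ.f (h.toSt (h.nexc_i hx he))).1)) := by
  rw [← hτ]
  change G.Exc (G.r (G.i (G.i x)))
  rwa [G.i_i]

/-- The conjugates of the two flags at an exceptional vertex are conjugate to each other in the
stabilization. Compatibility with `sw` is thus compatibility of `τ` with the conjugation `stInv`. -/
lemma extend_sw {x : G.X} (hx : G.r x ≠ x) (he : G.Exc (G.r x)) :
    h.extend h' τ.f (G.sw x) = G'.sw (h.extend h' τ.f x) := by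
  obtain ⟨s1, s2, s3, s4⟩ := sw_spec hx he
  have he2 : G.Exc (G.r (G.sw x)) := by rwa [s3]
  have e := exc_i_map τ hτ hx he
  rw [h.extend_flag h' _ s2 he2, h.extend_flag h' _ hx he]
  have h1 : h.toSt (h.nexc_i s2 he2) = h.st.i (h.toSt (h.nexc_i hx he)) := by
    refine Subtype.ext ?_
    change G.i (G.sw x) = G.stInv (G.i x)
    rw [stInv_of_exc (by rwa [G.i_i]), G.i_i]
  rw [h1, τ.map_i]
  change G'.i (G'.stInv _) = _
  rw [stInv_of_exc e, G'.i_i]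

/-- The value of `extend` at an exceptional vertex was defined through a chosen flag. The only other
flag there is obtained by `sw`, and by `extend_sw` its image has the same root, so any flag may be
used. -/
lemma extend_vertex {x : G.X} (hx : G.r x ≠ x) (he : G.Exc (G.r x)) :
    h.extend h' τ.f (G.r x) = G'.r (h.extend h' τ.f x) := by
  have he' : G.Exc (G.r (G.r x)) := by rwa [G.r_r]
  set y := (exists_flag he').choose with hy
  obtain ⟨hy1, hy2⟩ := (exists_flag he').choose_spec
  rw [← hy, G.r_r] at hy2
  rw [← hy] at hy1
  have e1 : h.extend h' τ.f (G.r x) = G'.r (h.extend h' τ.f y) := by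
    rw [h.extend_flag h' _ hy1 (by rwa [hy2]), extend, dif_pos he',
      dif_neg (not_not.2 (G.r_r x))]
  rw [e1]
  obtain ⟨s1, s2, s3, s4⟩ := sw_spec hx he
  rcases s4 y hy1 hy2 with h1 | h1
  · rw [h1]
  · rw [h1, extend_sw τ hτ hx he]
    refine (sw_spec ?_ ?_).2.2.1
    · rw [h.extend_flag h' _ hx he]
      exact flag_i (τ.f _).2 (exc_i_map τ hτ hx he)
    · rw [h.extend_flag h' _ hx he]
      exact exc_i_map τ hτ hx he

lemma extend_r (x : G.X) : h.extend h' τ.f (G.r x) = G'.r (h.extend h' τ.f x) := by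
  by_cases he : G.Exc (G.r x)
  · by_cases hx : G.r x = x
    · obtain ⟨y, hy, hyx⟩ := exists_flag he
      have h1 := extend_vertex τ hτ hy (by rwa [hyx])
      rw [hyx, hx] at h1
      rw [hx, h1, G'.r_r]
    · exact extend_vertex τ hτ hx he
  · have he' : ¬ G.Exc (G.r (G.r x)) := by rwa [G.r_r]
    rw [h.extend_nexc h' _ he, h.extend_nexc h' _ he']
    exact congrArg Subtype.val (τ.map_r (h.toSt he))

lemma extend_exc {x : G.X} (he : G.Exc (G.r x)) :
    G'.Exc (G'.r (h.extend h' τ.f x)) := by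
  have key : ∀ x, G.r x ≠ x → G.Exc (G.r x) → G'.Exc (G'.r (h.extend h' τ.f x)) := by
    intro x hx he
    rw [h.extend_flag h' _ hx he]
    exact exc_i_map τ hτ hx he
  by_cases hx : G.r x = x
  · obtain ⟨y, hy, hyx⟩ := exists_flag he
    have h1 := key y hy (by rwa [hyx])
    rw [← extend_r τ hτ, hyx] at h1
    rwa [extend_r τ hτ] at h1
  · exact key x hx he

lemma extend_vertex_iff (x : G.X) :
    G'.r (h.extend h' τ.f x) = h.extend h' τ.f x → G.Exc (G.r x) → G.r x = x := by
  intro h1 he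
  by_contra hx
  rw [h.extend_flag h' _ hx he] at h1
  exact flag_i (τ.f _).2 (exc_i_map τ hτ hx he) h1

lemma extend_i (x : G.X) : h.extend h' τ.f (G.i x) = G'.i (h.extend h' τ.f x) := by
  by_cases he : G.Exc (G.r x)
  · by_cases hx : G.r x = x
    · have h1 := extend_r τ hτ x
      rw [hx] at h1
      rw [Hom.i_vertex hx, Hom.i_vertex h1.symm]
    · rw [h.extend_flag h' _ hx he, G'.i_i, h.extend_nexc]
  · rw [h.extend_nexc h' _ he]
    by_cases he' : G.Exc (G.r (G.i x))
    · rw [h.extend_flag h' _ (flag_i he he') he']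
      congr 4
      exact G.i_i x
    · rw [h.extend_nexc h' _ he']
      have h1 : h.toSt he' = h.st.i (h.toSt he) :=
        Subtype.ext (stInv_of_nexc he').symm
      rw [h1, τ.map_i]
      exact stInv_of_nexc ((hτ (h.toSt he)).not.1 he')

lemma extend_extend (τ' : Hom h'.st h.st) (hc : ∀ x, τ'.f (τ.f x) = x)
    (hτ' : ∀ x, G'.Exc (G'.r (G'.i x.1)) ↔ G.Exc (G.r (G.i (τ'.f x).1))) (x : G.X) :
    h'.extend h τ'.f (h.extend h' τ.f x) = x := by
  have key : ∀ x, (G.Exc (G.r x) → G.r x ≠ x) →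
      h'.extend h τ'.f (h.extend h' τ.f x) = x := by
    intro x hx
    by_cases he : G.Exc (G.r x)
    · have e := exc_i_map τ hτ (hx he) he
      rw [h.extend_flag h' _ (hx he) he, h'.extend_flag h _ (flag_i (τ.f _).2 e) e]
      have h1 : h'.toSt (h'.nexc_i (flag_i (τ.f _).2 e) e) = τ.f (h.toSt (h.nexc_i (hx he) he)) :=
        Subtype.ext (G'.i_i _)
      rw [h1, hc]
      exact G.i_i x
    · rw [h.extend_nexc h' _ he, h'.extend_nexc h _ (τ.f (h.toSt he)).2]
      exact congrArg Subtype.val (hc _)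
  by_cases hx : G.Exc (G.r x) ∧ G.r x = x
  · obtain ⟨he, hx⟩ := hx
    obtain ⟨y, hy, hyx⟩ := exists_flag he
    rw [← hx, ← hyx, extend_r τ hτ, extend_r τ' hτ', key y fun _ => hy]
  · exact key x fun he hv => hx ⟨he, hv⟩

/-- Exceptional vertices have weight -2 and their flags weight 1 on both sides. All other weights
can be read off in the stabilizations, where `τ` preserves them because its fibres are singletons.
-/
lemma extend_om (hinj : Function.Injective τ.f) (x : G.X) :
    G'.om (h.extend h' τ.f x) = G.om x := by
  classical
  by_cases he : G.Exc (G.r x)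
  · have he' := extend_exc τ hτ he
    by_cases hx : G.r x = x
    · have hx' : G'.r (h.extend h' τ.f x) = h.extend h' τ.f x := by rw [← extend_r τ hτ, hx]
      rw [hx'] at he'
      rw [hx] at he
      have e1 := ((exc_iff hx).1 he).1
      have e2 := ((exc_iff hx').1 he').1
      simp [om, hx, hx', Hom.i_vertex hx, Hom.i_vertex hx', e1, e2]
    · have hx' := mt (extend_vertex_iff τ hτ x) (fun hc => hx (hc he))
      have e1 := (h.exc_edges x hx he).1
      have e2 := (h'.exc_edges _ hx' he').1
      simp [om, hx, hx', e1, e2]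
  · have e : h.st.om (h.toSt he) = G.om x := h.st_om _
    rw [h.extend_nexc h' _ he, ← h'.st_om, ← e,
      ← τ.sum_fiber, Finset.sum_eq_single (h.toSt he), if_pos]
    · rfl
    · intro z _ hz
      rw [if_neg fun h => hz (hinj h)]
    · simp

/-- An isomorphism of stabilizations that respects the exceptional edges lifts to a morphism. -/
lemma exists_extend (τ' : Hom h'.st h.st) (hc : ∀ x, τ'.f (τ.f x) = x)
    (hc' : ∀ x, τ.f (τ'.f x) = x) :
    ∃ θ : Hom G G', (∀ x : h.st.X, θ.f x.1 = (τ.f x).1) ∧ Function.Injective θ.f := by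
  have hτ' : ∀ x, G'.Exc (G'.r (G'.i x.1)) ↔ G.Exc (G.r (G.i (τ'.f x).1)) := fun x => by
    rw [hτ, hc']
  have hl := extend_extend τ hτ τ' hc hτ'
  refine ⟨Hom.ofInverse (h.extend h' τ.f) (h'.extend h τ'.f) hl
    (extend_extend τ' hτ' τ hc' hτ) (extend_r τ hτ) (extend_i τ hτ) (fun j => ?_)
    (extend_om τ hτ (Function.LeftInverse.injective hc)), fun x => h.extend_nexc h' _ x.2,
    Function.LeftInverse.injective hl⟩
  rw [h.extend_nexc h' _ (h.leg_nexc (G.m j).2.1 (G.m j).2.2)]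
  exact congrArg Subtype.val (τ.leg j)

end IsQuasiStable

end MGraph

end Trop

/-! ### Rigidity of morphisms over a fixed stabilization -/

namespace Trop

open CategoryTheory

namespace QDFib

variable {g n : ℕ} {Q : ObjectProperty (QD g n)} {B : SG g n} {X Y Z X' : QDFib Q B}

/-- the underlying morphism of graphs -/
abbrev gr (f : X ⟶ Y) : MGraph.Hom X.obj.G Y.obj.G := QD.Hom.π (Hom.π f)

/-- the isomorphism from the base graph to the stabilization, as a morphism of graphs -/
abbrev rho (X : QDFib Q B) : MGraph.Hom B.G X.obj.qs.st := SG.Hom.π X.ρ.hom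

/-- the inverse of the isomorphism from the base graph to the stabilization -/
abbrev rhoInv (X : QDFib Q B) : MGraph.Hom X.obj.qs.st B.G := SG.Hom.π X.ρ.inv

@[simp] lemma rhoInv_rho (X : QDFib Q B) (b : B.G.X) : X.rhoInv.f (X.rho.f b) = b :=
  congrFun (congrArg (fun f => MGraph.Hom.f (SG.Hom.π f)) X.ρ.hom_inv_id) b

@[simp] lemma rho_rhoInv (X : QDFib Q B) (x : X.obj.qs.st.X) : X.rho.f (X.rhoInv.f x) = x :=
  congrFun (congrArg (fun f => MGraph.Hom.f (SG.Hom.π f)) X.ρ.inv_hom_id) x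

lemma ext_gr {f f' : X ⟶ Y} (h : gr f = gr f') : f = f' :=
  Hom.ext (QD.Hom.ext h)

/-- morphisms of graphs that are compatible with the identifications of the stabilizations -/
def Lifts (X Y : QDFib Q B) (π : MGraph.Hom X.obj.G Y.obj.G) : Prop :=
  X.rho.comp (MGraph.Hom.st X.obj.qs Y.obj.qs π) = Y.rho

lemma lifts_gr (f : X ⟶ Y) : Lifts X Y (gr f) :=
  congrArg SG.Hom.π (Hom.comm f)

lemma Lifts.stFun {π : MGraph.Hom X.obj.G Y.obj.G} (h : Lifts X Y π) (b : B.G.X) :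
    π.stFun (X.rho.f b).1 = (Y.rho.f b).1 :=
  congrArg Subtype.val (congrFun (congrArg MGraph.Hom.f h) b)

lemma Lifts.comp {π : MGraph.Hom X.obj.G Y.obj.G} {π' : MGraph.Hom Y.obj.G Z.obj.G}
    (h : Lifts X Y π) (h' : Lifts Y Z π') : Lifts X Z (π.comp π') := by
  unfold Lifts at *
  rw [MGraph.Hom.st_comp X.obj.qs Y.obj.qs Z.obj.qs, ← h', ← h]
  rfl

lemma Lifts.of_comp {π : MGraph.Hom X.obj.G Y.obj.G} {π' : MGraph.Hom Y.obj.G Z.obj.G}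
    (h : Lifts X Y π) (h' : Lifts X Z (π.comp π')) : Lifts Y Z π' := by
  unfold Lifts at *
  rw [MGraph.Hom.st_comp X.obj.qs Y.obj.qs Z.obj.qs] at h'
  rw [← h', ← h]
  rfl

lemma half_rho (X : QDFib Q B) {b : B.G.X} :
    X.obj.G.i (X.rho.f b).1 = (X.rho.f b).1 ↔ B.G.i b = b := by
  rw [← MGraph.IsQuasiStable.stInv_eq_iff (X.rho.f b).2]
  constructor
  · intro h
    have h1 : X.obj.qs.st.i (X.rho.f b) = X.rho.f b := Subtype.ext h
    rw [← MGraph.Hom.map_i] at h1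
    rw [← X.rhoInv_rho (B.G.i b), h1, rhoInv_rho]
  · intro h
    have h1 := X.rho.map_i b
    rw [h] at h1
    exact congrArg Subtype.val h1.symm

lemma vertex_rho (X : QDFib Q B) {b : B.G.X} :
    X.obj.G.r (X.rho.f b).1 = (X.rho.f b).1 ↔ B.G.r b = b := by
  constructor
  · intro h
    have h1 : X.obj.qs.st.r (X.rho.f b) = X.rho.f b := Subtype.ext h
    rw [← MGraph.Hom.map_r] at h1
    rw [← X.rhoInv_rho (B.G.r b), h1, rhoInv_rho]
  · intro h
    exact congrArg Subtype.val (X.rho.map_vertex h)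

lemma exists_rho (X : QDFib Q B) {x : X.obj.G.X} (hx : ¬ X.obj.G.Exc (X.obj.G.r x)) :
    ∃ b, (X.rho.f b).1 = x :=
  ⟨X.rhoInv.f (X.obj.qs.toSt hx), congrArg Subtype.val (X.rho_rhoInv _)⟩

lemma rho_injective (X : QDFib Q B) {b b' : B.G.X} (h : (X.rho.f b).1 = (X.rho.f b').1) :
    b = b' := by
  rw [← X.rhoInv_rho b, ← X.rhoInv_rho b', Subtype.ext h]

/-- every element is rooted at a nonexceptional vertex, or is conjugate to such an element,
or is an exceptional vertex -/
lemma elem_ind {G : MGraph n} (h : G.IsQuasiStable g) {p : G.X → Prop}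
    (h1 : ∀ x, ¬ G.Exc (G.r x) → p x) (h2 : ∀ x, ¬ G.Exc (G.r x) → p (G.i x))
    (h3 : ∀ x, p (G.i x) → p (G.r (G.i x))) (x : G.X) : p x := by
  have key : ∀ x, G.r x ≠ x → p x := by
    intro x hx
    by_cases he : G.Exc (G.r x)
    · have := h2 _ (h.nexc_i hx he)
      rwa [G.i_i] at this
    · exact h1 x he
  by_cases hx : G.r x = x
  · by_cases he : G.Exc (G.r x)
    · obtain ⟨y, hy, hyx⟩ := MGraph.exists_flag he
      have := h3 (G.i y)
      rw [G.i_i, hyx, hx] at this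
      exact this (key y hy)
    · exact h1 x he
  · exact key x hx

section contracted

variable {π π' : MGraph.Hom X.obj.G Y.obj.G}

/-- The identifications with `B` prescribe `stFun`. At an element rooted at a nonexceptional vertex,
`π` takes the prescribed value if the element is not contracted, and the root of that value
otherwise. The remaining elements are conjugates and roots of these. -/
lemma Lifts.ext (h : Lifts X Y π) (h' : Lifts X Y π')
    (hc : ∀ b, Y.obj.G.r (π.f (X.rho.f b).1) = π.f (X.rho.f b).1 ↔
      Y.obj.G.r (π'.f (X.rho.f b).1) = π'.f (X.rho.f b).1) : π = π' := by
  refine MGraph.Hom.ext (funext ?_)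
  have key : ∀ x, ¬ X.obj.G.Exc (X.obj.G.r x) → π.f x = π'.f x := by
    intro x hx
    obtain ⟨b, rfl⟩ := X.exists_rho hx
    have e := h.stFun b
    have e' := h'.stFun b
    have hr := π.stFun_r (X.rho.f b).2
    have hr' := π'.stFun_r (X.rho.f b).2
    by_cases hv : Y.obj.G.r (π.f (X.rho.f b).1) = π.f (X.rho.f b).1
    · rw [← π.r_of_vertex hv, ← π'.r_of_vertex ((hc b).1 hv), ← hr, ← hr', e, e']
    · rw [← π.stFun_flag hv, ← π'.stFun_flag (mt (hc b).2 hv), e, e']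
  refine elem_ind X.obj.qs key ?_ ?_
  · intro x hx
    rw [π.map_i, π'.map_i, key x hx]
  · intro x hx
    rw [π.map_r, π'.map_r, hx]

/-- An edge that stays exceptional has neither half contracted. Otherwise the half-edge of `Y` at
`b` would be the image of the other flag at the exceptional vertex; the conjugate of that flag is
rooted at a nonexceptional vertex, and such vertices stay nonexceptional. -/
lemma Lifts.not_vertex (h : Lifts X Y π) {b : B.G.X}
    (he : X.obj.G.Exc (X.obj.G.r (X.obj.G.i (X.rho.f b).1)))
    (he' : Y.obj.G.Exc (Y.obj.G.r (Y.obj.G.i (Y.rho.f b).1))) :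
    Y.obj.G.r (π.f (X.rho.f b).1) ≠ π.f (X.rho.f b).1 := by
  intro hv
  have h1 := h.stFun b
  obtain ⟨e1, e2⟩ := MGraph.IsQuasiStable.stInv_exc_root (X.rho.f b).2 he
  rw [MGraph.Hom.stFun_pos _ hv he, ← e2] at h1
  rw [← h1, ← MGraph.Hom.map_i, MGraph.i_i, ← MGraph.Hom.map_r] at he'
  exact MGraph.Hom.nexc_map X.obj.qs _ (X.obj.qs.stInv_nexc (X.rho.f b).2) he'

/-- An exceptional edge that ceases to be exceptional loses exactly one of its halves: losing both
would contract an edge of `B`, and losing none would keep the vertex in the middle exceptional. -/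
lemma Lifts.vertex_iff (h : Lifts X Y π) {b : B.G.X} (hb : B.G.i b ≠ b)
    (he : X.obj.G.Exc (X.obj.G.r (X.obj.G.i (X.rho.f b).1)))
    (he' : ¬ Y.obj.G.Exc (Y.obj.G.r (Y.obj.G.i (Y.rho.f b).1))) :
    Y.obj.G.r (π.f (X.rho.f (B.G.i b)).1) = π.f (X.rho.f (B.G.i b)).1 ↔
    ¬ Y.obj.G.r (π.f (X.rho.f b).1) = π.f (X.rho.f b).1 := by
  have h1 := h.stFun b
  have e0 : (X.rho.f (B.G.i b)).1 = X.obj.G.stInv (X.rho.f b).1 :=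
    congrArg Subtype.val (X.rho.map_i b)
  obtain ⟨e1, e2⟩ := MGraph.IsQuasiStable.stInv_exc_root (X.rho.f b).2 he
  rw [e0]
  constructor
  · intro hv hv'
    rw [MGraph.Hom.stFun_pos _ hv' he, ← e2, π.i_of_vertex hv] at h1
    exact MGraph.flag_of_half hb (Y.vertex_rho.1 (by rw [← h1, hv]))
  · intro hv
    by_contra hv'
    have f1 := π.flag_map_i hv
    have f2 := π.flag_map_i hv'
    rw [e2] at f2
    have hexc := MGraph.IsQuasiStable.exc_map π
      (MGraph.IsQuasiStable.flag_i (X.rho.f b).2 he) he f1 f2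
    rw [π.map_r, π.map_i, ← π.stFun_flag hv, h1] at hexc
    exact he' hexc

lemma Lifts.vertex_of_nexc (h : Lifts X Y π) {b : B.G.X} (hb : B.G.i b ≠ b)
    (he : ¬ X.obj.G.Exc (X.obj.G.r (X.obj.G.i (X.rho.f b).1))) :
    ¬ Y.obj.G.r (π.f (X.rho.f b).1) = π.f (X.rho.f b).1 := by
  rw [← π.stFun_nexc he, h.stFun b, vertex_rho]
  exact MGraph.flag_of_half hb

end contracted

section orientation

variable {o : B.G.E → B.G.H} (ho : ∀ e, B.G.edge (o e).1 (o e).2 = e)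
include ho

lemma eq_or_eq {b : B.G.X} (hb : B.G.i b ≠ b) :
    b = (o (B.G.edge b hb)).1 ∨ b = B.G.i (o (B.G.edge b hb)).1 :=
  (MGraph.edge_eq_iff (o (B.G.edge b hb)).2 hb).1 (ho _)

/-- `IsExc` refers to the half-edge selected by `o`, but both halves lead to the same exceptional
vertex. -/
lemma exc_rho_iff (X : QDFib Q B) {b : B.G.X} (hb : B.G.i b ≠ b) :
    X.obj.G.Exc (X.obj.G.r (X.obj.G.i (X.rho.f b).1)) ↔ X.IsExc o (B.G.edge b hb) := by
  rcases eq_or_eq ho hb with h | h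
  · conv_lhs => rw [h]
    rfl
  · have e0 : (X.rho.f (B.G.i (o (B.G.edge b hb)).1)).1
        = X.obj.G.stInv (X.flag o (B.G.edge b hb)) :=
      congrArg Subtype.val (X.rho.map_i _)
    conv_lhs => rw [h, e0]
    have hn := X.flag_nexc o (B.G.edge b hb)
    unfold IsExc
    by_cases he : X.obj.G.Exc (X.obj.G.r (X.obj.G.i (X.flag o (B.G.edge b hb))))
    · rw [(MGraph.IsQuasiStable.stInv_exc_root hn he).1]
    · rw [MGraph.stInv_of_nexc he, X.obj.G.i_i]
      exact iff_of_false hn he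

omit ho in
lemma not_exc_rho (X : QDFib Q B) {b : B.G.X} (hb : B.G.i b = b) :
    ¬ X.obj.G.Exc (X.obj.G.r (X.obj.G.i (X.rho.f b).1)) := by
  rw [X.half_rho.2 hb]; exact (X.rho.f b).2

omit ho in
lemma vertex_map_iff_of_not_half {π : MGraph.Hom X.obj.G Y.obj.G} {x : X.obj.G.X}
    (hx : X.obj.G.i x = x) : Y.obj.G.r (π.f x) = π.f x ↔ X.obj.G.r x = x := by
  refine ⟨fun h => ?_, π.map_vertex⟩
  by_contra hc
  exact π.not_leg_flag hx hc h

/-- A morphism compatible with the identifications of the stabilizations is determined by the set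
of those edges whose first half is contracted. -/
lemma Lifts.ext_contr {π π' : MGraph.Hom X.obj.G Y.obj.G} (h : Lifts X Y π) (h' : Lifts X Y π')
    (hc : ∀ e, Y.obj.G.r (π.f (X.flag o e)) = π.f (X.flag o e) ↔
      Y.obj.G.r (π'.f (X.flag o e)) = π'.f (X.flag o e)) : π = π' := by
  refine h.ext h' fun b => ?_
  by_cases hb : B.G.i b = b
  · have hx := X.half_rho.2 hb
    rw [vertex_map_iff_of_not_half hx, vertex_map_iff_of_not_half hx]
  · by_cases he : X.obj.G.Exc (X.obj.G.r (X.obj.G.i (X.rho.f b).1))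
    · by_cases he' : Y.obj.G.Exc (Y.obj.G.r (Y.obj.G.i (Y.rho.f b).1))
      · exact iff_of_false (h.not_vertex he he') (h'.not_vertex he he')
      · have hc' := hc (B.G.edge b hb)
        unfold flag at hc'
        rcases eq_or_eq ho hb with h1 | h1
        · rwa [← h1] at hc'
        · have h2 : (o (B.G.edge b hb)).1 = B.G.i b :=
            ((congrArg B.G.i h1).trans (B.G.i_i _)).symm
          rw [h2] at hc'
          -- Here `b` is opposite to the oriented half, so its contraction is the negation of that
          -- of the first half.
          have a := h.vertex_iff hb he he'
          have a' := h'.vertex_iff hb he he'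
          tauto
    · exact iff_of_false (h.vertex_of_nexc hb he) (h'.vertex_of_nexc hb he)

lemma hom_ext_contr {f f' : X ⟶ Y} (hc : ∀ e, Hom.Contr o f e ↔ Hom.Contr o f' e) : f = f' :=
  ext_gr ((lifts_gr f).ext_contr ho (lifts_gr f') hc)

end orientation

open scoped Classical in
/-- A morphism contracting everything that `f` contracts factors through `f`. -/
lemma exists_factor (f : X ⟶ Y) (f' : X ⟶ Z)
    (h : ∀ x, Y.obj.G.r ((gr f).f x) = (gr f).f x → Z.obj.G.r ((gr f').f x) = (gr f').f x) :
    ∃ k : Y ⟶ Z, f ≫ k = f' := by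
  obtain ⟨ψ, hψ⟩ := (gr f).exists_factor (gr f') h
  have hl : Lifts Y Z ψ := (lifts_gr f).of_comp (by rw [hψ]; exact lifts_gr f')
  have hp : ∀ v : Z.obj.G.V, Z.obj.D v = ∑ w : Y.obj.G.V, if ψ.f w.1 = v.1 then Y.obj.D w else 0 := by
    intro v
    have h1 := MGraph.push_comp (gr f : X.obj.G ⟶ Y.obj.G) (ψ : Y.obj.G ⟶ Z.obj.G) X.obj.D Y.obj.D
      (fun v => ∑ w : Y.obj.G.V, if ψ.f w.1 = v.1 then Y.obj.D w else 0)
      (QD.Hom.push (Hom.π f)) (fun _ => rfl) v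
    refine (QD.Hom.push (Hom.π f') v).trans (Eq.trans ?_ h1.symm)
    have h2 : ∀ x, (gr f').f x = ((gr f).comp ψ).f x := fun x => by rw [hψ]
    exact Finset.sum_congr rfl fun w _ => if_congr (Iff.of_eq (congrArg (· = v.1) (h2 w.1))) rfl rfl
  exact ⟨Hom.mk (QD.Hom.mk ψ hp) (SG.Hom.ext hl), ext_gr hψ⟩

lemma cancel_left (f : X ⟶ Y) {k k' : Y ⟶ Z} (h : f ≫ k = f ≫ k') : k = k' :=
  ext_gr ((gr f).comp_right_cancel (congrArg gr h))

/-- The identity contracts at least as much as `f`, hence factors through `f`; the factor is also a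
right inverse because `f` can be cancelled. -/
lemma isIso_of_not_contracts (f : X ⟶ Y)
    (h : ∀ x, Y.obj.G.r ((gr f).f x) = (gr f).f x → X.obj.G.r x = x) : IsIso f := by
  obtain ⟨k, hk⟩ := exists_factor f (𝟙 X) h
  refine ⟨k, hk, cancel_left f ?_⟩
  rw [← Category.assoc, hk, Category.id_comp, Category.comp_id]

open scoped Classical in
/-- an object over `Y` is determined by its exceptional edges and the contracted edges -/
lemma exists_hom_over {o : B.G.E → B.G.H} (ho : ∀ e, B.G.edge (o e).1 (o e).2 = e)
    (f : X ⟶ Y) (f' : X' ⟶ Y) (he : ∀ e, X.IsExc o e ↔ X'.IsExc o e)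
    (hc : ∀ e, Hom.Contr o f e ↔ Hom.Contr o f' e) : ∃ k : X ⟶ X', k ≫ f' = f := by
  -- Both stabilizations are identified with `B` and have the same exceptional edges, so the
  -- resulting isomorphism between them lifts to a map `θ` of the graphs themselves.
  let τ := X.rhoInv.comp X'.rho
  have hτ' : ∀ b, τ.f (X.rho.f b) = X'.rho.f b := fun b => congrArg X'.rho.f (X.rhoInv_rho b)
  have hτ : ∀ x, X.obj.G.Exc (X.obj.G.r (X.obj.G.i x.1)) ↔
      X'.obj.G.Exc (X'.obj.G.r (X'.obj.G.i (τ.f x).1)) := by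
    intro x
    obtain ⟨b, rfl⟩ := X.rho.surjective x
    rw [hτ']
    by_cases hb : B.G.i b = b
    · exact iff_of_false (not_exc_rho X hb) (not_exc_rho X' hb)
    · rw [exc_rho_iff ho X hb, exc_rho_iff ho X' hb, he]
  obtain ⟨θ, h1, h2⟩ := MGraph.IsQuasiStable.exists_extend (h := X.obj.qs) (h' := X'.obj.qs) τ hτ
    (X'.rhoInv.comp X.rho)
    (fun x => by
      obtain ⟨b, rfl⟩ := X.rho.surjective x
      rw [hτ']; exact congrArg X.rho.f (X'.rhoInv_rho b))
    (fun x => by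
      obtain ⟨b, rfl⟩ := X'.rho.surjective x
      change τ.f (X.rho.f (X'.rhoInv.f (X'.rho.f b))) = _
      rw [X'.rhoInv_rho, hτ'])
  have h1' : ∀ b, θ.f (X.rho.f b).1 = (X'.rho.f b).1 := fun b => by rw [h1, hτ']
  have hl : Lifts X X' θ := by
    refine MGraph.Hom.ext (funext fun b => Subtype.ext ?_)
    change θ.stFun (X.rho.f b).1 = _
    rw [← h1' b]
    refine if_neg fun h => ?_
    have h3 : X.obj.G.r (X.rho.f b).1 = (X.rho.f b).1 := h2 (by rw [θ.map_r, h.1])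
    rw [MGraph.Hom.i_vertex h3] at h
    exact (X.rho.f b).2 h.2
  have hθ : θ.comp (gr f') = gr f := by
    refine (hl.comp (lifts_gr f')).ext_contr ho (lifts_gr f) fun e => ?_
    refine Iff.trans ?_ (hc e).symm
    have : θ.f (X.flag o e) = X'.flag o e := h1' _
    change Y.obj.G.r ((gr f').f (θ.f (X.flag o e))) = (gr f').f (θ.f (X.flag o e)) ↔ _
    rw [this]
    exact Iff.rfl
  -- It remains to see that the divisor of `X'` is the push-forward `D` along `θ`. Both equal 1 at
  -- exceptional vertices and have the same push-forward to `Y`. Distinct nonexceptional vertices of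
  -- `X'` have distinct images in `Y`, since they correspond to distinct vertices of `B`; comparing
  -- the push-forwards therefore gives equality at them too.
  let D : X'.obj.G.V → ℤ := fun v => ∑ w : X.obj.G.V, if θ.f w.1 = v.1 then X.obj.D w else 0
  have hexc : ∀ v : X'.obj.G.V, X'.obj.G.Exc v.1 → X'.obj.D v = D v := by
    intro v hv
    rw [X'.obj.adm v hv]
    obtain ⟨a, ha, hav⟩ := θ.exists_vertex v.2
    rw [show D v = X.obj.D ⟨a, ha⟩ from ?_, X.obj.adm]
    · exact X.obj.qs.exc_of_map θ ha (by rwa [hav])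
    · change (∑ w : X.obj.G.V, _) = _
      rw [Finset.sum_eq_single ⟨a, ha⟩, if_pos hav]
      · intro b _ hb
        rw [if_neg fun h => hb (Subtype.ext (h2 (h.trans hav.symm)))]
      · simp
  have hsum : ∀ u : Y.obj.G.V, (∑ v : X'.obj.G.V, if (gr f').f v.1 = u.1 then X'.obj.D v else 0)
      = ∑ v : X'.obj.G.V, if (gr f').f v.1 = u.1 then D v else 0 := by
    intro u
    have h3 := MGraph.push_comp (θ : X.obj.G ⟶ X'.obj.G) (gr f' : X'.obj.G ⟶ Y.obj.G) X.obj.D D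
      (fun u => ∑ v : X'.obj.G.V, if (gr f').f v.1 = u.1 then D v else 0) (fun _ => rfl)
      (fun _ => rfl) u
    refine ((QD.Hom.push (Hom.π f') u).symm.trans (QD.Hom.push (Hom.π f) u)).trans
      (Eq.trans ?_ h3.symm)
    refine Finset.sum_congr rfl fun w _ => if_congr (Iff.of_eq ?_) rfl rfl
    change ((gr f).f w.1 = u.1) = ((θ.comp (gr f')).f w.1 = u.1)
    rw [hθ]
  have hp : ∀ v : X'.obj.G.V, X'.obj.D v = D v := by
    intro v
    by_cases hv : X'.obj.G.Exc v.1
    · exact hexc v hv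
    · have h3 := hsum ⟨(gr f').f v.1, (gr f').map_vertex v.2⟩
      rw [← sub_eq_zero, ← Finset.sum_sub_distrib, Finset.sum_eq_single v] at h3
      · rw [if_pos rfl, if_pos rfl] at h3
        exact sub_eq_zero.1 h3
      · intro w _ hw
        by_cases hwv : (gr f').f w.1 = (gr f').f v.1
        · rw [if_pos hwv, if_pos hwv, sub_eq_zero]
          refine hexc w ?_
          by_contra hwe
          have hvr := v.2
          have hwr := w.2
          obtain ⟨b, hb⟩ := X'.exists_rho (x := v.1) (by rwa [v.2])
          obtain ⟨c, hc⟩ := X'.exists_rho (x := w.1) (by rwa [w.2])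
          have e1 := (lifts_gr f').stFun b
          have e2 := (lifts_gr f').stFun c
          rw [hb, MGraph.Hom.stFun_nexc _ (by rw [MGraph.Hom.i_vertex v.2, v.2]; exact hv)] at e1
          rw [hc, MGraph.Hom.stFun_nexc _ (by rw [MGraph.Hom.i_vertex w.2, w.2]; exact hwe)] at e2
          have : c = b := Y.rho_injective (by rw [← e1, ← e2, hwv])
          exact hw (Subtype.ext (by rw [← hb, ← hc, this]))
        · rw [if_neg hwv, if_neg hwv, sub_zero]
      · simp
  exact ⟨Hom.mk (QD.Hom.mk θ hp) (SG.Hom.ext hl), ext_gr hθ⟩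

end QDFib

end Trop

/-! ### Points of polytopes as edge lengths -/

namespace Trop

open CategoryTheory Topology

namespace QDFib

variable {g n : ℕ} {Q : ObjectProperty (QD g n)} {B : SG g n} {X Y Z X' : QDFib Q B}
  {o : B.G.E → B.G.H} {d : B.G.E → ℝ}

/-- the identification of the stabilization of `X` with the base graph preserves the lengths -/
def Adapted (X : QDFib Q B) (d : B.G.E → ℝ) (l : X.obj.G.E → ℝ) : Prop :=
  X.rho.Compat d (X.obj.qs.stLen l)

lemma adapted_iff {l : X.obj.G.E → ℝ} : X.Adapted d l ↔
    ∀ b, B.G.len d b = MGraph.IsQuasiStable.stLenAux X.obj.G l (X.rho.f b).1 :=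
  forall_congr' fun b => by rw [X.obj.qs.len_stLen]

open scoped Classical in
lemma Adapted.len_add {l : X.obj.G.E → ℝ} (h : X.Adapted d l) (b : B.G.X) :
    X.obj.G.len l (X.rho.f b).1 + (if X.obj.G.Exc (X.obj.G.r (X.obj.G.i (X.rho.f b).1)) then
      X.obj.G.len l (X.rho.f (B.G.i b)).1 else 0) = B.G.len d b := by
  have e0 : (X.rho.f (B.G.i b)).1 = X.obj.G.stInv (X.rho.f b).1 :=
    congrArg Subtype.val (X.rho.map_i b)
  rw [adapted_iff.1 h b, e0]
  rfl

lemma Adapted.of_compat {f : X ⟶ Y} {l : X.obj.G.E → ℝ} {l' : Y.obj.G.E → ℝ}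
    (hc : (gr f).Compat l l') (h : Y.Adapted d l') : X.Adapted d l := by
  intro b
  rw [h b, ← lifts_gr f]
  exact (MGraph.IsQuasiStable.compat_st X.obj.qs Y.obj.qs hc _).symm

open scoped Classical in
/-- the coordinate of a point at an edge -/
noncomputable def coord (X : QDFib Q B) (p : X.P o d) (e : B.G.E) : ℝ :=
  if h : X.IsExc o e then (p ⟨e, h⟩).1 else 0

lemma coord_exc (p : X.P o d) {e : B.G.E} (h : X.IsExc o e) : X.coord p e = (p ⟨e, h⟩).1 :=
  dif_pos h

open scoped Classical in
/-- the length of the edge of `X` through the half-edge that corresponds to a half-edge `b` of the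
base graph -/
noncomputable def halfLen (X : QDFib Q B) (p : X.P o d) (b : B.G.X) : ℝ :=
  if hb : B.G.i b ≠ b then
    if X.IsExc o (B.G.edge b hb) then
      if b = (o (B.G.edge b hb)).1 then X.coord p (B.G.edge b hb)
      else d (B.G.edge b hb) - X.coord p (B.G.edge b hb)
    else d (B.G.edge b hb)
  else 0

lemma halfLen_nexc (p : X.P o d) {b : B.G.X} (hb : B.G.i b ≠ b)
    (h : ¬ X.IsExc o (B.G.edge b hb)) : X.halfLen p b = d (B.G.edge b hb) := by
  rw [halfLen, dif_pos hb, if_neg h]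

lemma halfLen_not_half (p : X.P o d) {b : B.G.X} (hb : B.G.i b = b) : X.halfLen p b = 0 := by
  rw [halfLen, dif_neg (not_not.2 hb)]

open scoped Classical in
/-- the lengths of the edges of `X` given by a point of the polytope, as a function on the
half-edges -/
noncomputable def lenAux (X : QDFib Q B) (p : X.P o d) (x : X.obj.G.X) : ℝ :=
  if he : ¬ X.obj.G.Exc (X.obj.G.r x) then X.halfLen p (X.rhoInv.f (X.obj.qs.toSt he))
  else if he' : ¬ X.obj.G.Exc (X.obj.G.r (X.obj.G.i x)) then
    X.halfLen p (X.rhoInv.f (X.obj.qs.toSt he'))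
  else 0

lemma lenAux_rho (p : X.P o d) (b : B.G.X) : X.lenAux p (X.rho.f b).1 = X.halfLen p b := by
  rw [lenAux, dif_pos (X.rho.f b).2, MGraph.IsQuasiStable.toSt_self, rhoInv_rho]

lemma lenAux_i_rho (p : X.P o d) {b : B.G.X}
    (he : X.obj.G.Exc (X.obj.G.r (X.obj.G.i (X.rho.f b).1))) :
    X.lenAux p (X.obj.G.i (X.rho.f b).1) = X.halfLen p b := by
  have he' : ¬ X.obj.G.Exc (X.obj.G.r (X.obj.G.i (X.obj.G.i (X.rho.f b).1))) := by
    rw [X.obj.G.i_i]; exact (X.rho.f b).2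
  rw [lenAux, dif_neg (not_not.2 he), dif_pos he']
  have : X.obj.qs.toSt he' = X.rho.f b := Subtype.ext (X.obj.G.i_i _)
  rw [this, rhoInv_rho]

variable (ho : ∀ e, B.G.edge (o e).1 (o e).2 = e)
include ho

lemma edge_i_eq {b : B.G.X} (hb : B.G.i b ≠ b) :
    b = (o (B.G.edge b hb)).1 ↔ ¬ B.G.i b = (o (B.G.edge b hb)).1 := by
  rcases eq_or_eq ho hb with h | h
  · exact iff_of_true h fun h' => hb (h'.trans h.symm)
  · have h2 : B.G.i b = (o (B.G.edge b hb)).1 := (congrArg B.G.i h).trans (B.G.i_i _)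
    exact iff_of_false (fun h' => hb (h2.trans h'.symm)) (not_not.2 h2)

lemma halfLen_add (p : X.P o d) {b : B.G.X} (hb : B.G.i b ≠ b)
    (h : X.IsExc o (B.G.edge b hb)) : X.halfLen p b + X.halfLen p (B.G.i b)
      = d (B.G.edge b hb) := by
  have hb' := MGraph.half_i hb
  have e1 := MGraph.edge_i hb hb'
  have h2 := edge_i_eq ho hb
  unfold halfLen
  rw [dif_pos hb, dif_pos hb', e1, if_pos h, if_pos h]
  by_cases h3 : b = (o (B.G.edge b hb)).1
  · rw [if_pos h3, if_neg (h2.1 h3)]; ring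
  · rw [if_neg h3, if_pos (not_not.1 (mt h2.2 h3))]; ring

omit ho in
lemma halfLen_i (p : X.P o d) {b : B.G.X} (hb : B.G.i b ≠ b)
    (h : ¬ X.IsExc o (B.G.edge b hb)) : X.halfLen p (B.G.i b) = X.halfLen p b := by
  have hb' := MGraph.half_i hb
  rw [halfLen_nexc p hb h, halfLen_nexc p hb' (by rwa [MGraph.edge_i hb hb']),
    MGraph.edge_i hb hb']

lemma lenAux_i (p : X.P o d) {x : X.obj.G.X} (hx : X.obj.G.i x ≠ x) :
    X.lenAux p (X.obj.G.i x) = X.lenAux p x := by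
  by_cases he : X.obj.G.Exc (X.obj.G.r x)
  · obtain ⟨b, hb⟩ := X.exists_rho (X.obj.qs.nexc_i (MGraph.flag_of_half hx) he)
    have h1 := lenAux_i_rho (X := X) p (b := b) (by rw [hb, X.obj.G.i_i]; exact he)
    rw [hb, X.obj.G.i_i] at h1
    rw [h1, ← hb, lenAux_rho]
  · obtain ⟨b, rfl⟩ := X.exists_rho he
    have hb : B.G.i b ≠ b := fun h => hx (X.half_rho.2 h)
    by_cases he' : X.obj.G.Exc (X.obj.G.r (X.obj.G.i (X.rho.f b).1))
    · rw [lenAux_i_rho p he', lenAux_rho]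
    · have e : X.obj.G.i (X.rho.f b).1 = (X.rho.f (B.G.i b)).1 := by
        rw [X.rho.map_i]; exact (MGraph.stInv_of_nexc he').symm
      rw [e, lenAux_rho, lenAux_rho, halfLen_i p hb (by rwa [← exc_rho_iff ho])]

/-- the lengths of the edges of `X` given by a point of the polytope -/
noncomputable def edgeLen (p : X.P o d) : X.obj.G.E → ℝ :=
  X.obj.G.edgeFun (X.lenAux p) fun _ => lenAux_i ho p

/-- the lengths given by a point of the polytope, as a function on all elements of the graph -/
noncomputable def lens (p : X.P o d) : X.obj.G.X → ℝ := X.obj.G.len (X.edgeLen ho p)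

lemma lens_rho (p : X.P o d) (b : B.G.X) : lens ho p (X.rho.f b).1 = X.halfLen p b := by
  by_cases hb : B.G.i b = b
  · rw [halfLen_not_half p hb]
    exact MGraph.len_zero _ (X.half_rho.2 hb)
  · exact (MGraph.len_edgeFun _ _ (mt X.half_rho.1 hb)).trans (lenAux_rho p b)

lemma lens_i (p : X.P o d) (x : X.obj.G.X) : lens ho p (X.obj.G.i x) = lens ho p x :=
  MGraph.len_i _ _

lemma lens_vertex (p : X.P o d) {x : X.obj.G.X} (hx : X.obj.G.r x = x) : lens ho p x = 0 :=
  MGraph.len_vertex _ hx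

lemma lens_flag (p : X.P o d) {e : B.G.E} (h : X.IsExc o e) :
    lens ho p (X.flag o e) = (p ⟨e, h⟩).1 := by
  refine (lens_rho ho p _).trans ?_
  rw [halfLen, dif_pos (o e).2, ho, if_pos h, if_pos rfl, coord_exc]

lemma lens_flag_nexc (p : X.P o d) {e : B.G.E} (h : ¬ X.IsExc o e) :
    lens ho p (X.flag o e) = d e := by
  refine (lens_rho ho p _).trans ?_
  rw [halfLen_nexc p (o e).2 (by rwa [ho]), ho]

lemma lens_injective : Function.Injective (lens ho : X.P o d → _) := by
  intro p p' h
  funext e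
  refine Subtype.ext ?_
  have h1 := congrFun h (X.flag o e.1)
  rwa [lens_flag ho p e.2, lens_flag ho p' e.2] at h1

lemma adapted_edgeLen (p : X.P o d) : X.Adapted d (X.edgeLen ho p) := by
  classical
  rw [adapted_iff]
  intro b
  have e0 : (X.rho.f (B.G.i b)).1 = X.obj.G.stInv (X.rho.f b).1 :=
    congrArg Subtype.val (X.rho.map_i b)
  unfold MGraph.IsQuasiStable.stLenAux
  rw [← e0]
  change _ = lens ho p _ + if _ then lens ho p _ else 0
  rw [lens_rho, lens_rho]
  by_cases hb : B.G.i b = b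
  · rw [if_neg (not_exc_rho X hb), halfLen_not_half p hb, MGraph.len_zero _ hb, add_zero]
  · rw [MGraph.len_half _ hb]
    by_cases he : X.IsExc o (B.G.edge b hb)
    · rw [if_pos ((exc_rho_iff ho X hb).2 he), halfLen_add ho p hb he]
    · rw [if_neg (mt (exc_rho_iff ho X hb).1 he), halfLen_nexc p hb he, add_zero]

/-- lengths that are compatible with the lengths of the stabilization are determined by the lengths
of the first halves of the exceptional edges -/
lemma Adapted.ext {l l' : X.obj.G.E → ℝ} (h : X.Adapted d l) (h' : X.Adapted d l')
    (hf : ∀ e, X.IsExc o e → X.obj.G.len l (X.flag o e) = X.obj.G.len l' (X.flag o e))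
    (x : X.obj.G.X) : X.obj.G.len l x = X.obj.G.len l' x := by
  classical
  have key : ∀ b, X.obj.G.len l (X.rho.f b).1 = X.obj.G.len l' (X.rho.f b).1 := by
    intro b
    have h1 := h.len_add b
    rw [← h'.len_add b] at h1
    by_cases hb : B.G.i b = b
    · have := X.half_rho.2 hb
      rw [MGraph.len_zero _ this, MGraph.len_zero _ this]
    · by_cases he : X.obj.G.Exc (X.obj.G.r (X.obj.G.i (X.rho.f b).1))
      · rw [if_pos he, if_pos he] at h1
        rw [exc_rho_iff ho X hb] at he
        have h2 := hf _ he
        unfold flag at h2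
        rcases eq_or_eq ho hb with h3 | h3
        · rwa [← h3] at h2
        · have h4 : (o (B.G.edge b hb)).1 = B.G.i b :=
            ((congrArg B.G.i h3).trans (B.G.i_i _)).symm
          rw [h4] at h2
          linarith
      · rw [if_neg he, if_neg he, add_zero, add_zero] at h1
        exact h1
  refine elem_ind X.obj.qs (p := fun x => X.obj.G.len l x = X.obj.G.len l' x) ?_ ?_ ?_ x
  · intro x hx
    obtain ⟨b, rfl⟩ := X.exists_rho hx
    exact key b
  · intro x hx
    obtain ⟨b, rfl⟩ := X.exists_rho hx
    rw [MGraph.len_i, MGraph.len_i]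
    exact key b
  · intro x _
    rw [MGraph.len_vertex _ (X.obj.G.r_r _), MGraph.len_vertex _ (X.obj.G.r_r _)]

/-- lengths that are compatible with the lengths of the stabilization come from a point of the
polytope -/
lemma Adapted.exists_point {l : X.obj.G.E → ℝ} (h : X.Adapted d l)
    (hl : ∀ x, 0 ≤ X.obj.G.len l x) : ∃ p : X.P o d, lens ho p = X.obj.G.len l := by
  classical
  -- The two halves add up to `d e`, and the second one is nonnegative.
  have hle : ∀ e : {e : B.G.E // X.IsExc o e}, X.obj.G.len l (X.flag o e.1) ≤ d e.1 := by
    intro e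
    have h1 := h.len_add (o e.1).1
    rw [MGraph.len_half _ (o e.1).2, ho, if_pos ((exc_rho_iff ho X (o e.1).2).2
      (by rw [ho]; exact e.2))] at h1
    have h2 := hl (X.rho.f (B.G.i (o e.1).1)).1
    unfold flag
    linarith
  let p : X.P o d := fun e => ⟨X.obj.G.len l (X.flag o e.1), hl _, hle e⟩
  exact ⟨p, funext fun x => Adapted.ext ho (adapted_edgeLen ho p) h
    (fun e he => lens_flag ho p he) x⟩

lemma lens_nonneg (p : X.P o d) (hd : ∀ e, 0 < d e) (x : X.obj.G.X) : 0 ≤ lens ho p x := by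
  have hc : ∀ e, 0 ≤ X.coord p e ∧ X.coord p e ≤ d e := by
    intro e
    unfold coord
    split
    · exact (p _).2
    · exact ⟨le_rfl, (hd e).le⟩
  have key : ∀ b, 0 ≤ lens ho p (X.rho.f b).1 := by
    intro b
    rw [lens_rho]
    unfold halfLen
    split_ifs
    · exact (hc _).1
    · exact sub_nonneg.2 (hc _).2
    · exact (hd _).le
    · exact le_rfl
  refine elem_ind X.obj.qs (p := fun x => 0 ≤ lens ho p x) ?_ ?_ ?_ x
  · intro x hx
    obtain ⟨b, rfl⟩ := X.exists_rho hx
    exact key b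
  · intro x hx
    obtain ⟨b, rfl⟩ := X.exists_rho hx
    rw [lens_i]; exact key b
  · intro x _
    rw [lens_vertex ho p (X.obj.G.r_r _)]

lemma continuous_lens (x : X.obj.G.X) : Continuous fun p : X.P o d => lens ho p x := by
  have hc : ∀ e, Continuous fun p : X.P o d => X.coord p e := by
    intro e
    unfold coord
    split
    · exact continuous_subtype_val.comp (continuous_apply _)
    · exact continuous_const
  have key : ∀ b, Continuous fun p : X.P o d => lens ho p (X.rho.f b).1 := by
    intro b
    simp only [lens_rho]
    unfold halfLen
    split_ifs
    · exact hc _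
    · exact continuous_const.sub (hc _)
    · exact continuous_const
    · exact continuous_const
  refine elem_ind X.obj.qs (p := fun x => Continuous fun p : X.P o d => lens ho p x) ?_ ?_ ?_ x
  · intro x hx
    obtain ⟨b, rfl⟩ := X.exists_rho hx
    exact key b
  · intro x hx
    obtain ⟨b, rfl⟩ := X.exists_rho hx
    simp only [lens_i]; exact key b
  · intro x _
    simp only [lens_vertex ho _ (X.obj.G.r_r _)]
    exact continuous_const

/-- The coordinates of the polytope occur among the lengths, so closeness of points can be tested on
lengths. All metric estimates below are made in this form, which does not refer to the shape of the
polytope. -/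
lemma isInducing_lens : IsInducing (lens ho : X.P o d → _) := by
  have h : Continuous (lens ho : X.P o d → _) := continuous_pi (continuous_lens ho)
  refine IsInducing.of_comp (g := fun u (e : {e : B.G.E // X.IsExc o e}) => u (X.flag o e.1)) h
    (continuous_pi fun e => continuous_apply _) ?_
  have : (fun u (e : {e : B.G.E // X.IsExc o e}) => u (X.flag o e.1)) ∘ (lens ho : X.P o d → _)
      = fun (p : X.P o d) e => (p e).1 := by
    funext p e
    exact lens_flag ho p e.2
  rw [this]
  exact IsInducing.piMap 
    (f := fun (e : {e : B.G.E // X.IsExc o e}) (x : Set.Icc (0 : ℝ) (d e.1)) => x.1)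
    fun _ => IsInducing.subtypeVal

/-- the face inclusions are compatible with the lengths -/
lemma lens_mapP (hd : ∀ e, 0 < d e) (f : X ⟶ Y) (q : Y.P o d) (x : X.obj.G.X) :
    lens ho (mapP o hd f q) x = lens ho q ((gr f).f x) := by
  -- The lengths of `q` pulled back along `f` also stabilize to `d`; by `Adapted.ext` it is enough
  -- to compare the first halves of the exceptional edges.
  let l : X.obj.G.E → ℝ := X.obj.G.edgeFun (fun x => lens ho q ((gr f).f x)) fun x _ => by
    rw [(gr f).map_i, lens_i]
  have hl : (gr f).Compat l (Y.edgeLen ho q) := by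
    intro x
    by_cases hx : X.obj.G.i x = x
    · rw [MGraph.len_zero _ hx, MGraph.len_zero]
      rw [← (gr f).map_i, hx]
    · rw [MGraph.len_edgeFun _ _ hx]; rfl
  have ha : X.Adapted d l := Adapted.of_compat hl (adapted_edgeLen ho q)
  refine (Adapted.ext ho (adapted_edgeLen ho _) ha (fun e he => ?_) x).trans (hl x)
  rw [hl]
  refine (lens_flag ho _ he).trans ?_
  change _ = lens ho q ((gr f).f (X.flag o e))
  unfold mapP
  by_cases h : Y.IsExc o e
  · rw [dif_pos h, Hom.flag_eq f (Hom.not_contr f h), lens_flag ho q h]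
  -- If `e` is no longer exceptional, its first half is either contracted, of length 0, or becomes
  -- the whole edge, of length `d e`. These are the two values used by `mapP`.
  · rw [dif_neg h]
    by_cases hc : Hom.Contr o f e
    · rw [if_pos hc]
      exact (lens_vertex ho q hc).symm
    · rw [if_neg hc, Hom.flag_eq f hc, lens_flag_nexc ho q h]

lemma compat_edgeLen (hd : ∀ e, 0 < d e) (f : X ⟶ Y) (q : Y.P o d) :
    (gr f).Compat (X.edgeLen ho (mapP o hd f q)) (Y.edgeLen ho q) :=
  lens_mapP ho hd f q

/-- Reduces statements about faces of polytopes to lengths of elements of graphs, where the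
factorization lemmas for contractions apply. -/
lemma mapP_eq_iff (hd : ∀ e, 0 < d e) (f : X ⟶ Y) {q : Y.P o d} {p : X.P o d} :
    mapP o hd f q = p ↔ ∀ x, lens ho p x = lens ho q ((gr f).f x) := by
  constructor
  · rintro rfl x
    exact lens_mapP ho hd f q x
  · intro h
    refine lens_injective ho (funext fun x => ?_)
    rw [h, lens_mapP]

/-- all edges have positive length -/
def Interior (q : Y.P o d) : Prop := ∀ x, Y.obj.G.i x ≠ x → 0 < lens ho q x

/-- If `f` does not send `x` to a vertex, the image is a half-edge or a leg. Half-edges of `Y` are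
too long. Legs have length zero, but then `x` is a leg too, and `f'` sends no leg to a vertex. -/
lemma Interior.vertex_of_lens {q : Y.P o d} {δ : ℝ}
    (hδ : ∀ x, Y.obj.G.i x ≠ x → δ ≤ lens ho q x) {f : X ⟶ Y} {f' : X ⟶ Z} {x : X.obj.G.X}
    (hx : lens ho q ((gr f).f x) < δ)
    (hv : Z.obj.G.r ((gr f').f x) = (gr f').f x) : Y.obj.G.r ((gr f).f x) = (gr f).f x := by
  by_contra hc
  have h1 : Y.obj.G.i ((gr f).f x) = (gr f).f x := by
    by_contra hc'
    exact absurd (hδ _ hc') (not_le.2 hx)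
  have h2 : X.obj.G.i x = x := by
    by_contra hc'
    exact ((gr f).half_iff hc).2 hc' h1
  exact (gr f').not_leg_flag h2 ((gr f).flag_of_flag hc) hv

/-- A face inclusion into a polytope whose image contains a point near an interior point `q` of a
face factors the inclusion of that face. -/
lemma exists_factor_of_near (hd : ∀ e, 0 < d e) {q : Y.P o d} {δ : ℝ}
    (hδ : ∀ x, Y.obj.G.i x ≠ x → δ ≤ lens ho q x) (f : X ⟶ Y) {p : X.P o d}
    (hp : ∀ x, |lens ho p x - lens ho q ((gr f).f x)| < δ) (f' : X ⟶ Z) {z : Z.P o d}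
    (hz : mapP o hd f' z = p) : ∃ k : Z ⟶ Y, f' ≫ k = f := by
  refine exists_factor f' f fun x hx => Interior.vertex_of_lens ho hδ ?_ hx
  have h1 := hp x
  rw [(mapP_eq_iff ho hd f').1 hz, lens_vertex ho z hx, zero_sub, abs_neg] at h1
  exact lt_of_abs_lt h1

/-- What `f'` contracts has length zero at the common point, whereas all half-edges that survive in
`Y` have positive length at `q`; so `f` contracts it as well. Thus a representation of a point by an
interior point is reached from every other representation, in particular it is unique up to
isomorphism. -/
lemma exists_factor_of_eq (hd : ∀ e, 0 < d e) {q : Y.P o d} (hq : Interior ho q) (f : X ⟶ Y)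
    (f' : X ⟶ Z) {z : Z.P o d} (hz : mapP o hd f' z = mapP o hd f q) :
    ∃ k : Z ⟶ Y, f' ≫ k = f ∧ mapP o hd k q = z := by
  have h0 := (mapP_eq_iff ho hd f').1 hz
  obtain ⟨k, hk⟩ : ∃ k : Z ⟶ Y, f' ≫ k = f := by
    refine exists_factor f' f fun x hx => ?_
    by_contra hc
    have h1 : Y.obj.G.i ((gr f).f x) = (gr f).f x := by
      by_contra hc'
      have := hq _ hc'
      rw [← lens_mapP ho hd f q x, h0, lens_vertex ho z hx] at this
      exact lt_irrefl _ this
    have h2 : X.obj.G.i x = x := by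
      by_contra hc'
      exact ((gr f).half_iff hc).2 hc' h1
    exact (gr f').not_leg_flag h2 ((gr f).flag_of_flag hc) hx
  refine ⟨k, hk, (mapP_eq_iff ho hd k).2 fun y => ?_⟩
  obtain ⟨x, rfl⟩ := (gr f').surjective y
  rw [← h0, lens_mapP, ← hk]
  rfl

/-- morphisms to `Y` for which the images of a point in the polytope of `Y` are close are equal -/
lemma eq_of_near {q : Y.P o d} {f f' : X ⟶ Y}
    (h : ∀ e x, |lens ho q ((gr f).f x) - lens ho q ((gr f').f x)| < d e) : f = f' := by
  have key : ∀ {f f' : X ⟶ Y}, (∀ e x, |lens ho q ((gr f).f x) - lens ho q ((gr f').f x)| < d e) →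
      ∀ e, Hom.Contr o f e → Hom.Contr o f' e := by
    intro f f' h e hc
    by_contra hc'
    have he : ¬ Y.IsExc o e := fun he => Hom.not_contr f he hc
    have h1 := h e (X.flag o e)
    have h2 : (gr f').f (X.flag o e) = Y.flag o e := Hom.flag_eq f' hc'
    -- A first half contracted by `f` but not by `f'` has length 0 at one image and `d e` at the
    -- other.
    rw [lens_vertex ho q hc, h2, lens_flag_nexc ho q he, zero_sub, abs_neg] at h1
    exact absurd (le_abs_self _) (not_le.2 h1)
  exact hom_ext_contr ho fun e => ⟨key h e, key (fun e x => by rw [abs_sub_comm]; exact h e x) e⟩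

/-- Rigidity: for `X = Y` this says that an endomorphism over `B` fixing a point of the polytope is
the identity. -/
lemma eq_of_mapP_eq (hd : ∀ e, 0 < d e) {q : Y.P o d} {f f' : X ⟶ Y}
    (h : mapP o hd f q = mapP o hd f' q) : f = f' := by
  refine eq_of_near ho (q := q) fun e x => ?_
  rw [← lens_mapP ho hd, ← lens_mapP ho hd, h, sub_self, abs_zero]
  exact hd e

end QDFib

end Trop

/-! ### Every point of a polytope is an interior point of a face -/

namespace Trop

open CategoryTheory Topology

namespace QDFib

variable {g n : ℕ} {Q : ObjectProperty (QD g n)} {B : SG g n} {X Y Z X' : QDFib Q B}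
  {o : B.G.E → B.G.H} {d : B.G.E → ℝ} (ho : ∀ e, B.G.edge (o e).1 (o e).2 = e)
  (hd : ∀ e, 0 < d e)

include ho hd

/-- Edges that are not part of a subdivided edge have the positive length `d e`, so an edge of
length zero ends at an exceptional vertex. It is then not a loop and has an end of genus zero, as
`contractionMap` requires. -/
lemma exists_exc_of_not_interior {p : X.P o d} (h : ¬ Interior ho p) :
    ∃ y, X.obj.G.i y ≠ y ∧ X.obj.G.Exc (X.obj.G.r y) ∧ lens ho p y = 0 := by
  unfold Interior at h
  push Not at h
  obtain ⟨x, hx, h0⟩ := h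
  have h0 := le_antisymm h0 (lens_nonneg ho p hd x)
  by_cases he : X.obj.G.Exc (X.obj.G.r x)
  · exact ⟨x, hx, he, h0⟩
  · obtain ⟨b, rfl⟩ := X.exists_rho he
    by_cases he' : X.obj.G.Exc (X.obj.G.r (X.obj.G.i (X.rho.f b).1))
    · exact ⟨_, MGraph.half_i hx, he', by rw [lens_i, h0]⟩
    · have hb : B.G.i b ≠ b := fun hb => hx (X.half_rho.2 hb)
      rw [lens_rho, halfLen_nexc p hb (mt (exc_rho_iff ho X hb).2 he')] at h0
      exact absurd h0 (hd _).ne'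

/-- Edges of length zero are contracted one at a time, by induction on the number of elements of the
graph. The closedness of `Q` under push-forward enters the construction of the fibre product through
this lemma. -/
lemma exists_interior (hQ : ∀ {A A' : QD g n}, (A ⟶ A') → Q A → Q A') (X : QDFib Q B)
    (p : X.P o d) : ∃ (Z : QDFib Q B) (z : Z.P o d) (f : X ⟶ Z),
      Interior ho z ∧ mapP o hd f z = p := by
  induction hN : Fintype.card X.obj.G.X using Nat.strong_induction_on generalizing X with
  | _ N ih =>
  subst hN
  by_cases hp : Interior ho p
  · exact ⟨X, p, 𝟙 X, hp, mapP_id o hd X p⟩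
  · obtain ⟨y, hy, hye, hy0⟩ := exists_exc_of_not_interior ho hd hp
    have hl := (X.obj.qs.exc_edges y (MGraph.flag_of_half hy) hye).2
    have h0 := ((MGraph.exc_iff hye.vertex).1 hye).1
    let π := MGraph.contractionMap hy hl h0
    have hπ : ∀ x, (MGraph.contraction hy hl).r (π.f x) = π.f x → lens ho p x = 0 := by
      intro x hx
      by_cases hr : X.obj.G.Removed y x
      · rcases hr with h | h | h
        · rw [h, lens_vertex ho p (X.obj.G.r_r _)]
        · rw [h, hy0]
        · rw [h, lens_i, hy0]
      · have h1 : π.f x = ⟨x, hr⟩ := MGraph.toContraction_of_not_removed hy hl hr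
        rw [h1] at hx
        exact lens_vertex ho p ((MGraph.contraction_r_iff hy hl _).1 hx)
    obtain ⟨l, hc⟩ := π.exists_compat (X.edgeLen ho p) hπ
    let A := X.obj.push π
    let F : X.obj ⟶ A := X.obj.toPush π
    have hst := MGraph.IsQuasiStable.compat_st X.obj.qs A.qs hc
    -- The lengths on the stabilization are those of `d`, hence positive, and they are zero on
    -- everything that is contracted. So the stabilized morphism contracts no edge and is an
    -- isomorphism, and the contracted graph still lies over `B`.
    have hiso : IsIso (QD.st.map F) := by
      obtain ⟨ψ, h1, h2⟩ := (MGraph.Hom.st X.obj.qs A.qs π).exists_inverse (fun z hz => by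
        obtain ⟨b, rfl⟩ := X.rho.surjective z
        have h2 := (adapted_edgeLen ho p b).trans (hst _)
        rw [MGraph.len_vertex _ hz] at h2
        have hb : B.G.i b = b := by
          by_contra hb
          rw [MGraph.len_half _ hb] at h2
          exact (hd _).ne' h2
        have hz' : X.obj.qs.st.i (X.rho.f b) = X.rho.f b := by rw [← MGraph.Hom.map_i, hb]
        by_contra hc
        exact (MGraph.Hom.st X.obj.qs A.qs π).not_leg_flag hz' hc hz)
      exact ⟨⟨ψ⟩, SG.Hom.ext h1, SG.Hom.ext h2⟩
    let W : QDFib Q B := ⟨A, hQ F X.prop, X.ρ ≪≫ asIso (QD.st.map F)⟩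
    let f : X ⟶ W := Hom.mk F rfl
    have hW : W.Adapted d l := by
      intro b
      exact (adapted_edgeLen ho p b).trans (hst _)
    obtain ⟨q, hq⟩ := hW.exists_point ho (fun w => by
      obtain ⟨x, rfl⟩ := π.surjective w
      have h := hc x
      change lens ho p x = W.obj.G.len l (π.f x) at h
      rw [← h]; exact lens_nonneg ho p hd x)
    have hf : mapP o hd f q = p := by
      rw [mapP_eq_iff ho hd]
      intro x
      rw [hq]
      exact hc x
    have hcard : Fintype.card W.obj.G.X < Fintype.card X.obj.G.X := by
      refine Fintype.card_lt_of_injective_of_notMem (b := y)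
        (fun w : {x : X.obj.G.X // ¬ X.obj.G.Removed y x} => w.1) Subtype.val_injective ?_
      rintro ⟨⟨w, hwr⟩, hw⟩
      exact hwr (Or.inr (Or.inl hw))
    obtain ⟨Z, z, k, h1, h2⟩ := ih _ hcard W q rfl
    exact ⟨Z, z, f ≫ k, h1, by rw [mapP_comp, h2, hf]⟩

end QDFib

end Trop

/-! ### The points and the topology of the colimit -/

namespace Trop

open CategoryTheory Topology

namespace QDFib

variable {g n : ℕ} {Q : ObjectProperty (QD g n)} {B : SG g n} {X Y Z X' : QDFib Q B}
  {o : B.G.E → B.G.H} {d : B.G.E → ℝ}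

/-- the colimit of the polytopes -/
noncomputable abbrev Gluing (Q : ObjectProperty (QD g n)) {B : SG g n} (o : B.G.E → B.G.H)
    {d : B.G.E → ℝ} (hd : ∀ e, 0 < d e) : TopCat.{1} :=
  Limits.colimit (polytope (Q := Q) o hd)

variable (hd : ∀ e, 0 < d e)

/-- the point of the colimit that is given by a point of a polytope -/
noncomputable def glue (X : QDFib Q B) (p : X.P o d) : Gluing Q o hd :=
  (Limits.colimit.ι (polytope (Q := Q) o hd) (Opposite.op X)).hom (ULift.up p)

lemma glue_mapP (f : X ⟶ Y) (q : Y.P o d) : glue hd X (mapP o hd f q) = glue hd Y q :=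
  congrArg (fun k => k.hom (ULift.up q)) (Limits.colimit.w (polytope (Q := Q) o hd) f.op)

lemma exists_glue (j : Gluing Q o hd) : ∃ (X : QDFib Q B) (p : X.P o d), glue hd X p = j := by
  obtain ⟨X, ⟨p⟩, h⟩ := Limits.Concrete.colimit_exists_rep (polytope (Q := Q) o hd) j
  exact ⟨X.unop, p, h⟩

lemma isOpen_gluing_iff (U : Set (Gluing Q o hd)) :
    IsOpen U ↔ ∀ X : QDFib Q B, IsOpen {p : X.P o d | glue hd X p ∈ U} := by
  rw [TopCat.colimit_isOpen_iff]
  constructor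
  · intro h X
    exact (h (Opposite.op X)).preimage continuous_uliftUp
  · intro h X
    exact (h X.unop).preimage continuous_uliftDown

variable (ho : ∀ e, B.G.edge (o e).1 (o e).2 = e)

/-- two points of polytopes come from an interior point of a common face -/
def Related (a b : Σ X : QDFib Q B, X.P o d) : Prop :=
  ∃ (Z : QDFib Q B) (z : Z.P o d) (f : a.1 ⟶ Z) (f' : b.1 ⟶ Z),
    Interior ho z ∧ mapP o hd f z = a.2 ∧ mapP o hd f' z = b.2

variable (hQ : ∀ {A A' : QD g n}, (A ⟶ A') → Q A → Q A')

-- Reflexivity is `exists_interior`. For transitivity, the two interior points representing the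
-- middle point are compared by `exists_factor_of_eq`.
include hQ in
lemma equivalence_related : Equivalence (Related hd ho (Q := Q)) where
  refl a := by
    obtain ⟨Z, z, f, hz, h⟩ := exists_interior ho hd hQ a.1 a.2
    exact ⟨Z, z, f, f, hz, h, h⟩
  symm := by
    rintro a b ⟨Z, z, f, f', hz, h, h'⟩
    exact ⟨Z, z, f', f, hz, h', h⟩
  trans := by
    rintro a b c ⟨Z, z, f, f', hz, h, h'⟩ ⟨W, w, k, k', hw, e, e'⟩
    obtain ⟨m, hm, hm'⟩ := exists_factor_of_eq ho hd hz f' k (e.trans h'.symm)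
    exact ⟨Z, z, f, k' ≫ m, hz, h, by rw [mapP_comp, hm', e']⟩

-- The quotient by `Related` receives a cocone from the polytopes, and the induced map from the
-- colimit separates unrelated points.
include hQ in
lemma related_of_glue_eq {p : X.P o d} {q : Y.P o d} (h : glue hd X p = glue hd Y q) :
    Related hd ho ⟨X, p⟩ ⟨Y, q⟩ := by
  let S : Setoid (Σ X : QDFib Q B, X.P o d) := ⟨_, equivalence_related hd ho hQ⟩
  -- With the indiscrete topology every map into the quotient is continuous.
  let _ : TopologicalSpace (Quotient S) := ⊤
  let c : Limits.Cocone (polytope (Q := Q) o hd) :=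
    { pt := TopCat.of (Quotient S)
      ι :=
        { app := fun X => TopCat.ofHom ⟨fun p => Quotient.mk S ⟨X.unop, p.down⟩, continuous_top⟩
          naturality := fun Y X f => by
            refine TopCat.hom_ext (ContinuousMap.ext fun p => Quotient.sound ?_)
            obtain ⟨Z, z, k, hz, hk⟩ := exists_interior ho hd hQ Y.unop p.down
            exact ⟨Z, z, f.unop ≫ k, k, hz, by rw [mapP_comp, hk]; rfl, hk⟩ } }
  have h1 : ∀ (X : QDFib Q B) (p : X.P o d),
      (Limits.colimit.desc _ c).hom (glue hd X p) = Quotient.mk S ⟨X, p⟩ := fun X p =>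
    congrArg (fun k => k.hom (ULift.up p)) (Limits.colimit.ι_desc c (Opposite.op X))
  have h2 := congrArg (Limits.colimit.desc _ c).hom h
  rw [h1, h1] at h2
  exact Quotient.exact h2

include hQ in
lemma exists_rep (j : Gluing Q o hd) :
    ∃ (Z : QDFib Q B) (z : Z.P o d), Interior ho z ∧ glue hd Z z = j := by
  obtain ⟨X, p, rfl⟩ := exists_glue hd j
  obtain ⟨Z, z, f, hz, h⟩ := exists_interior ho hd hQ X p
  exact ⟨Z, z, hz, by rw [← h, glue_mapP]⟩

/-- the object to whose polytope a point of the colimit belongs as an interior point -/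
noncomputable def rep (j : Gluing Q o hd) : QDFib Q B := (exists_rep hd ho hQ j).choose

/-- the interior point of a polytope that represents a point of the colimit -/
noncomputable def repPt (j : Gluing Q o hd) : (rep hd ho hQ j).P o d :=
  (exists_rep hd ho hQ j).choose_spec.choose

lemma repPt_interior (j : Gluing Q o hd) : Interior ho (repPt hd ho hQ j) :=
  (exists_rep hd ho hQ j).choose_spec.choose_spec.1

@[simp] lemma glue_repPt (j : Gluing Q o hd) : glue hd (rep hd ho hQ j) (repPt hd ho hQ j) = j :=
  (exists_rep hd ho hQ j).choose_spec.choose_spec.2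

/-- the lengths on the graph representing a point of the colimit -/
noncomputable abbrev repLens (j : Gluing Q o hd) : (rep hd ho hQ j).obj.G.X → ℝ :=
  lens ho (repPt hd ho hQ j)

/-- The point `p` and the chosen representative both come from an interior point `z` of some `Z`. As
the representative is itself interior, `exists_factor_of_eq`, applied to its identity, yields a
morphism from `Z` to it. -/
lemma exists_hom_rep {p : X.P o d} {j : Gluing Q o hd} (h : glue hd X p = j) :
    ∃ f : X ⟶ rep hd ho hQ j, mapP o hd f (repPt hd ho hQ j) = p := by
  obtain ⟨Z, z, f, f', hz, h1, h2⟩ := related_of_glue_eq hd ho hQ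
    (h.trans (glue_repPt hd ho hQ j).symm)
  obtain ⟨k, hk, hk'⟩ := exists_factor_of_eq ho hd (repPt_interior hd ho hQ j) (𝟙 _) f'
    (h2.trans (mapP_id o hd _ _).symm)
  exact ⟨f ≫ k, by rw [mapP_comp, hk', h1]⟩

/-- the morphism `f` sends the point `p` approximately to the point `j` -/
def Near (δ : ℝ) {j : Gluing Q o hd} (p : X.P o d) (f : X ⟶ rep hd ho hQ j) : Prop :=
  ∀ x, |lens ho p x - repLens hd ho hQ j ((gr f).f x)| < δ

lemma near_mapP {δ : ℝ} {j : Gluing Q o hd} {p : Y.P o d} {f : Y ⟶ rep hd ho hQ j}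
    (h : Near hd ho hQ δ p f) (k : X ⟶ Y) : Near hd ho hQ δ (mapP o hd k p) (k ≫ f) := by
  intro x
  rw [lens_mapP]
  exact h _

lemma near_of_comp {δ : ℝ} {j : Gluing Q o hd} {p : Y.P o d} {f : Y ⟶ rep hd ho hQ j} {k : X ⟶ Y}
    (h : Near hd ho hQ δ (mapP o hd k p) (k ≫ f)) : Near hd ho hQ δ p f := by
  intro y
  obtain ⟨x, rfl⟩ := (gr k).surjective y
  have h1 := h x
  rw [lens_mapP] at h1
  exact h1

/-- the points that are close to `j` -/
def star (j : Gluing Q o hd) (δ : ℝ) : Set (Gluing Q o hd) :=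
  {j' | ∃ f : rep hd ho hQ j' ⟶ rep hd ho hQ j, Near hd ho hQ δ (repPt hd ho hQ j') f}

lemma exists_near_of_mem_star {j : Gluing Q o hd} {δ : ℝ} {p : X.P o d}
    (h : glue hd X p ∈ star hd ho hQ j δ) : ∃ f : X ⟶ rep hd ho hQ j, Near hd ho hQ δ p f := by
  obtain ⟨f, hf⟩ := h
  obtain ⟨k, hk⟩ := exists_hom_rep hd ho hQ (rfl : glue hd X p = _)
  refine ⟨k ≫ f, ?_⟩
  have := near_mapP hd ho hQ hf k
  rwa [hk] at this

/-- Together with `exists_near_of_mem_star`, this allows membership in a star to be tested on any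
polytope. What is contracted on the way to the representative of the point has length zero, so its
image under `f` has length below `δ` and is contracted as well; hence `f` factors through that
representative. -/
lemma mem_star_of_near {j : Gluing Q o hd} {δ : ℝ}
    (hδ : ∀ x, (rep hd ho hQ j).obj.G.i x ≠ x → δ ≤ repLens hd ho hQ j x) {p : X.P o d}
    {f : X ⟶ rep hd ho hQ j} (h : Near hd ho hQ δ p f) :
    glue hd X p ∈ star hd ho hQ j δ := by
  obtain ⟨k, hk⟩ := exists_hom_rep hd ho hQ (rfl : glue hd X p = _)
  obtain ⟨m, hm⟩ := exists_factor_of_near ho hd hδ f h k hk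
  refine ⟨m, ?_⟩
  rw [← hk, ← hm] at h
  exact near_of_comp hd ho hQ h

omit hQ in
include ho in
lemma isOpen_near (u : X.obj.G.X → ℝ) (δ : ℝ) :
    IsOpen {p : X.P o d | ∀ x, |lens ho p x - u x| < δ} := by
  rw [Set.ofPred_forall]
  refine isOpen_iInter_of_finite fun x => ?_
  exact isOpen_lt ((continuous_lens ho x).sub continuous_const).abs continuous_const

omit hQ in
include ho in
lemma exists_near_subset {U : Set (X.P o d)} (hU : IsOpen U) {p₀ : X.P o d} (h : p₀ ∈ U) :
    ∃ δ > 0, ∀ p, (∀ x, |lens ho p x - lens ho p₀ x| < δ) → p ∈ U := by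
  obtain ⟨V, hV, rfl⟩ := (isInducing_lens ho).isOpen_iff.1 hU
  obtain ⟨δ, hδ, hV⟩ := Metric.isOpen_iff.1 hV _ h
  refine ⟨δ, hδ, fun p hp => hV ?_⟩
  rw [Metric.mem_ball, dist_pi_lt_iff hδ]
  exact hp

/-- In each polytope the star is the union, over all contractions to the representative of `j`, of
the sets cut out by strict inequalities between lengths. -/
lemma isOpen_star {j : Gluing Q o hd} {δ : ℝ}
    (hδ : ∀ x, (rep hd ho hQ j).obj.G.i x ≠ x → δ ≤ repLens hd ho hQ j x) :
    IsOpen (star hd ho hQ j δ) := by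
  rw [isOpen_gluing_iff]
  intro X
  have : {p : X.P o d | glue hd X p ∈ star hd ho hQ j δ}
      = ⋃ f : X ⟶ rep hd ho hQ j, {p | Near hd ho hQ δ p f} := by
    ext p
    simp only [Set.mem_ofPred_eq, Set.mem_iUnion]
    exact ⟨exists_near_of_mem_star hd ho hQ, fun ⟨f, hf⟩ => mem_star_of_near hd ho hQ hδ hf⟩
  rw [this]
  exact isOpen_iUnion fun f => isOpen_near ho _ δ

lemma mem_star_self (j : Gluing Q o hd) {δ : ℝ} (hδ : 0 < δ) : j ∈ star hd ho hQ j δ :=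
  ⟨𝟙 _, fun x => by
    rw [show (gr (𝟙 (rep hd ho hQ j))).f x = x from rfl, sub_self, abs_zero]; exact hδ⟩

lemma eventually_le_repLens (j : Gluing Q o hd) :
    ∀ᶠ δ in 𝓝[>] (0 : ℝ), ∀ x, (rep hd ho hQ j).obj.G.i x ≠ x → δ ≤ repLens hd ho hQ j x := by
  refine Filter.eventually_all.2 fun x => ?_
  by_cases hx : (rep hd ho hQ j).obj.G.i x = x
  · exact Filter.Eventually.of_forall fun δ h => absurd hx h
  · filter_upwards [Ioo_mem_nhdsGT (repPt_interior hd ho hQ j x hx)] with δ hδ _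
    exact hδ.2.le

/-- `isOpen_star` needs a radius below all lengths of the representative; a larger star contains
such a smaller one. -/
lemma star_mem_nhds (j : Gluing Q o hd) {δ : ℝ} (hδ : 0 < δ) : star hd ho hQ j δ ∈ 𝓝 j := by
  obtain ⟨δ', h1, h2, h3⟩ := ((eventually_le_repLens hd ho hQ j).and
    (Ioo_mem_nhdsGT hδ)).exists
  refine Filter.mem_of_superset ((isOpen_star hd ho hQ h1).mem_nhds
    (mem_star_self hd ho hQ j h2)) ?_
  rintro j' ⟨f, hf⟩
  exact ⟨f, fun x => (hf x).trans h3⟩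

/-- the pattern of a morphism: the exceptional edges, and the contracted edges -/
def pattern (o : B.G.E → B.G.H) (f : X ⟶ Y) : B.G.E → Prop × Prop :=
  fun e => (X.IsExc o e, Hom.Contr o f e)

omit hQ in
include ho in
lemma exists_hom_of_pattern_eq {f : X ⟶ Y} {f' : X' ⟶ Y} (h : pattern o f = pattern o f') :
    ∃ k : X ⟶ X', k ≫ f' = f :=
  exists_hom_over ho f f' (fun e => Iff.of_eq (congrArg Prod.fst (congrFun h e)))
    (fun e => Iff.of_eq (congrArg Prod.snd (congrFun h e)))

/-- Every neighbourhood of `j` contains all points close to `j`, uniformly in the polytope. There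
are only finitely many patterns, and an object `X` receives a morphism over the representative of
`j` from one fixed object `W` with the same pattern. Pulling the point back to the polytope of `W`
shows that one radius per pattern is enough. -/
lemma exists_near_mem (j : Gluing Q o hd) {U : Set (Gluing Q o hd)} (hU : IsOpen U) (hj : j ∈ U) :
    ∃ δ > 0, ∀ (X : QDFib Q B) (p : X.P o d) (f : X ⟶ rep hd ho hQ j),
      Near hd ho hQ δ p f → glue hd X p ∈ U := by
  have h : ∀ s : B.G.E → Prop × Prop, ∀ᶠ δ in 𝓝[>] (0 : ℝ), ∀ (X : QDFib Q B) (p : X.P o d)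
      (f : X ⟶ rep hd ho hQ j), pattern o f = s → Near hd ho hQ δ p f → glue hd X p ∈ U := by
    intro s
    by_cases hs : ∃ (W : QDFib Q B) (k : W ⟶ rep hd ho hQ j), pattern o k = s
    · obtain ⟨W, k, rfl⟩ := hs
      obtain ⟨δ, hδ, h⟩ := exists_near_subset ho ((isOpen_gluing_iff hd U).1 hU W)
        (p₀ := mapP o hd k (repPt hd ho hQ j))
        (by rw [Set.mem_ofPred_eq, glue_mapP, glue_repPt]; exact hj)
      filter_upwards [Ioo_mem_nhdsGT hδ] with δ' hδ' X p f hf hp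
      obtain ⟨m, hm⟩ := exists_hom_of_pattern_eq ho hf.symm
      have h1 := near_mapP hd ho hQ hp m
      have h2 := h (mapP o hd m p) (fun x => by
        rw [lens_mapP ho hd k, ← hm]
        exact (h1 x).trans hδ'.2)
      rwa [Set.mem_ofPred_eq, glue_mapP] at h2
    · exact Filter.Eventually.of_forall fun δ X p f hf _ => absurd ⟨X, f, hf⟩ hs
  obtain ⟨δ, h1, h2⟩ := ((Filter.eventually_all.2 h).and self_mem_nhdsWithin).exists
  exact ⟨δ, h2, fun X p f hf => h1 _ X p f rfl hf⟩

omit hd hQ in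
include ho in
lemma finite_hom (X Y : QDFib Q B) : Finite (X ⟶ Y) :=
  Finite.of_injective (fun (f : X ⟶ Y) (e : B.G.E) => Hom.Contr o f e) fun _ _ h =>
    hom_ext_contr ho fun e => Iff.of_eq (congrFun h e)

include ho hQ in
/-- the maps from the polytopes to the colimit are closed -/
lemma isClosedMap_glue (X : QDFib Q B) : IsClosedMap (glue hd X : X.P o d → _) := by
  intro K hK
  rw [← isOpen_compl_iff, isOpen_iff_mem_nhds]
  intro j hj
  have hfin := finite_hom ho X (rep hd ho hQ j)
  -- The points of the polytope of `X` over `j` correspond to the finitely many contractions `f`.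
  -- Each of them lies outside `K`, and so do the points close to it.
  have h : ∀ f : X ⟶ rep hd ho hQ j, ∀ᶠ δ in 𝓝[>] (0 : ℝ), ∀ p, Near hd ho hQ δ p f → p ∉ K := by
    intro f
    have hf : mapP o hd f (repPt hd ho hQ j) ∈ Kᶜ := fun hf =>
      hj ⟨_, hf, by rw [glue_mapP, glue_repPt]⟩
    obtain ⟨δ, hδ, h⟩ := exists_near_subset ho hK.isOpen_compl hf
    filter_upwards [Ioo_mem_nhdsGT hδ] with δ' hδ' p hp
    refine h p fun x => ?_
    rw [lens_mapP ho hd f]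
    exact (hp x).trans hδ'.2
  obtain ⟨δ, h1, h2⟩ := ((Filter.eventually_all.2 h).and self_mem_nhdsWithin).exists
  refine Filter.mem_of_superset (star_mem_nhds hd ho hQ j h2) ?_
  rintro _ hs ⟨p, hp, rfl⟩
  obtain ⟨f, hf⟩ := exists_near_of_mem_star hd ho hQ hs
  exact h1 f p hf hp

-- The factor 4 leaves room for the triangle inequality in `eventually_toRep`, where three errors of
-- size at most the gap add up.
include hd in
omit ho hQ in
lemma exists_gap : ∃ ε > 0, ∀ e, 4 * ε ≤ d e := by
  have h : ∀ e, ∀ᶠ ε in 𝓝[>] (0 : ℝ), 4 * ε ≤ d e := by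
    intro e
    filter_upwards [Ioo_mem_nhdsGT (show 0 < d e / 4 by have := hd e; linarith)] with ε hε
    have := hε.2
    linarith
  obtain ⟨ε, h1, h2⟩ := ((Filter.eventually_all.2 h).and self_mem_nhdsWithin).exists
  exact ⟨ε, h2, h1⟩

/-- a positive number that is small compared to all edge lengths -/
noncomputable def gap : ℝ := (exists_gap hd).choose

lemma gap_pos : 0 < gap hd := (exists_gap hd).choose_spec.1

lemma gap_le (e : B.G.E) : 4 * gap hd ≤ d e := (exists_gap hd).choose_spec.2 e

end QDFib

end Trop

/-! ### The universal family over the colimit -/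

namespace Trop

open CategoryTheory Topology

namespace QDFib

variable {g n : ℕ} {Q : ObjectProperty (QD g n)} {B : SG g n} {X Y Z X' : QDFib Q B}
  {o : B.G.E → B.G.H} {d : B.G.E → ℝ}

/-- forgetting the identification of the stabilization -/
def toFull : QDFib Q B ⥤ Q.FullSubcategory where
  obj X := ⟨X.obj, X.prop⟩
  map f := ObjectProperty.homMk (Hom.π f)

variable (hd : ∀ e, 0 < d e) (ho : ∀ e, B.G.edge (o e).1 (o e).2 = e)

omit hd in
lemma edgeLen_pos {q : Y.P o d} (h : Interior ho q) (e : Y.obj.G.E) : 0 < Y.edgeLen ho q e := by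
  induction e using MGraph.edge_ind with | H x hx =>
  have h1 := h x hx
  unfold lens at h1
  rwa [MGraph.len_half _ hx] at h1

omit hd in
lemma edgeLen_edge (q : Y.P o d) {x : Y.obj.G.X} (hx : Y.obj.G.i x ≠ x) :
    Y.edgeLen ho q (Y.obj.G.edge x hx) = lens ho q x :=
  (MGraph.len_half _ hx).symm

variable (hQ : ∀ {A A' : QD g n}, (A ⟶ A') → Q A → Q A')

open scoped Classical in
/-- the specialization maps of the family over the colimit -/
noncomputable def specialize (j₀ j : Gluing Q o hd) :
    Option (rep hd ho hQ j ⟶ rep hd ho hQ j₀) :=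
  if h : ∃ f : rep hd ho hQ j ⟶ rep hd ho hQ j₀, Near hd ho hQ (gap hd) (repPt hd ho hQ j) f
  then some h.choose else none

/-- The lengths induced by the two morphisms differ by less than twice the gap, hence by less than
every `d e`, and `eq_of_near` applies. So the choice made in `specialize` is forced. -/
lemma near_unique {j : Gluing Q o hd} {p : X.P o d} {f f' : X ⟶ rep hd ho hQ j}
    (h : Near hd ho hQ (gap hd) p f) (h' : Near hd ho hQ (gap hd) p f') : f = f' := by
  refine eq_of_near ho (q := repPt hd ho hQ j) fun e x => ?_
  have h1 := abs_lt.1 (h x)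
  have h2 := abs_lt.1 (h' x)
  have h3 := gap_le hd e
  have h4 := gap_pos hd
  rw [abs_lt]
  constructor <;> linarith [h1.1, h1.2, h2.1, h2.2]

lemma specialize_eq {j₀ j : Gluing Q o hd} {f : rep hd ho hQ j ⟶ rep hd ho hQ j₀}
    (h : Near hd ho hQ (gap hd) (repPt hd ho hQ j) f) : specialize hd ho hQ j₀ j = some f := by
  have hex : ∃ f : rep hd ho hQ j ⟶ rep hd ho hQ j₀,
    Near hd ho hQ (gap hd) (repPt hd ho hQ j) f := ⟨f, h⟩
  rw [specialize, dif_pos hex]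
  exact congrArg some (near_unique hd ho hQ hex.choose_spec h)

/-- a point of the colimit, as a point of the realization -/
noncomputable def toPt (j : Gluing Q o hd) : Pt (Q.ι ⋙ QD.forget) :=
  ⟨toFull.obj (rep hd ho hQ j), edgeLen ho (repPt hd ho hQ j),
    edgeLen_pos ho (repPt_interior hd ho hQ j)⟩

section chart

variable {j₀ : Gluing Q o hd} (f : X ⟶ rep hd ho hQ j₀)

/-- the points of the polytope of `X` that are close to the face given by `f` -/
def box : Set (X.P o d) :=
  {p | ∀ x, |lens ho p x - repLens hd ho hQ j₀ ((gr f).f x)| ≤ gap hd}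

lemma isClosed_box : IsClosed (box hd ho hQ f) := by
  unfold box
  rw [Set.ofPred_forall]
  refine isClosed_iInter fun x => ?_
  exact isClosed_le ((continuous_lens ho x).sub continuous_const).abs continuous_const

/-- a section over the image of the box -/
noncomputable def boxSection (t : glue hd X '' box hd ho hQ f) : X.P o d := t.2.choose

lemma boxSection_mem (t : glue hd X '' box hd ho hQ f) : boxSection hd ho hQ f t ∈ box hd ho hQ f :=
  t.2.choose_spec.1

lemma glue_boxSection (t : glue hd X '' box hd ho hQ f) : glue hd X (boxSection hd ho hQ f t) = t.1 :=
  t.2.choose_spec.2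

/-- the contraction to the graph that represents a point of the image of the box -/
noncomputable def toRep (t : glue hd X '' box hd ho hQ f) : X ⟶ rep hd ho hQ t.1 :=
  (exists_hom_rep hd ho hQ (glue_boxSection hd ho hQ f t)).choose

lemma mapP_toRep (t : glue hd X '' box hd ho hQ f) :
    mapP o hd (toRep hd ho hQ f t) (repPt hd ho hQ t.1) = boxSection hd ho hQ f t :=
  (exists_hom_rep hd ho hQ (glue_boxSection hd ho hQ f t)).choose_spec

lemma lens_toRep (t : glue hd X '' box hd ho hQ f) (x : X.obj.G.X) :
    repLens hd ho hQ t.1 ((gr (toRep hd ho hQ f t)).f x)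
      = lens ho (boxSection hd ho hQ f t) x := by
  rw [← mapP_toRep hd ho hQ f t, lens_mapP]

/-- Both sections lie in the box, within the gap of the same lengths, and `κ` changes lengths by
less than the gap. So the two morphisms to the representative of `t₀` induce lengths differing by
less than three gaps, and they agree by `eq_of_near`. The box is what excludes ambiguity here, since
`glue` may identify different faces of one polytope. -/
lemma eventually_toRep (t₀ : glue hd X '' box hd ho hQ f) {δ : ℝ} (hδ : 0 < δ) :
    ∀ᶠ t in 𝓝 t₀, ∃ κ : rep hd ho hQ t.1 ⟶ rep hd ho hQ t₀.1,
      Near hd ho hQ δ (repPt hd ho hQ t.1) κ ∧ Near hd ho hQ (gap hd) (repPt hd ho hQ t.1) κ ∧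
      toRep hd ho hQ f t ≫ κ = toRep hd ho hQ f t₀ := by
  have h := continuous_subtype_val.continuousAt (x := t₀)
    (star_mem_nhds hd ho hQ t₀.1 (lt_min hδ (gap_pos hd)))
  filter_upwards [h] with t ⟨κ, hκ⟩
  refine ⟨κ, fun x => (hκ x).trans_le (min_le_left _ _),
    fun x => (hκ x).trans_le (min_le_right _ _), ?_⟩
  refine eq_of_near ho (q := repPt hd ho hQ t₀.1) fun e x => ?_
  have h1 := abs_lt.1 ((hκ ((gr (toRep hd ho hQ f t)).f x)).trans_le (min_le_right _ _))
  have h2 := abs_le.1 (boxSection_mem hd ho hQ f t x)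
  have h3 := abs_le.1 (boxSection_mem hd ho hQ f t₀ x)
  have e1 := lens_toRep hd ho hQ f t x
  have e2 := lens_toRep hd ho hQ f t₀ x
  have h4 := gap_le hd e
  have h5 := gap_pos hd
  have e3 : (gr (toRep hd ho hQ f t ≫ κ)).f x = (gr κ).f ((gr (toRep hd ho hQ f t)).f x) := rfl
  unfold repLens at e1 e2 h2 h3
  rw [e1] at h1
  rw [e3, e2, abs_lt]
  constructor <;> linarith [h1.1, h1.2, h2.1, h2.2, h3.1, h3.2]

/-- The section was chosen pointwise and is nevertheless continuous. Its lengths are those of the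
representatives, pulled back along `toRep`. Because `toRep` is compatible with specialization, the
length of one and the same edge of `X` is compared at `t` and at `t₀`, and `κ` changes it by less
than `δ`. -/
lemma continuous_boxSection :
    Continuous fun t => edgeLen ho (boxSection hd ho hQ f t) := by
  refine continuous_pi fun e => continuous_iff_continuousAt.2 fun t₀ => ?_
  induction e using MGraph.edge_ind with | H x hx =>
  simp only [ContinuousAt, edgeLen_edge ho _ hx]
  rw [Metric.tendsto_nhds]
  intro δ hδ
  filter_upwards [eventually_toRep hd ho hQ f t₀ hδ] with t ⟨κ, h1, _, h2⟩
  have h3 := h1 ((gr (toRep hd ho hQ f t)).f x)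
  have e3 : (gr (toRep hd ho hQ f t ≫ κ)).f x = (gr κ).f ((gr (toRep hd ho hQ f t)).f x) := rfl
  rw [← e3, h2, lens_toRep] at h3
  rw [Real.dist_eq, ← lens_toRep]
  exact h3

/-- the chart on the image of the box -/
noncomputable def chart (N : Set (Gluing Q o hd)) :
    Chart (Q.ι ⋙ QD.forget) (Z := (glue hd X '' box hd ho hQ f ∩ N : Set (Gluing Q o hd)))
      (fun t => toPt hd ho hQ t.1)
      (fun t₀ t => (specialize hd ho hQ t₀.1 t.1).map fun κ => toFull.map κ) where
  x := toFull.obj X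
  l t := edgeLen ho (boxSection hd ho hQ f ⟨t.1, t.2.1⟩)
  cont := (continuous_boxSection hd ho hQ f).comp
    (continuous_subtype_val.subtype_mk fun t => t.2.1)
  π t := toFull.map (toRep hd ho hQ f ⟨t.1, t.2.1⟩)
  compat t := by
    have h := compat_edgeLen ho hd (toRep hd ho hQ f ⟨t.1, t.2.1⟩) (repPt hd ho hQ t.1)
    have e := mapP_toRep hd ho hQ f ⟨t.1, t.2.1⟩
    dsimp only at e
    rw [e] at h
    exact h
  spec t₀ := by
    have hc : Continuous fun t : (glue hd X '' box hd ho hQ f ∩ N : Set (Gluing Q o hd)) =>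
        (⟨t.1, t.2.1⟩ : glue hd X '' box hd ho hQ f) :=
      continuous_subtype_val.subtype_mk fun t => t.2.1
    have h := hc.continuousAt.eventually
      (eventually_toRep hd ho hQ f ⟨t₀.1, t₀.2.1⟩ (gap_pos hd))
    filter_upwards [h] with t ⟨κ, h1, _, h2⟩
    refine ⟨toFull.map κ, ?_, ?_⟩
    · rw [specialize_eq hd ho hQ h1]; rfl
    · exact (toFull.map_comp _ _).symm.trans (congrArg toFull.map h2)

end chart

/-- One contraction to the representative of `j₀` is chosen for each of the finitely many patterns
that occur. The images of the boxes are closed because `glue` is a closed map. They cover a star of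
radius below the gap: a nearby point has a contraction with one of these patterns, so it can be
pulled back into the box of the chosen object. -/
lemma exists_charts (j₀ : Gluing Q o hd) :
    ∃ N : Set (Gluing Q o hd), IsOpen N ∧ j₀ ∈ N ∧ ∃ (k : ℕ) (F : Fin k → Set (Gluing Q o hd)),
      (∀ i, IsClosed (F i)) ∧ N ⊆ ⋃ i, F i ∧
      ∀ i, Nonempty (Chart (Q.ι ⋙ QD.forget) (Z := (F i ∩ N : Set (Gluing Q o hd)))
        (fun t => toPt hd ho hQ t.1)
        (fun t₀ t => (specialize hd ho hQ t₀.1 t.1).map fun κ => toFull.map κ)) := by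
  obtain ⟨δ, h1, h2, h3⟩ := ((eventually_le_repLens hd ho hQ j₀).and
    (Ioo_mem_nhdsGT (gap_pos hd))).exists
  let S := {s : B.G.E → Prop × Prop //
    ∃ (X : QDFib Q B) (f : X ⟶ rep hd ho hQ j₀), pattern o f = s}
  obtain ⟨k, ⟨e⟩⟩ := Finite.exists_equiv_fin S
  let X : S → QDFib Q B := fun s => s.2.choose
  let f : ∀ s : S, X s ⟶ rep hd ho hQ j₀ := fun s => s.2.choose_spec.choose
  have hf : ∀ s, pattern o (f s) = s.1 := fun s => s.2.choose_spec.choose_spec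
  refine ⟨star hd ho hQ j₀ δ, isOpen_star hd ho hQ h1, mem_star_self hd ho hQ j₀ h2, k,
    fun i => glue hd (X (e.symm i)) '' box hd ho hQ (f (e.symm i)),
    fun i => isClosedMap_glue hd ho hQ _ _ (isClosed_box hd ho hQ _), ?_,
    fun i => ⟨chart hd ho hQ (f (e.symm i)) _⟩⟩
  rintro j ⟨m, hm⟩
  let s : S := ⟨pattern o m, _, m, rfl⟩
  obtain ⟨k, hk⟩ := exists_hom_of_pattern_eq ho (hf s)
  refine Set.mem_iUnion.2 ⟨e s, ?_⟩
  rw [e.symm_apply_apply]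
  refine ⟨mapP o hd k (repPt hd ho hQ j), fun x => ?_, by rw [glue_mapP, glue_repPt]⟩
  have h4 := near_mapP hd ho hQ hm k x
  rw [hk] at h4
  exact (h4.trans h3).le

/-- the universal family over the colimit -/
noncomputable def family : Fam (Q.ι ⋙ QD.forget) (Gluing Q o hd) where
  pt := toPt hd ho hQ
  sp j₀ j := (specialize hd ho hQ j₀ j).map fun κ => toFull.map κ
  charts := exists_charts hd ho hQ

end QDFib

end Trop

/-! ### Pull-back of families, and isomorphisms in the realization -/

namespace Trop

open CategoryTheory Topology

universe u v

variable {n : ℕ} {C : Type u} [Category.{v} C] {U : C ⥤ MGraph n}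

namespace Fam

/-- pull-back of a family along a continuous map -/
def pullback {S T : TopCat.{1}} (A : Fam U T) (b : S ⟶ T) : Fam U S where
  pt s := A.pt (b s)
  sp s₀ s := A.sp (b s₀) (b s)
  charts s₀ := by
    obtain ⟨N, hN, hN₀, k, F, hF, hNF, hc⟩ := A.charts (b s₀)
    have hb := b.hom.continuous
    refine ⟨b ⁻¹' N, hN.preimage hb, hN₀, k, fun j => b ⁻¹' F j, fun j => (hF j).preimage hb,
      fun s hs => ?_, fun j => ?_⟩
    · obtain ⟨j, hj⟩ := Set.mem_iUnion.1 (hNF hs)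
      exact Set.mem_iUnion.2 ⟨j, hj⟩
    · obtain ⟨c⟩ := hc j
      have hr : Continuous fun s : (b ⁻¹' F j ∩ b ⁻¹' N : Set S) =>
          (⟨b s.1, s.2⟩ : (F j ∩ N : Set T)) :=
        (hb.comp continuous_subtype_val).subtype_mk _
      exact ⟨{  x := c.x
                l := fun s => c.l ⟨b s.1, s.2⟩
                cont := c.cont.comp hr
                π := fun s => c.π ⟨b s.1, s.2⟩
                compat := fun s => c.compat ⟨b s.1, s.2⟩
                spec := fun s₀ => hr.continuousAt.eventually (c.spec ⟨b s₀.1, s₀.2⟩) }⟩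

variable {T : TopCat.{1}} (A : Fam U T)

lemma sp_congr {t₀ t t₀' t' : T} (h₀ : t₀ = t₀') (h : t = t') {κ} (hκ : A.sp t₀ t = some κ) :
    A.sp t₀' t' = some (eqToHom (by rw [h]) ≫ κ ≫ eqToHom (by rw [h₀])) := by
  subst h₀ h
  rw [hκ, eqToHom_refl, eqToHom_refl, Category.id_comp, Category.comp_id]

omit A in
lemma eqToIso_conj {x x' y y' : C} (h : x = y) (h' : x' = y') (κ : x ⟶ x') :
    κ ≫ (eqToIso h').hom = (eqToIso h).hom ≫ eqToHom h.symm ≫ κ ≫ eqToHom h' := by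
  subst h h'
  simp

lemma compat_eqToHom {t t' : T} (h : t = t') (h' : (A.pt t).x = (A.pt t').x) :
    (U.map (eqToHom h')).Compat (A.pt t).d (A.pt t').d := by
  subst h
  exact Realization.compat_id _

/-- On a closed piece with a chart, all curves are contractions of one graph whose lengths vary
continuously. These contractions are surjective and compatible with specialization, so closeness of
lengths passes to the curves. Only finitely many pieces occur, and those not containing `t₀` stay
away from a neighbourhood of it. -/
lemma eventually_near (t₀ : T) {δ : ℝ} (hδ : 0 < δ) :
    ∀ᶠ t in 𝓝 t₀, ∃ κ, A.sp t₀ t = some κ ∧ ∀ y, |(U.obj (A.pt t).x).len (A.pt t).d y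
      - (U.obj (A.pt t₀).x).len (A.pt t₀).d ((U.map κ).f y)| < δ := by
  obtain ⟨N, hN, hN₀, k, F, hF, hNF, hc⟩ := A.charts t₀
  have h : ∀ j, ∀ᶠ t in 𝓝 t₀, t ∈ F j ∩ N → ∃ κ, A.sp t₀ t = some κ ∧
      ∀ y, |(U.obj (A.pt t).x).len (A.pt t).d y
      - (U.obj (A.pt t₀).x).len (A.pt t₀).d ((U.map κ).f y)| < δ := by
    intro j
    by_cases hj : t₀ ∈ F j
    · obtain ⟨c⟩ := hc j
      have hl : ∀ z, Continuous fun t => (U.obj c.x).len (c.l t) z := by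
        intro z
        unfold MGraph.len
        split
        · exact (continuous_apply _).comp c.cont
        · exact continuous_const
      have h0 : ∀ᶠ t in 𝓝 (⟨t₀, hj, hN₀⟩ : (F j ∩ N : Set T)), ∀ z,
          |(U.obj c.x).len (c.l t) z - (U.obj c.x).len (c.l ⟨t₀, hj, hN₀⟩) z| < δ := by
        have := (U.obj c.x).finite_X
        exact Filter.eventually_all.2 fun z =>
          Metric.tendsto_nhds.1 (hl z).continuousAt δ hδ
      have h1 := Filter.eventually_comap.1 (nhds_subtype_eq_comap (X := T) (p := fun t =>
        t ∈ F j ∩ N) ▸ (c.spec ⟨t₀, hj, hN₀⟩).and h0)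
      filter_upwards [h1] with t ht htF
      obtain ⟨⟨κ, hκ, hκ'⟩, h2⟩ := ht ⟨t, htF⟩ rfl
      refine ⟨κ, hκ, fun y => ?_⟩
      obtain ⟨z, rfl⟩ := MGraph.Hom.surjective (U.map (c.π ⟨t, htF⟩)) y
      have e1 : (U.map κ).f ((U.map (c.π ⟨t, htF⟩)).f z) = (U.map (c.π ⟨t₀, hj, hN₀⟩)).f z := by
        rw [← hκ', U.map_comp]; rfl
      have e2 := c.compat ⟨t, htF⟩ z
      have e3 := c.compat ⟨t₀, hj, hN₀⟩ z
      dsimp only at e2 e3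
      rw [e1, ← e2, ← e3]
      exact h2 z
    · filter_upwards [(hF j).isOpen_compl.mem_nhds hj] with t ht htF
      exact absurd htF.1 ht
  filter_upwards [Filter.eventually_all.2 h, hN.mem_nhds hN₀] with t ht htN
  obtain ⟨j, hj⟩ := Set.mem_iUnion.1 (hNF htN)
  exact ht j ⟨hj, htN⟩

omit A in
lemma hom_left {S S' : Over T} (f : S ⟶ S') (s : S.left) : S.hom s = S'.hom (f.left s) :=
  (congrArg (fun k => k.hom s) (Over.w f)).symm

lemma pt_hom_left {S S' : Over T} (f : S ⟶ S') (s : S.left) :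
    (A.pt (S.hom s)).x = (A.pt (S'.hom (f.left s))).x :=
  congrArg (fun t => (A.pt t).x) (hom_left f s)

/-- the morphism from the stack represented by the base of a family to the realization -/
def classify : Over T ⥤ Realization U where
  obj S := ⟨S.left, A.pullback S.hom⟩
  map {S S'} f :=
    { base := f.left
      φ := fun s => eqToIso (A.pt_hom_left f s)
      isom := fun s => A.compat_eqToHom (hom_left f s) (A.pt_hom_left f s)
      germ := fun s₀ => by
        filter_upwards [(A.pullback S.hom).eventually_sp s₀] with s ⟨κ, hκ⟩
        exact ⟨κ, _, hκ, A.sp_congr (hom_left f s₀) (hom_left f s) hκ, eqToIso_conj _ _ _⟩ }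
  map_id S := Realization.Hom.ext' rfl fun _ => HEq.rfl
  map_comp f f' := Realization.Hom.ext' rfl fun s => heq_of_eq
    (eqToHom_trans (A.pt_hom_left f s) (A.pt_hom_left f' (f.left s))).symm

end Fam

namespace Realization

variable {A B : Realization U}

lemma Hom.heq_φ {f f' : A ⟶ B} (h : f = f') (t : A.T) :
    HEq (Hom.φ f t).hom (Hom.φ f' t).hom := by
  subst h; rfl

lemma Hom.hom_eqToHom_inv (f : A ⟶ B) {s s' : A.T} (h : s = s')
    (h' : (B.fam.pt (Hom.base f s)).x = (B.fam.pt (Hom.base f s')).x) :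
    HEq ((Hom.φ f s).hom ≫ eqToHom h' ≫ (Hom.φ f s').inv) (𝟙 (A.fam.pt s).x) := by
  subst h
  rw [eqToHom_refl, Category.id_comp, Iso.hom_inv_id]

/-- the inverse of a morphism over an isomorphism -/
noncomputable def Hom.inv (f : A ⟶ B) [IsIso (Hom.base f)] : B ⟶ A where
  base := CategoryTheory.inv (Hom.base f)
  -- Applying the inverse of the base map and then the base map returns `t` only up to a
  -- propositional equality, so the curve at `t` has to be transported.
  φ t := eqToIso (congrArg (fun t => (B.fam.pt t).x)
    (congrArg (fun k => k.hom t) (IsIso.inv_hom_id (Hom.base f))).symm) ≪≫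
      (Hom.φ f (CategoryTheory.inv (Hom.base f) t)).symm
  isom t := by
    have hb : t = Hom.base f (CategoryTheory.inv (Hom.base f) t) :=
      (congrArg (fun k => k.hom t) (IsIso.inv_hom_id (Hom.base f))).symm
    refine compat_comp (B.fam.compat_eqToHom hb (congrArg (fun t => (B.fam.pt t).x) hb)) ?_
    have h := Hom.isom f (CategoryTheory.inv (Hom.base f) t)
    intro x
    have h1 := h ((U.map (Hom.φ f (CategoryTheory.inv (Hom.base f) t)).inv).f x)
    refine Eq.trans ?_ h1.symm
    congr 1
    exact congrFun (congrArg MGraph.Hom.f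
      (((U.map_comp _ _).symm.trans (congrArg U.map
        (Hom.φ f (CategoryTheory.inv (Hom.base f) t)).inv_hom_id)).trans (U.map_id _))).symm x
  germ t₀ := by
    have hv := (CategoryTheory.inv (Hom.base f)).hom.continuous.continuousAt (x := t₀)
    have hb : ∀ t, Hom.base f (CategoryTheory.inv (Hom.base f) t) = t := fun t =>
      congrArg (fun k => k.hom t) (IsIso.inv_hom_id (Hom.base f))
    filter_upwards [hv.eventually (Hom.germ f (CategoryTheory.inv (Hom.base f) t₀))] with t
      ⟨κ, κ', h1, h2, h3⟩
    refine ⟨_, κ, B.fam.sp_congr (hb t₀) (hb t) h2, h1, ?_⟩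
    have h4 : κ' ≫ (Hom.φ f (CategoryTheory.inv (Hom.base f) t₀)).inv
        = (Hom.φ f (CategoryTheory.inv (Hom.base f) t)).inv ≫ κ := by
      rw [Iso.comp_inv_eq, Category.assoc, h3, Iso.inv_hom_id_assoc]
    simp [h4]

/-- The isomorphisms of curves are invertible at each point by definition, so only the base can
obstruct invertibility, as in a category fibred in groupoids. -/
lemma isIso_of_base (f : A ⟶ B) [IsIso (Hom.base f)] : IsIso f := by
  refine ⟨Hom.inv f, Hom.ext' (IsIso.hom_inv_id (Hom.base f)) fun t => ?_,
    Hom.ext' (IsIso.inv_hom_id (Hom.base f)) fun t => ?_⟩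
  · have h : t = CategoryTheory.inv (Hom.base f) (Hom.base f t) :=
      (congrArg (fun k => k.hom t) (IsIso.hom_inv_id (Hom.base f))).symm
    exact Hom.hom_eqToHom_inv f h (congrArg (fun t => (B.fam.pt (Hom.base f t)).x) h)
  · refine (heq_of_eq ((Category.assoc _ _ _).trans ((congrArg _
      (Hom.φ f (CategoryTheory.inv (Hom.base f) t)).inv_hom_id).trans
        (Category.comp_id _)))).trans ?_
    have h : t = Hom.base f (CategoryTheory.inv (Hom.base f) t) :=
      (congrArg (fun k => k.hom t) (IsIso.inv_hom_id (Hom.base f))).symm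
    exact eqToHom_heq_id_dom _ _ (congrArg (fun t => (B.fam.pt t).x) h)

end Realization

end Trop

/-! ### The comparison functor is an equivalence -/

namespace Trop

open CategoryTheory Topology

namespace QDFib

variable {g n : ℕ} {Q : ObjectProperty (QD g n)} {Γ : StableCurve g n}
  {o : Γ.x.G.E → Γ.x.G.H} (ho : ∀ e, Γ.x.G.edge (o e).1 (o e).2 = e)
  (hQ : ∀ {A A' : QD g n}, (A ⟶ A') → Q A → Q A')

/-- the curve that corresponds to a point of the Jacobian has stabilization `Γ` -/
noncomputable def squareApp (S : Over (Jac Q Γ o)) :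
    (Realization.point Γ).obj ((Over.map (TopCat.isTerminalPUnit.from (Jac Q Γ o))).obj S) ⟶
      (Phi Q).obj ((family Γ.pos ho hQ).classify.obj S) :=
  Realization.Hom.mk (𝟙 S.left) (fun s => (rep Γ.pos ho hQ (S.hom s)).ρ)
    (fun s => adapted_edgeLen ho (repPt Γ.pos ho hQ (S.hom s)))
    (fun s₀ => by
      filter_upwards [((family Γ.pos ho hQ).pullback S.hom).eventually_sp s₀] with s ⟨κ, hκ⟩
      change Option.map _ (specialize Γ.pos ho hQ (S.hom s₀) (S.hom s)) = some κ at hκ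
      obtain ⟨f, hf, rfl⟩ := Option.map_eq_some_iff.1 hκ
      refine ⟨𝟙 _, QD.st.map (Hom.π f), rfl, ?_, ?_⟩
      · change Option.map _ (Option.map _ (specialize Γ.pos ho hQ (S.hom s₀) (S.hom s))) = _
        rw [hf]; rfl
      · exact (Category.id_comp _).trans (Hom.comm f).symm)

lemma ρ_map_eqToHom {j j' : Jac Q Γ o} (h : j = j')
    (h' : toFull.obj (rep Γ.pos ho hQ j) = toFull.obj (rep Γ.pos ho hQ j')) :
    (rep Γ.pos ho hQ j).ρ.hom ≫ (Q.ι ⋙ QD.st).map (eqToHom h') = (rep Γ.pos ho hQ j').ρ.hom := by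
  subst h
  rw [eqToHom_refl, CategoryTheory.Functor.map_id]
  exact Category.comp_id _

/-- Once the two points are identified, `f` is an endomorphism fixing a point of the polytope, hence
the identity by rigidity. -/
lemma map_toFull_eq_eqToHom {j j' : Jac Q Γ o} (h : j = j')
    (f : rep Γ.pos ho hQ j ⟶ rep Γ.pos ho hQ j')
    (hf : mapP o Γ.pos f (repPt Γ.pos ho hQ j') = repPt Γ.pos ho hQ j)
    (h' : toFull.obj (rep Γ.pos ho hQ j) = toFull.obj (rep Γ.pos ho hQ j')) :
    toFull.map f = eqToHom h' := by
  subst h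
  obtain rfl : f = 𝟙 _ := eq_of_mapP_eq ho Γ.pos (hf.trans (mapP_id o Γ.pos _ _).symm)
  rfl

instance (S : Over (Jac Q Γ o)) : IsIso (squareApp ho hQ S) := by
  have : IsIso (Realization.Hom.base (squareApp ho hQ S)) := inferInstanceAs (IsIso (𝟙 S.left))
  exact Realization.isIso_of_base _

/-- the curves that correspond to points of the Jacobian have stabilization `Γ` -/
noncomputable def square :
    Over.map (TopCat.isTerminalPUnit.from (Jac Q Γ o)) ⋙ Realization.point Γ ≅
      (family Γ.pos ho hQ).classify ⋙ Phi Q :=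
  NatIso.ofComponents (fun S => asIso (squareApp ho hQ S)) fun f =>
    Realization.Hom.ext' rfl fun s => heq_of_eq ((Category.id_comp _).trans
      (ρ_map_eqToHom ho hQ (Fam.hom_left f s)
        ((family Γ.pos ho hQ).pt_hom_left f s)).symm)

/-- the comparison functor from spaces over the Jacobian to the fibre product -/
noncomputable abbrev comparison : Over (Jac Q Γ o) ⥤
    Limits.CategoricalPullback (Realization.point Γ) (Phi Q) :=
  (Limits.CategoricalPullback.CatCommSqOver.toFunctorToCategoricalPullback
    (Realization.point Γ) (Phi Q) (Over (Jac Q Γ o))).obj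
      ⟨_, (family Γ.pos ho hQ).classify, square ho hQ⟩

instance faithful_comparison : (comparison (Q := Q) ho hQ).Faithful where
  map_injective {S S'} f f' h := by
    have h1 : Realization.Hom.base ((comparison ho hQ).map f).snd
      = Realization.Hom.base ((comparison ho hQ).map f').snd := by rw [h]
    exact Over.OverMorphism.ext h1

/-- The compatibility `k.w` with the identifications with Γ says that the isomorphism of curves is a
morphism of `QDFib`. Since it also preserves lengths, it matches the points of the polytopes. -/
lemma exists_hom_of_fiber {S S' : Over (Jac Q Γ o)}
    (k : (comparison ho hQ).obj S ⟶ (comparison ho hQ).obj S') (s : S.left) :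
    ∃ f : rep Γ.pos ho hQ (S.hom s) ⟶
        rep Γ.pos ho hQ (S'.hom (Realization.Hom.base k.snd s)),
      mapP o Γ.pos f (repPt Γ.pos ho hQ _) = repPt Γ.pos ho hQ (S.hom s) ∧
      toFull.map f = (Realization.Hom.φ k.snd s).hom := by
  have hb : k.fst.left = Realization.Hom.base k.snd :=
    (Category.comp_id _).symm.trans ((congrArg Realization.Hom.base k.w).trans (Category.id_comp _))
  have h1 := Realization.Hom.heq_φ k.w s
  have h2 : HEq (rep Γ.pos ho hQ (S'.hom (k.fst.left s))).ρ.hom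
      (rep Γ.pos ho hQ (S'.hom (Realization.Hom.base k.snd s))).ρ.hom := by
    rw [hb]; exact HEq.rfl
  have h3 : (rep Γ.pos ho hQ (S.hom s)).ρ.hom ≫
      QD.st.map (Q.ι.map (Realization.Hom.φ k.snd s).hom) =
      (rep Γ.pos ho hQ (S'.hom (Realization.Hom.base k.snd s))).ρ.hom :=
    (eq_of_heq (h2.symm.trans ((heq_of_eq (Category.id_comp _).symm).trans h1))).symm
  refine ⟨⟨Q.ι.map (Realization.Hom.φ k.snd s).hom, h3⟩, ?_, rfl⟩
  exact (mapP_eq_iff ho Γ.pos _).2 (Realization.Hom.isom k.snd s)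

/-- By `exists_hom_of_fiber` the curves at `s` and at its image represent the same point of the
colimit, so the base map is a map over the Jacobian. The isomorphisms of curves are then the
canonical ones by `map_toFull_eq_eqToHom`. -/
instance full_comparison : (comparison (Q := Q) ho hQ).Full where
  map_surjective {S S'} k := by
    have hw : ∀ s, S'.hom (Realization.Hom.base k.snd s) = S.hom s := by
      intro s
      obtain ⟨f, hf, _⟩ := exists_hom_of_fiber ho hQ k s
      exact (glue_repPt Γ.pos ho hQ _).symm.trans ((glue_mapP Γ.pos f _).symm.trans
        ((congrArg (glue Γ.pos _) hf).trans (glue_repPt Γ.pos ho hQ _)))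
    let m : S ⟶ S' := Over.homMk (Realization.Hom.base k.snd)
      (TopCat.hom_ext (ContinuousMap.ext hw))
    have hb : k.fst.left = Realization.Hom.base k.snd :=
      (Category.comp_id _).symm.trans
        ((congrArg Realization.Hom.base k.w).trans (Category.id_comp _))
    refine ⟨m, Limits.CategoricalPullback.hom_ext (Over.OverMorphism.ext hb.symm)
      (Realization.Hom.ext' rfl fun s => ?_)⟩
    obtain ⟨f, hf, hf'⟩ := exists_hom_of_fiber ho hQ k s
    exact heq_of_eq ((map_toFull_eq_eqToHom ho hQ (hw s).symm f hf
      ((family Γ.pos ho hQ).pt_hom_left m s)).symm.trans hf')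

section point

variable (y : Limits.CategoricalPullback (Realization.point Γ) (Phi Q))

/-- the base of a point of the fibre product, as a map to the base of the family of curves -/
abbrev fiberBase : y.fst.left ⟶ y.snd.T := Realization.Hom.base y.iso.hom

instance isIso_fiberBase : IsIso (fiberBase y) :=
  inferInstanceAs (IsIso (Realization.proj.map y.iso.hom))

/-- the curve over a point of the fibre product -/
noncomputable def fiberObj (s : y.fst.left) : QDFib Q Γ.x where
  obj := (y.snd.fam.pt (fiberBase y s)).x.obj
  prop := (y.snd.fam.pt (fiberBase y s)).x.property
  ρ := Realization.Hom.φ y.iso.hom s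

/-- the edge lengths of the curve over a point of the fibre product -/
noncomputable def fiberLen (s : y.fst.left) : (fiberObj y s).obj.G.E → ℝ :=
  (y.snd.fam.pt (fiberBase y s)).d

lemma adapted_fiberLen (s : y.fst.left) : (fiberObj y s).Adapted Γ.d (fiberLen y s) :=
  Realization.Hom.isom y.iso.hom s

lemma fiberLen_pos (s : y.fst.left) (e) : 0 < fiberLen y s e :=
  (y.snd.fam.pt (fiberBase y s)).pos e

lemma exists_fiberPt (s : y.fst.left) :
    ∃ p : (fiberObj y s).P o Γ.d, lens ho p = (fiberObj y s).obj.G.len (fiberLen y s) := by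
  refine (adapted_fiberLen y s).exists_point ho fun x => ?_
  unfold MGraph.len
  split
  · exact (fiberLen_pos y s _).le
  · exact le_rfl

/-- the point of a polytope given by a point of the fibre product -/
noncomputable def fiberPt (s : y.fst.left) : (fiberObj y s).P o Γ.d :=
  (exists_fiberPt ho y s).choose

lemma lens_fiberPt (s : y.fst.left) :
    lens ho (fiberPt ho y s) = (fiberObj y s).obj.G.len (fiberLen y s) :=
  (exists_fiberPt ho y s).choose_spec

/-- the point of the Jacobian given by a point of the fibre product -/
noncomputable def fiberGlue (s : y.fst.left) : Jac Q Γ o := glue Γ.pos _ (fiberPt ho y s)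

/-- the comparison of the curve over a point of the fibre product with the one over the
corresponding point of the Jacobian -/
noncomputable def fiberRep (s : y.fst.left) :
    fiberObj y s ⟶ rep Γ.pos ho hQ (fiberGlue ho y s) :=
  (exists_hom_rep Γ.pos ho hQ (p := fiberPt ho y s) rfl).choose

lemma mapP_fiberRep (s : y.fst.left) :
    mapP o Γ.pos (fiberRep ho hQ y s) (repPt Γ.pos ho hQ (fiberGlue ho y s)) = fiberPt ho y s :=
  (exists_hom_rep Γ.pos ho hQ (p := fiberPt ho y s) rfl).choose_spec

lemma repLens_fiberRep (s : y.fst.left) (x : (fiberObj y s).obj.G.X) :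
    repLens Γ.pos ho hQ (fiberGlue ho y s) ((gr (fiberRep ho hQ y s)).f x)
      = lens ho (fiberPt ho y s) x :=
  (lens_mapP ho Γ.pos (fiberRep ho hQ y s) _ x).symm.trans
    (congrFun (congrArg (lens ho) (mapP_fiberRep ho hQ y s)) x)

/-- The curve over `s` has only positive lengths and the comparison preserves lengths, so no edge
can be contracted. -/
instance isIso_fiberRep (s : y.fst.left) : IsIso (fiberRep ho hQ y s) := by
  refine isIso_of_not_contracts _ fun x hx => ?_
  by_contra hc
  have h1 : 0 = (fiberObj y s).obj.G.len (fiberLen y s) x :=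
    (lens_vertex ho _ hx).symm.trans ((repLens_fiberRep ho hQ y s x).trans
      (congrFun (lens_fiberPt ho y s) x))
  by_cases hi : (fiberObj y s).obj.G.i x = x
  · exact (gr (fiberRep ho hQ y s)).not_leg_flag hi hc hx
  · rw [MGraph.len_half _ hi] at h1
    exact (fiberLen_pos y s _).ne h1

/-- The specialization map of the given family commutes with the identifications with the constant
family Γ, so it is a morphism of `QDFib`. The estimate on lengths comes from `eventually_near`, and
yields continuity of the classifying map by `exists_near_mem`. -/
lemma eventually_fiber_near (s₀ : y.fst.left) {δ : ℝ} (hδ : 0 < δ) :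
    ∀ᶠ s in 𝓝 s₀, ∃ κ : fiberObj y s ⟶ fiberObj y s₀,
      y.snd.fam.sp (fiberBase y s₀) (fiberBase y s)
        = some (toFull.map κ) ∧
      Near Γ.pos ho hQ δ (fiberPt ho y s) (κ ≫ fiberRep ho hQ y s₀) := by
  have h := (Realization.Hom.base y.iso.hom).hom.continuous.continuousAt (x := s₀)
  filter_upwards [h.eventually (y.snd.fam.eventually_near _ hδ),
    Realization.Hom.germ y.iso.hom s₀] with s ⟨κ, h1, h2⟩ ⟨κ₁, κ₂, h3, h4, h5⟩
  have h6 : κ₂ = QD.st.map (Q.ι.map κ) := by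
    change Option.map _ (y.snd.fam.sp _ _) = _ at h4
    rw [h1] at h4
    exact (Option.some.inj h4).symm
  -- The specialization maps of the constant family are identities, so the germ condition becomes
  -- compatibility with ρ.
  obtain rfl : 𝟙 _ = κ₁ := Option.some.inj h3
  have h5 := (Category.id_comp (Realization.Hom.φ y.iso.hom s₀).hom).symm.trans h5
  refine ⟨⟨Q.ι.map κ, ?_⟩, h1, fun x => ?_⟩
  · subst h6
    exact h5.symm
  · have h7 := repLens_fiberRep ho hQ y s₀
    refine lt_of_eq_of_lt ?_ (h2 x)
    congr 2
    · rw [lens_fiberPt]; rfl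
    · refine (h7 _).trans ?_
      rw [lens_fiberPt]; rfl

include hQ in
lemma continuous_fiberGlue : Continuous (fiberGlue ho y : y.fst.left → Jac Q Γ o) := by
  refine continuous_iff_continuousAt.2 fun s₀ => ?_
  rw [ContinuousAt, (nhds_basis_opens _).tendsto_right_iff]
  rintro U ⟨hU₀, hU⟩
  obtain ⟨δ, hδ, h⟩ := exists_near_mem Γ.pos ho hQ _ hU hU₀
  filter_upwards [eventually_fiber_near ho hQ y s₀ hδ] with s ⟨κ, _, hκ⟩
  exact h _ _ _ hκ

lemma compat_inv_fiberRep (s : y.fst.left) :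
    (gr (inv (fiberRep ho hQ y s))).Compat
      ((rep Γ.pos ho hQ (fiberGlue ho y s)).edgeLen ho (repPt Γ.pos ho hQ (fiberGlue ho y s)))
      (fiberLen y s) := by
  intro x
  have h1 := repLens_fiberRep ho hQ y s ((gr (inv (fiberRep ho hQ y s))).f x)
  have h2 : (gr (fiberRep ho hQ y s)).f ((gr (inv (fiberRep ho hQ y s))).f x) = x :=
    congrFun (congrArg (fun k => (gr k).f) (IsIso.inv_hom_id (fiberRep ho hQ y s))) x
  rw [h2] at h1
  exact h1.trans (congrFun (lens_fiberPt ho y s) _)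

/-- The given specialization map, transported along the comparison isomorphisms, changes lengths by
less than the gap. By uniqueness it is the specialization map of the universal family. -/
lemma germ_fiberRep (s₀ : y.fst.left) : ∀ᶠ s in 𝓝 s₀, ∃ κ κ',
    (specialize Γ.pos ho hQ (fiberGlue ho y s₀) (fiberGlue ho y s)).map (fun κ => toFull.map κ)
      = some κ ∧
    y.snd.fam.sp (fiberBase y s₀) (fiberBase y s) = some κ' ∧
    κ ≫ toFull.map (inv (fiberRep ho hQ y s₀)) = toFull.map (inv (fiberRep ho hQ y s)) ≫ κ' := by
  filter_upwards [eventually_fiber_near ho hQ y s₀ (gap_pos Γ.pos)] with s ⟨κ, h1, h2⟩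
  have h3 : specialize Γ.pos ho hQ (fiberGlue ho y s₀) (fiberGlue ho y s)
      = some (inv (fiberRep ho hQ y s) ≫ κ ≫ fiberRep ho hQ y s₀) := by
    refine specialize_eq Γ.pos ho hQ (near_of_comp Γ.pos ho hQ (k := fiberRep ho hQ y s) ?_)
    rw [IsIso.hom_inv_id_assoc]
    have h4 := mapP_fiberRep ho hQ y s
    exact h4 ▸ h2
  refine ⟨toFull.map (inv (fiberRep ho hQ y s) ≫ κ ≫ fiberRep ho hQ y s₀), toFull.map κ,
    by rw [h3]; rfl, h1, ?_⟩
  refine (toFull.map_comp _ (inv (fiberRep ho hQ y s₀))).symm.trans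
    (Eq.trans ?_ (toFull.map_comp (inv (fiberRep ho hQ y s)) κ))
  simp

end point

/-- The given family is isomorphic to the pull-back of the universal family along the continuous map
`fiberGlue`. The isomorphisms `fiberRep` provide this pointwise, and `isIso_of_base` makes it an
isomorphism of families. -/
instance essSurj_comparison : (comparison (Q := Q) ho hQ).EssSurj where
  mem_essImage y := by
    let S : Over (Jac Q Γ o) := Over.mk (Y := y.fst.left)
      (TopCat.ofHom ⟨fiberGlue ho y, continuous_fiberGlue ho hQ y⟩)
    let m : (family Γ.pos ho hQ).classify.obj S ⟶ y.snd := Realization.Hom.mk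
      (A := (family Γ.pos ho hQ).classify.obj S) (fiberBase y)
      (fun (s : y.fst.left) => (toFull.mapIso (asIso (fiberRep ho hQ y s))).symm)
      (compat_inv_fiberRep ho hQ y) (germ_fiberRep ho hQ y)
    have hm : IsIso m := by
      have : IsIso (Realization.Hom.base m) := isIso_fiberBase y
      exact Realization.isIso_of_base _
    let k : (comparison ho hQ).obj S ⟶ y :=
      { fst := (Over.isoMk (Iso.refl y.fst.left)).hom
        snd := m
        w := Realization.Hom.ext' ((Category.id_comp (fiberBase y)).trans
            (Category.id_comp (fiberBase y)).symm) fun (s : y.fst.left) => heq_of_eq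
              ((Category.id_comp _).trans (inv (fiberRep ho hQ y s)).comm.symm) }
    have hk : IsIso k := by
      rw [Limits.CategoricalPullback.isIso_iff]
      exact ⟨(Over.isoMk (Iso.refl y.fst.left)).isIso_hom, hm⟩
    exact ⟨S, ⟨asIso k⟩⟩

include ho hQ in
/-- If `Q` is closed under specialization, then the Jacobian is the fibre product. -/
theorem isFiber_of_push : IsFiber Q Γ o :=
  ⟨(family Γ.pos ho hQ).classify, square ho hQ,
    { faithful := faithful_comparison ho hQ
      full := full_comparison ho hQ
      essSurj := essSurj_comparison ho hQ }⟩

end QDFib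

end Trop

/-! ### Degree, simplicity and semistability are preserved by push-forward -/

namespace Trop

open CategoryTheory Topology

namespace MGraph.Hom

variable {n : ℕ} {G₁ G₂ : MGraph n}

/-- the image of a vertex -/
def vert (π : Hom G₁ G₂) (w : G₁.V) : G₂.V := ⟨π.f w.1, π.map_vertex w.2⟩

open scoped Classical in
lemma sum_push {M : Type*} [AddCommMonoid M] (π : Hom G₁ G₂) (D₁ : G₁.V → M) (D₂ : G₂.V → M)
    (h : ∀ v, D₂ v = ∑ w : G₁.V, if π.f w.1 = v.1 then D₁ w else 0) (S : Finset G₂.V) :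
    ∑ v ∈ S, D₂ v = ∑ w ∈ Finset.univ.filter fun w => π.vert w ∈ S, D₁ w := by
  rw [Finset.sum_congr rfl fun v _ => h v, Finset.sum_comm, Finset.sum_filter]
  refine Finset.sum_congr rfl fun w _ => ?_
  have e : ∀ v ∈ S, (if π.f w.1 = v.1 then D₁ w else 0)
      = if π.vert w = v then D₁ w else 0 := fun v _ =>
    if_congr (Subtype.ext_iff (a1 := π.vert w)).symm rfl rfl
  rw [Finset.sum_congr rfl e, Finset.sum_ite_eq]

-- An edge in the cut of the preimage has ends with different images, so it is not contracted and
-- maps to an edge of the cut of `S`. Different edges that are not contracted have different images.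
open scoped Classical in
lemma cut_le (π : Hom G₁ G₂) (S : Finset G₂.V) :
    G₁.cut (Finset.univ.filter fun w => π.vert w ∈ S) ≤ G₂.cut S := by
  unfold cut
  refine Finset.card_le_card_of_forall_subsingleton
    (fun e e' => ∃ x hx hy, G₁.edge x hx = e ∧ G₂.edge (π.f x) hy = e') ?_ ?_
  · intro e he
    obtain ⟨x, hx, rfl, h1, h2⟩ := (Finset.mem_filter.1 he).2
    have h1' := (Finset.mem_filter.1 h1).2
    have h2' : π.vert ⟨G₁.r (G₁.i x), G₁.r_r _⟩ ∉ S := fun h =>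
      h2 (Finset.mem_filter.2 ⟨Finset.mem_univ _, h⟩)
    have e1 : π.vert ⟨G₁.r x, G₁.r_r x⟩ = ⟨G₂.r (π.f x), G₂.r_r _⟩ := Subtype.ext (π.map_r x)
    have e2 : π.vert ⟨G₁.r (G₁.i x), G₁.r_r _⟩ = ⟨G₂.r (G₂.i (π.f x)), G₂.r_r _⟩ :=
      Subtype.ext ((π.map_r _).trans (congrArg _ (π.map_i x)))
    rw [e1] at h1'
    rw [e2] at h2'
    have hy : G₂.i (π.f x) ≠ π.f x := fun hc => h2' (by simpa only [hc] using h1')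
    exact ⟨_, Finset.mem_filter.2 ⟨Finset.mem_univ _, _, hy, rfl, h1', h2'⟩, x, hx, hy, rfl, rfl⟩
  · rintro e' - _ ⟨-, x, hx, hx', rfl, rfl⟩ _ ⟨-, y, hy, hy', rfl, h⟩
    have hf := flag_of_half hx'
    refine (edge_eq_iff hx hy).2 ?_
    rcases (edge_eq_iff hx' hy').1 h.symm with h | h
    · exact Or.inl (π.eq_of_flag hf h)
    · right
      rw [← π.map_i] at h
      exact π.eq_of_flag (by rw [π.map_i]; exact flag_of_half (half_i hx')) h

end MGraph.Hom

namespace QD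

variable {g n : ℕ} {A B : QD g n}

/-- Nonexceptional vertices are the vertices of the stabilization, and the stabilized morphism is
surjective on vertices. -/
lemma exists_nexc_vertex (f : A ⟶ B) {w : B.G.X} (hw : B.G.r w = w) (he : ¬ B.G.Exc w) :
    ∃ v, A.G.r v = v ∧ ¬ A.G.Exc v ∧ MGraph.Hom.f (Hom.π f) v = w := by
  obtain ⟨v, hv, hvw⟩ := MGraph.Hom.exists_vertex (SG.Hom.π (QD.st.map f))
    (w := B.qs.toSt (x := w) (by rwa [hw])) (Subtype.ext hw)
  have hr : A.G.r v.1 = v.1 := congrArg Subtype.val hv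
  have hn : ¬ A.G.Exc v.1 := by
    have := v.2
    rwa [hr] at this
  refine ⟨v.1, hr, hn, ?_⟩
  rw [← MGraph.Hom.stFun_nexc _ (by rwa [MGraph.Hom.i_vertex hr, hr])]
  exact congrArg Subtype.val hvw

lemma deg_eq (f : A ⟶ B) : A.deg = B.deg := by
  classical
  have h := MGraph.Hom.sum_push (Hom.π f) _ _ (Hom.push f) Finset.univ
  rw [Finset.filter_true_of_mem fun _ _ => Finset.mem_univ _] at h
  exact h.symm

/-- Nonexceptional vertices stay nonexceptional, so paths avoiding exceptional vertices map to such
paths; their end points can be lifted by `exists_nexc_vertex`. -/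
lemma IsSimple.of_hom (h : A.IsSimple) (f : A ⟶ B) : B.IsSimple := by
  have hS : ∀ x ∈ {x | ¬ A.G.Exc (A.G.r x) ∧ ¬ A.G.Exc (A.G.r (A.G.i x))},
      MGraph.Hom.f (Hom.π f) x ∈ {x | ¬ B.G.Exc (B.G.r x) ∧ ¬ B.G.Exc (B.G.r (B.G.i x))} := by
    rintro x ⟨h1, h2⟩
    refine ⟨?_, ?_⟩
    · rw [← MGraph.Hom.map_r]
      exact MGraph.Hom.nexc_map A.qs _ h1
    · rw [← MGraph.Hom.map_i, ← MGraph.Hom.map_r]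
      exact MGraph.Hom.nexc_map A.qs _ h2
  refine ⟨?_, fun a ha b hb hra hrb => ?_⟩
  · obtain ⟨v, hv, hrv⟩ := h.1
    exact ⟨_, hS v hv, MGraph.Hom.map_vertex _ hrv⟩
  · have hmem : ∀ {v : A.G.X}, A.G.r v = v → ¬ A.G.Exc v →
        v ∈ {x | ¬ A.G.Exc (A.G.r x) ∧ ¬ A.G.Exc (A.G.r (A.G.i x))} := fun hv he =>
      ⟨by rwa [hv], by rwa [MGraph.Hom.i_vertex hv, hv]⟩
    have ha' := ha.1
    have hb' := hb.1
    rw [hra] at ha'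
    rw [hrb] at hb'
    obtain ⟨a', ha1, ha2, rfl⟩ := exists_nexc_vertex f hra ha'
    obtain ⟨b', hb1, hb2, rfl⟩ := exists_nexc_vertex f hrb hb'
    exact MGraph.Hom.step_image _ hS (h.2 a' (hmem ha1 ha2) b' (hmem hb1 hb2) ha1 hb1)

-- Only exceptional vertices, where the condition vanishes, lie over an exceptional vertex. Over
-- other vertices the exceptional ones contribute nothing, and the rest is the compatibility of `s`
-- with the stabilized morphism.
open scoped Classical in
lemma ext_push (s : StabCond g n) (f : A ⟶ B) (v : B.G.V) :
    s.ext B v = ∑ w : A.G.V, if MGraph.Hom.f (Hom.π f) w.1 = v.1 then s.ext A w else 0 := by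
  by_cases hv : B.G.Exc v.1
  · rw [StabCond.ext, dif_pos hv, Finset.sum_eq_zero]
    intro w _
    split_ifs with h
    · rw [StabCond.ext, dif_pos]
      by_contra hc
      rw [← w.2] at hc
      refine MGraph.Hom.nexc_map A.qs (Hom.π f) hc ?_
      rwa [w.2, h]
    · rfl
  · rw [StabCond.ext, dif_neg hv, s.push (QD.st.map f)]
    refine Fintype.sum_of_injective
      (fun w : (QD.st.obj A).G.V => (⟨w.1.1, congrArg Subtype.val w.2⟩ : A.G.V))
      (fun w w' h => Subtype.ext (Subtype.ext (congrArg (fun u : A.G.V => u.1) h))) _ _ ?_ ?_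
    · intro w hw
      have he : A.G.Exc w.1 := by
        by_contra he
        exact hw ⟨⟨⟨w.1, by rwa [w.2]⟩, Subtype.ext w.2⟩, rfl⟩
      rw [StabCond.ext, dif_pos he, ite_self]
    · intro w
      have hr : A.G.r w.1.1 = w.1.1 := congrArg Subtype.val w.2
      have hn : ¬ A.G.Exc w.1.1 := by
        have := w.1.2
        rwa [hr] at this
      have e : MGraph.Hom.stFun (Hom.π f) w.1.1 = MGraph.Hom.f (Hom.π f) w.1.1 :=
        MGraph.Hom.stFun_nexc _ (by rwa [MGraph.Hom.i_vertex hr, hr])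
      rw [StabCond.ext, dif_neg hn, ← e]
      exact if_congr Subtype.ext_iff rfl rfl

/-- The preimage of a set of vertices has the same values of the divisor and of the stability
condition, and its cut is no larger, so its inequalities imply those for the set. -/
lemma IsSemistable.of_hom {s : StabCond g n} (h : A.IsSemistable s) (f : A ⟶ B) :
    B.IsSemistable s := by
  classical
  have h1 := MGraph.Hom.sum_push (Hom.π f) _ _ (ext_push s f)
  have h2 := MGraph.Hom.sum_push (Hom.π f) _ _ (Hom.push f)
  refine ⟨?_, fun S => ?_⟩
  · rw [← deg_eq f, h.1, h1, Finset.filter_true_of_mem fun _ _ => Finset.mem_univ _]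
  · have h3 := h.2 (Finset.univ.filter fun w => MGraph.Hom.vert (Hom.π f) w ∈ S)
    have h4 : (A.G.cut _ : ℝ) ≤ B.G.cut S := Nat.cast_le.2 (MGraph.Hom.cut_le (Hom.π f) S)
    rw [h1, h2]
    constructor <;> linarith [h3.1, h3.2]

end QD

end Trop
theorem theoremT {g n : ℕ} (Γ : Trop.StableCurve g n) (o : Γ.x.G.E → Γ.x.G.H)
    (ho : ∀ e, Γ.x.G.edge (o e).1 (o e).2 = e) :
    Trop.IsFiber (fun _ => True) Γ o ∧
    (∀ d : ℤ, Trop.IsFiber (fun A => A.deg = d) Γ o) ∧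
    Trop.IsFiber (fun A => A.IsSimple) Γ o ∧
    (∀ d : ℤ, Trop.IsFiber (fun A => A.IsSimple ∧ A.deg = d) Γ o) ∧
    (∀ φ : Trop.StabCond g n, Trop.IsFiber (fun A => A.IsSemistable φ) Γ o) :=
  ⟨Trop.QDFib.isFiber_of_push ho fun _ _ => trivial,
    fun _ => Trop.QDFib.isFiber_of_push ho fun f h => (Trop.QD.deg_eq f).symm.trans h,
    Trop.QDFib.isFiber_of_push ho fun f h => h.of_hom f,
    fun _ => Trop.QDFib.isFiber_of_push ho fun f h =>
      ⟨h.1.of_hom f, (Trop.QD.deg_eq f).symm.trans h.2⟩,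
    fun _ => Trop.QDFib.isFiber_of_push ho fun f h => h.of_hom f⟩
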